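/- **Setting.** Let $\Gamma$ be an infinite group with a finite symmetric generating set $S$, $1\notin S$, and let $G=\mathrm{Cay}(\Gamma,S)$ be the Cayley graph with vertex set $\Gamma$ and edge set $E=\{\{g,gs\}: g\in\Gamma, s\in S\}$. Let $H\le\Gamma$ be a subgroup of finite index that is left-orderable (it has a left-invariant strict total order). Let $(A_r)$ be an exhaustive Følner sequence: finite non-empty sets $A_r\subseteq A_{r+1}$ with $\bigcup_r A_r=\Gamma$ and $|\partial A_r|/|A_r|\to 0$, where $\partial W=\{u\in W: u \text{ has a neighbour outside } W\}$ (so $\Gamma$ is amenable). Let $p\in(0,1)$ and let $\omega\in\{0,1\}^E$ be Bernoulli($p$) bond percolation with law $\mathbb P_p$. For $A\subseteq\Gamma$ let $G(\omega;A)$ be the graph with vertex set $A$ whose edges are the open edges with both endpoints in $A$. A *local graph simplicial complex rule* $\Delta$ over $G$ assigns to each subgraph $K\subseteq G$ a simplicial complex $\Delta(K)$ (a family of finite non-empty sets closed under passing to non-empty subsets) on vertices of $K$, such that: (equivariance) $\Delta(\varphi(K))=\varphi(\Delta(K))$ for all $\varphi\in\mathrm{Aut}(G)$; (monotonicity) $K\subseteq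 L$ implies $\Delta(K)\subseteq\Delta(L)$; (connectivity) the vertices of each simplex of $\Delta(K)$ lie in one connected component of $K$; (confinement) there is $T\ge0$ such that every $\sigma\in\Delta(K)$ belongs to $\Delta(K_\sigma)$ for some non-empty subgraph $K_\sigma\subseteq K$ whose vertices are at pairwise $G$-distance at most $T$. The clique complex and the neighbor complex are examples. Fix such a $\Delta$ and $k\ge 0$. Let $\beta_k(\omega,A)$ be the $k$-th Betti number (dimension of the unreduced simplicial homology with real coefficients) of $\Delta(G(\omega;A))$, and $\beta_k^r=\beta_k(\omega,A_r)$. For $e\in E$ let $\omega^e$ be $\omega$ with the state of $e$ replaced by an independent copy, and $D_e(\omega,A)=\beta_k(\omega,A)-\beta_k(\omega^e,A)$. For a total order $\preccurlyeq$ on $E$ let $\mathcal F_e=\sigma(\omega(f): f\preccurlyeq e)$. A set $\tilde E\subseteq E$ is *$H$-fundamental* if each $e\in E$ satisfies $he\in\tilde E$ for some $h\in H$. **Theorem.** There is $\sigma^2\ge 0$ such that, as $r\to\infty$, 1. $\displaystyle \frac{1}{|A_r|}\mathrm{Var}_p(\beta_k^r)\to\sigma^2$; 2. $\displaystyle |A_r|^{-1/2}\bigl(\beta_k^r-\mathbb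 E_p[\beta_k^r]\bigr)\Longrightarrow\mathcal N(0,\sigma^2)$ in distribution (with $\mathcal N(0,0)=\delta_0$). Moreover there is a finite $H$-fundamental set of edges $\tilde E$, and for each $e\in E$ there is a square-integrable random variable $D_e^\infty$ such that $D_e(\omega,xA_r)\to D_e^\infty$ in probability as $r\to\infty$ for every $x\in\Gamma$; and $E$ has a total order that is invariant under left translation by $H$, and for every such order $$\sigma^2=\frac{1}{2[\Gamma:H]}\sum_{e\in\tilde E}\mathbb E_p\Bigl[\mathbb E_p\bigl[D_e^\infty\mid\mathcal F_e\bigr]^2\Bigr].$$ -/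

import Mathlib

open MeasureTheory ProbabilityTheory Filter Topology
open scoped NNReal

noncomputable section

namespace PercHom

/-! ### Simplicial homology with real coefficients -/

section Homology

variable {V : Type*}

/-- The chain space `ℝ[V]` of formal combinations of vertices. -/
abbrev VertexSpace (V : Type*) : Type _ := V →₀ ℝ

/-- The oriented simplex `[v₀, …, vₙ₋₁]`, realised as the wedge `v₀ ∧ ⋯ ∧ vₙ₋₁`:
a permutation of the vertices multiplies it by its sign, and oriented simplices on
different vertex sets are linearly independent. -/
def orientedSimplex {n : ℕ} (v : Fin n → V) : ExteriorAlgebra ℝ (VertexSpace V) :=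
  ExteriorAlgebra.ιMulti ℝ n fun i => Finsupp.single (v i) (1 : ℝ)

/-- The linear functional on `ℝ[V]` that is `1` at each vertex. -/
def augmentation (V : Type*) : Module.Dual ℝ (VertexSpace V) :=
  Finsupp.linearCombination ℝ fun _ : V => (1 : ℝ)

/-- The boundary operator, `∂[v₀, …, vₙ] = ∑ᵢ (-1)ⁱ [v₀, …, v̂ᵢ, …, vₙ]`
(see `boundary_orientedSimplex`), as the contraction with the augmentation. -/
def boundary (V : Type*) :
    ExteriorAlgebra ℝ (VertexSpace V) →ₗ[ℝ] ExteriorAlgebra ℝ (VertexSpace V) :=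
  CliffordAlgebra.contractLeft (augmentation V)

theorem orientedSimplex_succ {n : ℕ} (v : Fin (n + 1) → V) :
    orientedSimplex v =
      ExteriorAlgebra.ι ℝ (Finsupp.single (v 0) (1 : ℝ)) *
        orientedSimplex (fun i => v i.succ) := by
  unfold orientedSimplex
  rw [ExteriorAlgebra.ιMulti_succ_apply]
  rfl

theorem boundary_orientedSimplex {n : ℕ} (v : Fin (n + 1) → V) :
    boundary V (orientedSimplex v) =
      ∑ i : Fin (n + 1), (-1 : ℝ) ^ (i : ℕ) • orientedSimplex (fun j => v (i.succAbove j)) := by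
  induction n with
  | zero =>
    rw [orientedSimplex_succ, boundary, ExteriorAlgebra.ι, CliffordAlgebra.contractLeft_ι_mul]
    simp [orientedSimplex, augmentation]
  | succ n ih =>
    rw [orientedSimplex_succ, boundary, ExteriorAlgebra.ι, CliffordAlgebra.contractLeft_ι_mul]
    have h := ih fun i => v i.succ
    rw [boundary] at h
    rw [h, Fin.sum_univ_succ (n := n + 1), Finset.mul_sum, sub_eq_add_neg,
      ← Finset.sum_neg_distrib]
    congr 1
    · simp [augmentation]
    · refine Finset.sum_congr rfl fun i _ => ?_
      rw [orientedSimplex_succ (fun j => v (i.succ.succAbove j))]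
      simp [pow_succ, ExteriorAlgebra.ι]

/-- The space of `n`-chains of `K`: the span of the oriented `n`-simplices of `K`. -/
def chains (K : PreAbstractSimplicialComplex V) (n : ℕ) :
    Submodule ℝ (ExteriorAlgebra ℝ (VertexSpace V)) :=
  Submodule.span ℝ
    {c | ∃ v : Fin (n + 1) ↪ V, Finset.univ.map v ∈ K ∧ orientedSimplex v = c}

/-- The `n`-cycles of `K` (homology is not reduced: every `0`-chain is a cycle). -/
def cycles (K : PreAbstractSimplicialComplex V) :
    ℕ → Submodule ℝ (ExteriorAlgebra ℝ (VertexSpace V))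
  | 0 => chains K 0
  | n + 1 => chains K (n + 1) ⊓ LinearMap.ker (boundary V)

/-- The `n`-boundaries of `K`: the image of the `(n+1)`-chains. -/
def boundaries (K : PreAbstractSimplicialComplex V) (n : ℕ) :
    Submodule ℝ (ExteriorAlgebra ℝ (VertexSpace V)) :=
  (chains K (n + 1)).map (boundary V)

theorem boundaries_le_chains (K : PreAbstractSimplicialComplex V) (n : ℕ) :
    boundaries K n ≤ chains K n := by
  rw [boundaries, chains, Submodule.map_span, Submodule.span_le]
  rintro _ ⟨_, ⟨v, hv, rfl⟩, rfl⟩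
  rw [boundary_orientedSimplex]
  refine Submodule.sum_mem _ fun i _ => Submodule.smul_mem _ _ (Submodule.subset_span ?_)
  refine ⟨i.succAboveEmb.trans v, ?_, rfl⟩
  refine (K.isRelLowerSet_faces hv).2 ?_ (by simp)
  intro x hx
  simp only [Finset.mem_map, Finset.mem_univ, true_and] at hx ⊢
  obtain ⟨j, rfl⟩ := hx
  exact ⟨_, rfl⟩

theorem boundaries_le_cycles (K : PreAbstractSimplicialComplex V) (n : ℕ) :
    boundaries K n ≤ cycles K n := by
  cases n with
  | zero => exact boundaries_le_chains K 0
  | succ n =>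
    refine le_inf (boundaries_le_chains K (n + 1)) ?_
    rintro _ ⟨c, -, rfl⟩
    exact CliffordAlgebra.contractLeft_contractLeft _ c

/-- The `n`-th real Betti number `dim (ker ∂ₙ / im ∂ₙ₊₁)`. -/
def betti (K : PreAbstractSimplicialComplex V) (n : ℕ) : ℕ :=
  Module.finrank ℝ (cycles K n ⧸ (boundaries K n).submoduleOf (cycles K n))

end Homology

/-! ### Local graph simplicial complex rules -/

/-- A local graph simplicial complex rule over `G`. Simplices are non-empty finite sets. -/
structure LocalComplexRule {V : Type*} (G : SimpleGraph V) where
  /-- the complex assigned to a subgraph -/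
  complex : G.Subgraph → PreAbstractSimplicialComplex V
  /-- `Δ(K)` is a complex on the vertex set of `K` -/
  subset_verts : ∀ K : G.Subgraph, ∀ σ ∈ complex K, (σ : Set V) ⊆ K.verts
  /-- `Δ(φ(K)) = φ(Δ(K))` for each automorphism `φ` of `G` -/
  equivariant : ∀ (φ : G ≃g G) (K : G.Subgraph),
    (complex (K.map φ.toHom)).faces =
      (fun σ : Finset V => σ.map φ.toEquiv.toEmbedding) '' (complex K).faces
  monotone : ∀ K L : G.Subgraph, K ≤ L → complex K ≤ complex L
  /-- the vertices of a simplex of `Δ(K)` lie in one connected component of `K` -/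
  connected : ∀ K : G.Subgraph, ∀ σ ∈ complex K, ∀ u ∈ σ, ∀ v ∈ σ, K.spanningCoe.Reachable u v
  confined : ∃ T : ℕ, ∀ K : G.Subgraph, ∀ σ ∈ complex K,
    ∃ L : G.Subgraph, L ≤ K ∧ L.verts.Nonempty ∧
      (∀ u ∈ L.verts, ∀ v ∈ L.verts, G.edist u v ≤ T) ∧ σ ∈ complex L

/-! ### Bernoulli bond percolation -/

section Percolation

variable {V : Type*} (G : SimpleGraph V)

/-- Bond configurations; `true` means open. -/
abbrev Config : Type _ := G.edgeSet → Bool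

/-- Bernoulli bond percolation: the edges are open independently with probability `p`. -/
def percolation (p : unitInterval) : Measure (Config G) :=
  Measure.infinitePi fun _ : G.edgeSet => bernoulliMeasure true false p

instance (p : unitInterval) : IsProbabilityMeasure (percolation G p) := by
  unfold percolation
  infer_instance

/-- The law of a configuration together with an independent copy of it, the copy being the
source of the resampled states. -/
def resampling (p : unitInterval) : Measure (Config G × Config G) :=
  (percolation G p).prod (percolation G p)

instance (p : unitInterval) : IsProbabilityMeasure (resampling G p) := by
  unfold resampling
  infer_instance

variable {G}

/-- `G(ω; A)`: the vertices are those of `A`, the edges are the open edges inside `A`. -/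
def openSubgraph (ω : Config G) (A : Set V) : G.Subgraph where
  verts := A
  Adj u v := u ∈ A ∧ v ∈ A ∧ ∃ h : G.Adj u v, ω ⟨s(u, v), h⟩ = true
  adj_sub h := h.2.2.1
  edge_vert h := h.1
  symm := ⟨fun u v ⟨hu, hv, h, hω⟩ => ⟨hv, hu, h.symm, by
    rw [← hω]; exact congrArg ω (Subtype.ext Sym2.eq_swap)⟩⟩

/-- `β_k(ω, A)`, the `k`-th Betti number of `Δ(G(ω; A))`. -/
def bettiFunctional (Δ : LocalComplexRule G) (k : ℕ) (ω : Config G) (A : Set V) : ℝ :=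
  betti (Δ.complex (openSubgraph ω A)) k

open Classical in
/-- `D_e(ω, A) = β_k(ω, A) - β_k(ωᵉ, A)`, where `ωᵉ` is `ω` with the state of `e` replaced by an
independent copy: for `q = (ω, ω')` the new state of `e` is `ω' e`. -/
def bettiDifference (Δ : LocalComplexRule G) (k : ℕ) (e : G.edgeSet) (A : Set V)
    (q : Config G × Config G) : ℝ :=
  bettiFunctional Δ k q.1 A - bettiFunctional Δ k (Function.update q.1 e (q.2 e)) A

/-- The σ-algebra `𝓕_e`, generated by the states `ω(f)` of the edges `f ≼ e`. -/
@[reducible]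
def edgeSigma (le : G.edgeSet → G.edgeSet → Prop) (e : G.edgeSet) :
    MeasurableSpace (Config G × Config G) :=
  ⨆ f : {f : G.edgeSet // le f e}, MeasurableSpace.comap (fun q => q.1 f.1) inferInstance

end Percolation

/-! ### Cayley graphs, orders and Følner sequences -/

section Cayley

variable {Γ : Type*} [Group Γ]

/-- The Cayley graph with edges `{g, gs}`, `s ∈ S`. -/
abbrev cayley (S : Finset Γ) : SimpleGraph Γ :=
  SimpleGraph.mulCayley (S : Set Γ)

/-- A group is left-orderable if it has a left-invariant strict total order. -/
def IsLeftOrderable (H : Type*) [Group H] : Prop :=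
  ∃ lt : H → H → Prop, IsStrictTotalOrder H lt ∧ ∀ g h k : H, lt g h → lt (k * g) (k * h)

/-- The action of left translation by `g` on the edges of a Cayley graph. -/
def edgeTranslate (S : Finset Γ) (g : Γ) (e : (cayley S).edgeSet) :
    (cayley S).edgeSet :=
  ⟨Sym2.map (g * ·) e.1, by
    obtain ⟨e, he⟩ := e
    induction e with
    | _ u v =>
      simpa only [cayley, Sym2.map_mk, SimpleGraph.mem_edgeSet,
        SimpleGraph.mulCayley_adj_mul_iff_right] using he⟩

/-- `E'` meets each orbit of `H` on the edges. -/
def IsFundamental (S : Finset Γ) (H : Subgroup Γ)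
    (E' : Finset (cayley S).edgeSet) : Prop :=
  ∀ e, ∃ h ∈ H, edgeTranslate S h e ∈ E'

/-- `le` is a total order on the edges that is invariant under left translation by `H`. -/
structure IsInvariantOrder (S : Finset Γ) (H : Subgroup Γ)
    (le : (cayley S).edgeSet → (cayley S).edgeSet → Prop) :
    Prop where
  isLinearOrder : IsLinearOrder _ le
  invariant : ∀ h ∈ H, ∀ e f, le e f → le (edgeTranslate S h e) (edgeTranslate S h f)

end Cayley

/-- The inner vertex boundary of a set of vertices. -/
def innerBoundary {V : Type*} (G : SimpleGraph V) (W : Set V) : Set V :=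
  {u ∈ W | ∃ v, v ∉ W ∧ G.Adj u v}

/-- Exhaustive Følner sequences of a graph. -/
structure IsExhaustiveFolner {V : Type*} (G : SimpleGraph V) (A : ℕ → Finset V) : Prop where
  nonempty : ∀ r, (A r).Nonempty
  folner : Tendsto (fun r => ((innerBoundary G (A r)).ncard : ℝ) / (A r).card) atTop (𝓝 0)
  mono : ∀ r, A r ⊆ A (r + 1)
  exhaust : ∀ v, ∃ r, v ∈ A r

end PercHom

end

open PercHom

/-! The Betti number of a finite window is a function of finitely many independent coins, so it can
be revealed edge by edge along any total order. Revealing `e` contributes the centred coin of `e`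
times the conditional mean, given the earlier edges, of the influence of `e`, that is, of the change
of the Betti number when `e` is switched from closed to open (`avg_insert_sub_avg`,
`sum_increment_avg_influence`). These contributions are martingale differences.

By confinement, opening one edge creates only simplices close to that edge. The chain and boundary
spaces U therefore grow to U + L with L inside a fixed finite-dimensional space, and the gain dim L
- dim (U ∩ L) is a difference of two bounded quantities that increase with the window. Hence
influences are uniformly bounded and eventually constant along the directed set of all finite
windows (`betti_sub_betti`, `exists_influence_bound`). The limit `limitInfluence` is covariant under
translations, because translating permutes the finite windows.

A left-orderable group has no element of order two, so `H` acts freely on the edges. The edges then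
embed in the product of `H` with a finite set of orbit representatives, and the lexicographic order
is `H`-invariant (`OrbitReps.exists_isInvariantOrder`). For such an order the squared limiting
martingale differences have means that are constant on orbits. The Følner property shows that each
orbit has about |A_r| / [Γ:H] edges in the window (`tendsto_orbitCount`), and that only o(|A_r|)
edges of the window are near its boundary (`tendsto_card_badEdges`). Consequently true influences
can be replaced by limiting ones at squared L² cost o(|A_r|), the averaged second moments converge,
and approximation by finite-range functions yields a weak law of large numbers for the squares. A
central limit theorem of McLeish type, proved with characteristic functions, concludes
(`norm_integral_exp_sum_increment_sub_le`, `CLTData.tendstoInDistribution`).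

The limiting resampling difference is the limiting influence times the difference of the two coins
at `e`. Its conditional expectation given the edges up to `e` is exactly the limiting martingale
difference (`condExp_resample`). One edge per orbit would give the variance with prefactor 1/[Γ:H];
the prefactor 1/(2[Γ:H]) is matched by a fundamental set with two edges per orbit. Since the limit
of the variances does not know the order, the formula holds for every invariant order. -/

noncomputable section

namespace PercHom

/-! ### Averaging over coordinates of a product measure -/

section ProductMeasure

variable {ι : Type*}

/-- The product over `ι` of copies of a measure on `Bool`. -/
abbrev coinMeasure (ι : Type*) (ν : Measure Bool) : Measure (ι → Bool) :=
  Measure.infinitePi fun _ : ι => ν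

open Classical in
/-- The configuration equal to `ω` on `J` and to `η` off `J`. -/
def mix (J : Set ι) (ω η : ι → Bool) : ι → Bool := fun i => if i ∈ J then ω i else η i

theorem mix_of_mem {J : Set ι} {i : ι} (h : i ∈ J) (ω η : ι → Bool) : mix J ω η i = ω i :=
  if_pos h

theorem mix_of_notMem {J : Set ι} {i : ι} (h : i ∉ J) (ω η : ι → Bool) : mix J ω η i = η i :=
  if_neg h

theorem measurable_mix (J : Set ι) :
    Measurable fun q : (ι → Bool) × (ι → Bool) => mix J q.1 q.2 := by
  refine measurable_pi_lambda _ fun i => ?_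
  by_cases h : i ∈ J
  · simp only [mix_of_mem h]; fun_prop
  · simp only [mix_of_notMem h]; fun_prop

theorem measurable_mix_right (J : Set ι) (ω : ι → Bool) : Measurable (mix J ω) :=
  (measurable_mix J).comp measurable_prodMk_left

/-- The preimage of a box is a product of two boxes, one for the coordinates in `J` and one for the
others. All independence arguments below reduce to this substitution. -/
theorem measurePreserving_mix (ν : Measure Bool) [IsProbabilityMeasure ν] (J : Set ι) :
    MeasurePreserving (fun q : (ι → Bool) × (ι → Bool) => mix J q.1 q.2)
      ((coinMeasure ι ν).prod (coinMeasure ι ν)) (coinMeasure ι ν) := by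
  classical
  refine ⟨measurable_mix J, Measure.eq_infinitePi _ fun s t ht => ?_⟩
  rw [Measure.map_apply (measurable_mix J) (.pi s.countable_toSet fun _ _ => ht _)]
  have : (fun q : (ι → Bool) × (ι → Bool) => mix J q.1 q.2) ⁻¹' (s : Set ι).pi t =
      (({i ∈ s | i ∈ J} : Finset ι) : Set ι).pi t ×ˢ
        (({i ∈ s | i ∉ J} : Finset ι) : Set ι).pi t := by
    ext q
    simp only [Set.mem_preimage, Set.mem_pi, Set.mem_prod, Finset.coe_filter, Set.mem_ofPred_eq,
      Finset.mem_coe]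
    constructor
    · intro h
      exact ⟨fun i hi => by simpa [mix_of_mem hi.2] using h i hi.1,
        fun i hi => by simpa [mix_of_notMem hi.2] using h i hi.1⟩
    · rintro ⟨h1, h2⟩ i hi
      by_cases hJ : i ∈ J
      · simpa [mix_of_mem hJ] using h1 i ⟨hi, hJ⟩
      · simpa [mix_of_notMem hJ] using h2 i ⟨hi, hJ⟩
  rw [this, Measure.prod_prod, Measure.infinitePi_pi _ (fun i _ => ht i),
    Measure.infinitePi_pi _ (fun i _ => ht i), Finset.prod_filter_mul_prod_filter_not]

/-- The average of `f` over the coordinates outside `J`. -/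
def avg (ν : Measure Bool) (J : Set ι) (f : (ι → Bool) → ℝ) (ω : ι → Bool) : ℝ :=
  ∫ η, f (mix J ω η) ∂coinMeasure ι ν

variable (ν : Measure Bool) [IsProbabilityMeasure ν]

theorem mix_congr {J K : Set ι} {ω ω' : ι → Bool} (h : ∀ i ∈ J ∩ K, ω i = ω' i) (η : ι → Bool) :
    ∀ i ∈ K, mix J ω η i = mix J ω' η i := by
  intro i hi
  by_cases hJ : i ∈ J
  · rw [mix_of_mem hJ, mix_of_mem hJ, h i ⟨hJ, hi⟩]
  · rw [mix_of_notMem hJ, mix_of_notMem hJ]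

omit [IsProbabilityMeasure ν] in
theorem dependsOn_avg {J K : Set ι} {f : (ι → Bool) → ℝ} (hf : DependsOn f K) :
    DependsOn (avg ν J f) (J ∩ K) := by
  intro ω ω' h
  exact integral_congr_ae (ae_of_all _ fun η => hf (mix_congr h η))

omit [IsProbabilityMeasure ν] in
theorem avg_congr_set {J J' K : Set ι} {f : (ι → Bool) → ℝ} (hf : DependsOn f K)
    (h : J ∩ K = J' ∩ K) : avg ν J f = avg ν J' f := by
  funext ω
  refine integral_congr_ae (ae_of_all _ fun η => hf fun i hi => ?_)
  have hi' : i ∈ J ↔ i ∈ J' := by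
    have := Set.ext_iff.1 h i
    simpa [hi] using this
  by_cases hJ : i ∈ J
  · rw [mix_of_mem hJ, mix_of_mem (hi'.1 hJ)]
  · rw [mix_of_notMem hJ, mix_of_notMem (fun h' => hJ (hi'.2 h'))]

theorem avg_of_dependsOn {J : Set ι} {f : (ι → Bool) → ℝ} (hf : DependsOn f J) :
    avg ν J f = f := by
  funext ω
  have : ∀ η, f (mix J ω η) = f ω := fun η => hf fun i hi => mix_of_mem hi _ _
  simp [avg, this]

omit [IsProbabilityMeasure ν] in
theorem avg_empty (f : (ι → Bool) → ℝ) (ω : ι → Bool) :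
    avg ν ∅ f ω = ∫ η, f η ∂coinMeasure ι ν := by
  have : ∀ η, mix ∅ ω η = η := fun η => funext fun i => mix_of_notMem (by simp) _ _
  simp [avg, this]

theorem measurable_avg (J : Set ι) {f : (ι → Bool) → ℝ} (hf : Measurable f) :
    Measurable (avg ν J f) :=
  ((hf.comp (measurable_mix J)).stronglyMeasurable.integral_prod_right').measurable

theorem abs_avg_le (J : Set ι) {f : (ι → Bool) → ℝ} {C : ℝ} (hC : ∀ ω, |f ω| ≤ C) (ω : ι → Bool) :
    |avg ν J f ω| ≤ C := by
  have := norm_integral_le_of_norm_le_const (μ := coinMeasure ι ν)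
    (ae_of_all _ fun η => (Real.norm_eq_abs _).trans_le (hC (mix J ω η)))
  simpa [avg] using this

theorem integrable_of_abs_le {Ω : Type*} [MeasurableSpace Ω] {μ : Measure Ω} [IsFiniteMeasure μ]
    {f : Ω → ℝ} (hf : Measurable f) {C : ℝ} (hC : ∀ ω, |f ω| ≤ C) : Integrable f μ :=
  Integrable.of_bound hf.aestronglyMeasurable C (ae_of_all _ hC)

theorem avg_sub (J : Set ι) {f g : (ι → Bool) → ℝ} (hf : Measurable f) {C : ℝ}
    (hC : ∀ ω, |f ω| ≤ C) (hg : Measurable g) {D : ℝ} (hD : ∀ ω, |g ω| ≤ D) (ω : ι → Bool) :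
    avg ν J (fun ω => f ω - g ω) ω = avg ν J f ω - avg ν J g ω :=
  integral_sub (integrable_of_abs_le (hf.comp (measurable_mix_right J ω)) fun _ => hC _)
    (integrable_of_abs_le (hg.comp (measurable_mix_right J ω)) fun _ => hD _)

theorem integral_comp_of_measurePreserving {α β E : Type*} [MeasurableSpace α] [MeasurableSpace β]
    {μ : Measure α} {μ' : Measure β} [NormedAddCommGroup E] [NormedSpace ℝ E] {φ : α → β}
    (h : MeasurePreserving φ μ μ') {f : β → E} (hf : StronglyMeasurable f) :
    ∫ x, f (φ x) ∂μ = ∫ y, f y ∂μ' := by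
  rw [← h.map_eq, integral_map h.measurable.aemeasurable hf.aestronglyMeasurable]

theorem integral_comp_mix (J : Set ι) {E : Type*} [NormedAddCommGroup E] [NormedSpace ℝ E]
    {f : (ι → Bool) → E} (hf : StronglyMeasurable f) :
    ∫ q : (ι → Bool) × (ι → Bool), f (mix J q.1 q.2)
      ∂(coinMeasure ι ν).prod (coinMeasure ι ν) = ∫ ω, f ω ∂coinMeasure ι ν :=
  integral_comp_of_measurePreserving (measurePreserving_mix ν J) hf

/-- The characteristic property of conditional expectation: `avg ν J f` is a version of the
conditional expectation given the coordinates in `J`. After mixing in a second configuration, `g`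
does not notice the change, and Fubini applies. -/
theorem integral_mul_avg (J : Set ι) {f g : (ι → Bool) → ℝ} (hf : Measurable f) {C : ℝ}
    (hC : ∀ ω, |f ω| ≤ C) (hg : Measurable g) {D : ℝ} (hD : ∀ ω, |g ω| ≤ D)
    (hgJ : DependsOn g J) :
    ∫ ω, g ω * avg ν J f ω ∂coinMeasure ι ν = ∫ ω, g ω * f ω ∂coinMeasure ι ν := by
  rw [← integral_comp_mix ν J (f := fun ω => g ω * f ω) (hg.mul hf).stronglyMeasurable,
    integral_prod]
  · refine integral_congr_ae (ae_of_all _ fun ω => ?_)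
    simp only [avg, ← integral_const_mul]
    refine integral_congr_ae (ae_of_all _ fun η => ?_)
    have : g (mix J ω η) = g ω := hgJ fun i hi => mix_of_mem hi _ _
    simp [this]
  · refine integrable_of_abs_le ((hg.mul hf).comp (measurable_mix J)) (C := D * C) fun q => ?_
    simp only [abs_mul]
    exact mul_le_mul (hD _) (hC _) (abs_nonneg _) ((abs_nonneg _).trans (hD q.1))

/-- Conditional expectation is an orthogonal projection: expand the square of `f - avg ν J f` and
evaluate the cross term by `integral_mul_avg`. -/
theorem integral_avg_sq_le (J : Set ι) {f : (ι → Bool) → ℝ} (hf : Measurable f) {C : ℝ}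
    (hC : ∀ ω, |f ω| ≤ C) :
    ∫ ω, avg ν J f ω ^ 2 ∂coinMeasure ι ν ≤ ∫ ω, f ω ^ 2 ∂coinMeasure ι ν := by
  have hm := measurable_avg ν J hf
  have hb := abs_avg_le ν J hC
  have hdep : DependsOn (avg ν J f) J :=
    (dependsOn_avg ν (dependsOn_univ f)).mono Set.inter_subset_left
  have hC0 : 0 ≤ C := (abs_nonneg _).trans (hC fun _ => true)
  have hint : ∀ {g h : (ι → Bool) → ℝ}, Measurable g → (∀ ω, |g ω| ≤ C) → Measurable h →
      (∀ ω, |h ω| ≤ C) → Integrable (fun ω => g ω * h ω) (coinMeasure ι ν) := by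
    intro g h hg hgC hh hhC
    refine integrable_of_abs_le (hg.mul hh) (C := C * C) fun ω => ?_
    rw [abs_mul]
    exact mul_le_mul (hgC ω) (hhC ω) (abs_nonneg _) hC0
  have h1 := integral_mul_avg ν J hf hC hm hb hdep
  have h2 : 0 ≤ ∫ ω, (f ω - avg ν J f ω) ^ 2 ∂coinMeasure ι ν :=
    integral_nonneg fun ω => sq_nonneg _
  have h3 : ∀ ω, (f ω - avg ν J f ω) ^ 2 =
      f ω * f ω - 2 * (avg ν J f ω * f ω) + avg ν J f ω * avg ν J f ω := fun ω => by ring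
  simp only [h3] at h2
  have i1 := hint hf hC hf hC
  have i2 := (hint hm hb hf hC).const_mul 2
  have i3 : Integrable (fun ω => f ω * f ω - 2 * (avg ν J f ω * f ω)) (coinMeasure ι ν) := i1.sub i2
  rw [integral_add i3 (hint hm hb hm hb), integral_sub i1 i2, integral_const_mul, ← h1] at h2
  simp only [pow_two]
  linarith

/-- The indicator of the open state. -/
def val (b : Bool) : ℝ := cond b 1 0

/-- The centred indicator of the open state. -/
def cval (ν : Measure Bool) (b : Bool) : ℝ := val b - ∫ b', val b' ∂ν

omit [IsProbabilityMeasure ν] in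
theorem measurable_cval : Measurable (cval ν) := measurable_of_finite _

theorem integral_val_mem : 0 ≤ ∫ b, val b ∂ν ∧ ∫ b, val b ∂ν ≤ 1 := by
  have h0 : ∀ b, 0 ≤ val b := by intro b; cases b <;> simp [val]
  have h1 : ∀ b, val b ≤ 1 := by intro b; cases b <;> simp [val]
  refine ⟨integral_nonneg h0, ?_⟩
  have := integral_mono (μ := ν) (Integrable.of_finite) (integrable_const (1 : ℝ)) h1
  rwa [integral_const, probReal_univ, one_smul] at this

theorem abs_cval_le (b : Bool) : |cval ν b| ≤ 1 := by
  have h := integral_val_mem ν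
  have hb : val b = 0 ∨ val b = 1 := by cases b <;> simp [val]
  rw [cval, abs_le]
  rcases hb with hb | hb <;> rw [hb] <;> constructor <;> linarith

theorem integral_cval : ∫ b, cval ν b ∂ν = 0 := by
  simp only [cval]
  rw [integral_sub Integrable.of_finite Integrable.of_finite, integral_const, probReal_univ,
    one_smul, sub_self]

theorem integral_cval_eval (e : ι) : ∫ ω, cval ν (ω e) ∂coinMeasure ι ν = 0 := by
  rw [← integral_cval ν]
  exact integral_comp_of_measurePreserving (measurePreserving_eval_infinitePi (fun _ : ι => ν) e)
    (measurable_cval ν).stronglyMeasurable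

/-- A centred coin is independent of the other coordinates. Values in a normed space are allowed
because the lemma serves both real second moments and complex characteristic functions. -/
theorem integral_cval_smul {E : Type*} [NormedAddCommGroup E] [NormedSpace ℝ E] (e : ι)
    {h : (ι → Bool) → E} (hh : StronglyMeasurable h) (hdep : DependsOn h {e}ᶜ) :
    ∫ ω, cval ν (ω e) • h ω ∂coinMeasure ι ν = 0 := by
  have hm : Measurable fun ω : ι → Bool => cval ν (ω e) :=
    (measurable_cval ν).comp (measurable_pi_apply e)
  rw [← integral_comp_mix ν {e}ᶜ (f := fun ω => cval ν (ω e) • h ω)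
    (hm.stronglyMeasurable.smul hh)]
  have : ∀ q : (ι → Bool) × (ι → Bool), cval ν (mix {e}ᶜ q.1 q.2 e) • h (mix {e}ᶜ q.1 q.2) =
      cval ν (q.2 e) • h q.1 := by
    intro q
    rw [mix_of_notMem (by simp), hdep (y := q.1) fun i hi => mix_of_mem hi _ _]
  simp only [this]
  rw [← integral_prod_swap]
  simp only [Prod.fst_swap, Prod.snd_swap]
  rw [integral_prod_smul (fun ω : ι → Bool => cval ν (ω e)) h, integral_cval_eval, zero_smul]

theorem measurePreserving_comp_equiv (σ : ι ≃ ι) :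
    MeasurePreserving (fun ω : ι → Bool => ω ∘ σ) (coinMeasure ι ν) (coinMeasure ι ν) := by
  classical
  have hm : Measurable fun ω : ι → Bool => ω ∘ σ :=
    measurable_pi_lambda _ fun i => measurable_pi_apply _
  refine ⟨hm, Measure.eq_infinitePi _ fun s t ht => ?_⟩
  rw [Measure.map_apply hm (.pi s.countable_toSet fun _ _ => ht _)]
  have : (fun ω : ι → Bool => ω ∘ σ) ⁻¹' (s : Set ι).pi t =
      ((s.map σ.toEmbedding : Finset ι) : Set ι).pi fun i => t (σ.symm i) := by
    ext ω
    simp only [Set.mem_preimage, Set.mem_pi, Finset.coe_map, Set.mem_image, Finset.mem_coe,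
      Function.comp_apply, Equiv.coe_toEmbedding, forall_exists_index, and_imp,
      forall_apply_eq_imp_iff₂, Equiv.symm_apply_apply]
  rw [this, Measure.infinitePi_pi _ (fun i _ => ht _)]
  simp

theorem integral_comp_equiv (σ : ι ≃ ι) {f : (ι → Bool) → ℝ} (hf : Measurable f) :
    ∫ ω, f (ω ∘ σ) ∂coinMeasure ι ν = ∫ ω, f ω ∂coinMeasure ι ν :=
  integral_comp_of_measurePreserving (measurePreserving_comp_equiv ν σ) hf.stronglyMeasurable

theorem avg_comp_equiv (σ : ι ≃ ι) {J J' : Set ι} (hJ : ∀ i, σ i ∈ J' ↔ i ∈ J)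
    {f : (ι → Bool) → ℝ} (hf : Measurable f) (ω : ι → Bool) :
    avg ν J' (fun ω => f (ω ∘ σ)) ω = avg ν J f (ω ∘ σ) := by
  simp only [avg]
  rw [← integral_comp_equiv ν σ (f := fun η => f (mix J (ω ∘ σ) η))
    (hf.comp (measurable_mix_right J (ω ∘ σ)))]
  refine integral_congr_ae (ae_of_all _ fun η => congrArg f (funext fun i => ?_))
  by_cases h : i ∈ J
  · rw [mix_of_mem h, Function.comp, mix_of_mem ((hJ i).2 h)]; rfl
  · rw [mix_of_notMem h, Function.comp, mix_of_notMem (fun h' => h ((hJ i).1 h'))]; rfl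

/-- Functions depending on disjoint sets of coordinates are uncorrelated. -/
theorem integral_mul_of_disjoint {J K : Set ι} (hJK : Disjoint J K) {f g : (ι → Bool) → ℝ}
    (hf : Measurable f) (hg : Measurable g) (hfJ : DependsOn f J) (hgK : DependsOn g K) :
    ∫ ω, f ω * g ω ∂coinMeasure ι ν =
      (∫ ω, f ω ∂coinMeasure ι ν) * ∫ ω, g ω ∂coinMeasure ι ν := by
  rw [← integral_comp_mix ν J (f := fun ω => f ω * g ω) (hf.mul hg).stronglyMeasurable,
    ← integral_prod_mul]
  refine integral_congr_ae (ae_of_all _ fun q => ?_)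
  have h1 : f (mix J q.1 q.2) = f q.1 := hfJ fun i hi => mix_of_mem hi _ _
  have h2 : g (mix J q.1 q.2) = g q.2 := hgK fun i hi =>
    mix_of_notMem (fun h => hJK.le_bot ⟨h, hi⟩) _ _
  simp [h1, h2]

/-- Functions of finitely many coordinates are measurable. -/
theorem measurable_of_dependsOn_finite {J : Set ι} (hJ : J.Finite) {β : Type*} [MeasurableSpace β]
    [Nonempty β] {f : (ι → Bool) → β} (hf : DependsOn f J) : Measurable f := by
  classical
  have := hJ.to_subtype
  obtain ⟨g, hg⟩ : ∃ g : (J → Bool) → β, f = g ∘ J.domRestrict :=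
    dependsOn_iff_exists_comp.1 hf
  rw [hg]
  exact (measurable_of_finite g).comp (by fun_prop)

/-- Induction by adjoining a new maximum, that is, by revealing one more coin. The order is a bare
relation because the final formula quantifies over orders. -/
theorem finset_induction_on_linear {le : ι → ι → Prop} (hle : IsLinearOrder ι le)
    {P : Finset ι → Prop} (s : Finset ι) (h0 : P ∅)
    (h : ∀ m s (hm : m ∉ s), (∀ x ∈ s, le x m) → P s → P (Finset.cons m s hm)) : P s := by
  classical
  let _ : LinearOrder ι :=
    { le := le
      le_refl := hle.refl
      le_trans := fun _ _ _ => hle.trans _ _ _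
      le_antisymm := fun _ _ => hle.antisymm _ _
      le_total := hle.total
      toDecidableLE := Classical.decRel _ }
  induction s using Finset.induction_on_max with
  | empty => exact h0
  | insert a s ha ih =>
    have hm : a ∉ s := fun h' => lt_irrefl _ (ha a h')
    have := h a s hm (fun x hx => (ha x hx).le) ih
    rwa [Finset.cons_eq_insert] at this

end ProductMeasure

/-! ### Stabilisation of Betti number increments -/

section Stabilisation

variable {E : Type*} [AddCommGroup E] [Module ℝ E]

theorem exists_eventually_eq_of_monotone_of_le {ι : Type*} [Preorder ι] [IsDirectedOrder ι]
    [Nonempty ι] {g : ι → ℕ} (hg : Monotone g) {N : ℕ} (hN : ∀ i, g i ≤ N) :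
    ∃ n, ∀ᶠ i in atTop, g i = n := by
  obtain ⟨i₀, hi₀⟩ : ∃ i₀, ∀ i, g i ≤ g i₀ := by
    have hfin : (Set.range g).Finite := (Set.finite_Iic N).subset (by rintro _ ⟨i, rfl⟩; exact hN i)
    obtain ⟨_, ⟨i₀, rfl⟩, h⟩ := Set.exists_max_image _ id hfin (Set.range_nonempty g)
    exact ⟨i₀, fun i => h _ ⟨i, rfl⟩⟩
  exact ⟨g i₀, (eventually_ge_atTop i₀).mono fun i hi => le_antisymm (hi₀ i) (hg hi)⟩

theorem finrank_sup_sub_finrank (U L : Submodule ℝ E) [FiniteDimensional ℝ U]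
    [FiniteDimensional ℝ L] :
    (Module.finrank ℝ ↥(U ⊔ L) : ℝ) - Module.finrank ℝ U =
      Module.finrank ℝ L - Module.finrank ℝ ↥(U ⊓ L) := by
  have h := Submodule.finrank_sup_add_finrank_inf_eq U L
  have h' : (Module.finrank ℝ ↥(U ⊔ L) : ℝ) + Module.finrank ℝ ↥(U ⊓ L) =
      Module.finrank ℝ U + Module.finrank ℝ L := by exact_mod_cast h
  linarith

theorem abs_finrank_sup_sub_finrank_le (U L : Submodule ℝ E) [FiniteDimensional ℝ U]
    [FiniteDimensional ℝ L] :
    |(Module.finrank ℝ ↥(U ⊔ L) : ℝ) - Module.finrank ℝ U| ≤ Module.finrank ℝ L := by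
  rw [finrank_sup_sub_finrank]
  have h : (Module.finrank ℝ ↥(U ⊓ L) : ℝ) ≤ Module.finrank ℝ L := by
    exact_mod_cast Submodule.finrank_mono inf_le_right
  rw [abs_of_nonneg (by linarith)]
  have : (0 : ℝ) ≤ Module.finrank ℝ ↥(U ⊓ L) := Nat.cast_nonneg _
  linarith

/-- The increment is dim L - dim (U ∩ L). Both terms are monotone integers bounded by dim M, hence
eventually constant, even though dim U may be unbounded. -/
theorem exists_eventually_finrank_sup_sub_finrank_eq {ι : Type*} [Preorder ι] [IsDirectedOrder ι]
    [Nonempty ι] {U L : ι → Submodule ℝ E} (hU : Monotone U) (hL : Monotone L)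
    [∀ i, FiniteDimensional ℝ (U i)] {M : Submodule ℝ E} [FiniteDimensional ℝ M]
    (hM : ∀ i, L i ≤ M) :
    ∃ d : ℝ, ∀ᶠ i in atTop,
      (Module.finrank ℝ ↥(U i ⊔ L i) : ℝ) - Module.finrank ℝ (U i) = d := by
  have hfd : ∀ i, FiniteDimensional ℝ (L i) := fun i =>
    Submodule.finiteDimensional_of_le (hM i)
  obtain ⟨n, hn⟩ := exists_eventually_eq_of_monotone_of_le
    (g := fun i => Module.finrank ℝ (L i)) (fun i j h => Submodule.finrank_mono (hL h))
    (fun i => Submodule.finrank_mono (hM i))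
  obtain ⟨m, hm⟩ := exists_eventually_eq_of_monotone_of_le
    (g := fun i => Module.finrank ℝ ↥(U i ⊓ L i))
    (fun i j h => Submodule.finrank_mono (inf_le_inf (hU h) (hL h)))
    (fun i => Submodule.finrank_mono (inf_le_right.trans (hM i)))
  refine ⟨n - m, ?_⟩
  filter_upwards [hn, hm] with i h1 h2
  rw [finrank_sup_sub_finrank, h1, h2]

end Stabilisation

/-! ### Betti numbers through dimensions of chain and boundary spaces -/

section Betti

variable {V : Type*}

/-- The span of the oriented `n`-simplices with vertices in `B`. -/
def fullChains (B : Set V) (n : ℕ) : Submodule ℝ (ExteriorAlgebra ℝ (VertexSpace V)) :=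
  Submodule.span ℝ {c | ∃ v : Fin (n + 1) → V, (∀ i, v i ∈ B) ∧ orientedSimplex v = c}

theorem fullChains_eq_span_range (B : Finset V) (n : ℕ) :
    fullChains (B : Set V) n =
      Submodule.span ℝ (Set.range fun v : Fin (n + 1) → B => orientedSimplex fun i => (v i : V)) := by
  rw [fullChains]
  congr 1
  ext c
  constructor
  · rintro ⟨v, hv, rfl⟩
    exact ⟨fun i => ⟨v i, hv i⟩, rfl⟩
  · rintro ⟨v, rfl⟩
    exact ⟨fun i => v i, fun i => (v i).2, rfl⟩

instance (B : Finset V) (n : ℕ) : FiniteDimensional ℝ (fullChains (B : Set V) n) := by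
  rw [fullChains_eq_span_range]
  exact FiniteDimensional.span_of_finite ℝ (Set.finite_range _)

/-- All tuples are counted, including repeated vertices and reorderings; the crude bound suffices
since only its dependence on `B.card` alone matters. -/
theorem finrank_fullChains_le (B : Finset V) (n : ℕ) :
    Module.finrank ℝ (fullChains (B : Set V) n) ≤ B.card ^ (n + 1) := by
  rw [fullChains_eq_span_range]
  refine (finrank_range_le_card _).trans ?_
  simp

theorem chains_mono {K L : PreAbstractSimplicialComplex V} (h : K ≤ L) (n : ℕ) :
    chains K n ≤ chains L n :=
  Submodule.span_mono fun _ ⟨v, hv, hc⟩ => ⟨v, h hv, hc⟩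

theorem chains_le_fullChains {K : PreAbstractSimplicialComplex V} {B : Set V}
    (h : ∀ σ ∈ K, (σ : Set V) ⊆ B) (n : ℕ) : chains K n ≤ fullChains B n :=
  Submodule.span_mono fun _ ⟨v, hv, hc⟩ => ⟨v, fun i => h _ hv (by simp), hc⟩

theorem finiteDimensional_chains {K : PreAbstractSimplicialComplex V} {A : Finset V}
    (h : ∀ σ ∈ K, (σ : Set V) ⊆ A) (n : ℕ) : FiniteDimensional ℝ (chains K n) :=
  Submodule.finiteDimensional_of_le (chains_le_fullChains h n)

theorem betti_add_finrank_boundaries (K : PreAbstractSimplicialComplex V) (n : ℕ)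
    [FiniteDimensional ℝ (chains K n)] :
    betti K n + Module.finrank ℝ (boundaries K n) = Module.finrank ℝ (cycles K n) := by
  have : FiniteDimensional ℝ (cycles K n) := by
    refine Submodule.finiteDimensional_of_le (S₂ := chains K n) ?_
    cases n with
    | zero => exact le_rfl
    | succ n => exact inf_le_left
  rw [← (Submodule.submoduleOfEquivOfLe (boundaries_le_cycles K n)).finrank_eq]
  exact Submodule.finrank_quotient_add_finrank _

theorem finrank_cycles_succ (K : PreAbstractSimplicialComplex V) (n : ℕ)
    [FiniteDimensional ℝ (chains K (n + 1))] :
    Module.finrank ℝ (cycles K (n + 1)) + Module.finrank ℝ (boundaries K n) =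
      Module.finrank ℝ (chains K (n + 1)) := by
  have h := ((boundary V).domRestrict (chains K (n + 1))).finrank_range_add_finrank_ker
  rw [LinearMap.range_domRestrict] at h
  have h2 : Module.finrank ℝ (LinearMap.ker ((boundary V).domRestrict (chains K (n + 1)))) =
      Module.finrank ℝ (cycles K (n + 1)) := by
    rw [LinearMap.ker_domRestrict]
    have : (LinearMap.ker (boundary V)).comap (chains K (n + 1)).subtype =
        (cycles K (n + 1)).submoduleOf (chains K (n + 1)) := by
      ext x; simp [Submodule.submoduleOf, cycles]
    rw [this]
    exact (Submodule.submoduleOfEquivOfLe inf_le_left).finrank_eq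
  rw [h2] at h
  rw [add_comm]
  exact h

theorem betti_zero (K : PreAbstractSimplicialComplex V) [FiniteDimensional ℝ (chains K 0)] :
    (betti K 0 : ℝ) = Module.finrank ℝ (chains K 0) - Module.finrank ℝ (boundaries K 0) := by
  have h := betti_add_finrank_boundaries K 0
  rw [eq_sub_iff_add_eq]
  exact_mod_cast h

/-- Rank-nullity eliminates the cycles. This is essential because chains and boundaries of a larger
complex are sums of the old space with a local one, whereas cycles have no such decomposition. -/
theorem betti_succ (K : PreAbstractSimplicialComplex V) (n : ℕ)
    [FiniteDimensional ℝ (chains K (n + 1))] :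
    (betti K (n + 1) : ℝ) = Module.finrank ℝ (chains K (n + 1)) -
      Module.finrank ℝ (boundaries K n) - Module.finrank ℝ (boundaries K (n + 1)) := by
  have h1 := betti_add_finrank_boundaries K (n + 1)
  have h2 := finrank_cycles_succ K n
  rw [← h1] at h2
  have : (betti K (n + 1) : ℝ) + Module.finrank ℝ (boundaries K (n + 1)) +
    Module.finrank ℝ (boundaries K n) = Module.finrank ℝ (chains K (n + 1)) := by exact_mod_cast h2
  linarith

/-- The span of the oriented `n`-simplices of `K` with vertices in `B`. -/
def localChains (B : Set V) (K : PreAbstractSimplicialComplex V) (n : ℕ) :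
    Submodule ℝ (ExteriorAlgebra ℝ (VertexSpace V)) :=
  Submodule.span ℝ {c | ∃ v : Fin (n + 1) ↪ V, Finset.univ.map v ∈ K ∧ (∀ i, v i ∈ B) ∧
    orientedSimplex v = c}

theorem localChains_mono (B : Set V) {K L : PreAbstractSimplicialComplex V} (h : K ≤ L) (n : ℕ) :
    localChains B K n ≤ localChains B L n :=
  Submodule.span_mono fun _ ⟨v, hv, hc⟩ => ⟨v, h hv, hc⟩

theorem localChains_le_fullChains (B : Set V) (K : PreAbstractSimplicialComplex V) (n : ℕ) :
    localChains B K n ≤ fullChains B n :=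
  Submodule.span_mono fun _ ⟨v, _, hv, hc⟩ => ⟨v, hv, hc⟩

theorem chains_eq_sup_localChains {K L : PreAbstractSimplicialComplex V} (h : K ≤ L) {B : Set V}
    (hB : ∀ σ ∈ L, σ ∈ K ∨ (σ : Set V) ⊆ B) (n : ℕ) :
    chains L n = chains K n ⊔ localChains B L n := by
  refine le_antisymm (Submodule.span_le.2 ?_) (sup_le (chains_mono h n) ?_)
  · rintro c ⟨v, hv, rfl⟩
    rcases hB _ hv with h' | h'
    · exact Submodule.mem_sup_left (Submodule.subset_span ⟨v, h', rfl⟩)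
    · exact Submodule.mem_sup_right (Submodule.subset_span ⟨v, hv, fun i => h' (by simp), rfl⟩)
  · exact Submodule.span_mono fun _ ⟨v, hv, _, hc⟩ => ⟨v, hv, hc⟩

/-- A bound for the change of the `n`-th Betti number by a modification inside a set of `N`
vertices. -/
def bettiBound (N n : ℕ) : ℝ := 2 * N ^ (n + 1) + N ^ (n + 2)

/-- Adding simplices supported in `B` enlarges each chain space by local chains and each boundary
space by the boundaries of local chains. The local spaces have dimension bounded in terms of
`B.card` and grow with the index, so both the bound and the stabilisation follow term by term from
the rank formulas. -/
theorem betti_sub_betti {ι : Type*} [Preorder ι] [IsDirectedOrder ι] [Nonempty ι]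
    {K L : ι → PreAbstractSimplicialComplex V} {A : ι → Finset V} {B : Finset V}
    (hK : Monotone K) (hL : Monotone L) (hKL : ∀ i, K i ≤ L i)
    (hA : ∀ i, ∀ σ ∈ L i, (σ : Set V) ⊆ A i)
    (hB : ∀ i, ∀ σ ∈ L i, σ ∈ K i ∨ (σ : Set V) ⊆ B) (n : ℕ) :
    (∀ i, |(betti (L i) n : ℝ) - betti (K i) n| ≤ bettiBound B.card n) ∧
      ∃ d : ℝ, ∀ᶠ i in atTop, (betti (L i) n : ℝ) - betti (K i) n = d := by
  have hfL : ∀ i m, FiniteDimensional ℝ (chains (L i) m) := fun i m =>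
    finiteDimensional_chains (hA i) m
  have hfK : ∀ i m, FiniteDimensional ℝ (chains (K i) m) := fun i m =>
    finiteDimensional_chains (fun σ hσ => hA i σ (hKL i hσ)) m
  have hfl : ∀ i m, FiniteDimensional ℝ (localChains (B : Set V) (L i) m) := fun i m =>
    Submodule.finiteDimensional_of_le (localChains_le_fullChains _ _ m)
  have hc : ∀ i m, chains (L i) m = chains (K i) m ⊔ localChains B (L i) m := fun i m =>
    chains_eq_sup_localChains (hKL i) (hB i) m
  have hb : ∀ i m, boundaries (L i) m =
      boundaries (K i) m ⊔ (localChains B (L i) (m + 1)).map (boundary V) := fun i m => by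
    rw [boundaries, hc, Submodule.map_sup]; rfl
  have hfb : ∀ i m, FiniteDimensional ℝ (boundaries (K i) m) := fun i m => by
    rw [boundaries]; infer_instance
  have bc : ∀ i m, |(Module.finrank ℝ (chains (L i) m) : ℝ) - Module.finrank ℝ (chains (K i) m)| ≤
      (B.card : ℝ) ^ (m + 1) := fun i m => by
    rw [hc]
    refine (abs_finrank_sup_sub_finrank_le _ _).trans ?_
    exact_mod_cast (Submodule.finrank_mono (localChains_le_fullChains _ _ m)).trans
      (finrank_fullChains_le B m)
  have bb : ∀ i m,
      |(Module.finrank ℝ (boundaries (L i) m) : ℝ) - Module.finrank ℝ (boundaries (K i) m)| ≤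
      (B.card : ℝ) ^ (m + 2) := fun i m => by
    rw [hb]
    refine (abs_finrank_sup_sub_finrank_le _ _).trans ?_
    exact_mod_cast (Submodule.finrank_map_le _ _).trans
      ((Submodule.finrank_mono (localChains_le_fullChains _ _ (m + 1))).trans
      (finrank_fullChains_le B (m + 1)))
  have ec : ∀ m, ∃ d : ℝ, ∀ᶠ i in atTop,
      (Module.finrank ℝ (chains (L i) m) : ℝ) - Module.finrank ℝ (chains (K i) m) = d := fun m => by
    obtain ⟨d, hd⟩ := exists_eventually_finrank_sup_sub_finrank_eq
      (U := fun i => chains (K i) m) (L := fun i => localChains (B : Set V) (L i) m)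
      (M := fullChains (B : Set V) m)
      (fun i j h => chains_mono (hK h) m)
      (fun i j h => localChains_mono _ (hL h) m) (fun i => localChains_le_fullChains _ _ m)
    exact ⟨d, hd.mono fun i hi => by rw [hc]; exact hi⟩
  have eb : ∀ m, ∃ d : ℝ, ∀ᶠ i in atTop,
      (Module.finrank ℝ (boundaries (L i) m) : ℝ) - Module.finrank ℝ (boundaries (K i) m) = d :=
    fun m => by
    have : FiniteDimensional ℝ ((fullChains (B : Set V) (m + 1)).map (boundary V)) := inferInstance
    obtain ⟨d, hd⟩ := exists_eventually_finrank_sup_sub_finrank_eq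
      (U := fun i => boundaries (K i) m)
      (L := fun i => (localChains (B : Set V) (L i) (m + 1)).map (boundary V))
      (M := (fullChains (B : Set V) (m + 1)).map (boundary V))
      (fun i j h => Submodule.map_mono (chains_mono (hK h) (m + 1)))
      (fun i j h => Submodule.map_mono (localChains_mono _ (hL h) (m + 1)))
      (fun i => Submodule.map_mono (localChains_le_fullChains _ _ (m + 1)))
    exact ⟨d, hd.mono fun i hi => by rw [hb]; exact hi⟩
  cases n with
  | zero =>
    have hL0 : ∀ i, (betti (L i) 0 : ℝ) = _ := fun i => betti_zero (L i)
    have hK0 : ∀ i, (betti (K i) 0 : ℝ) = _ := fun i => betti_zero (K i)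
    simp only [hL0, hK0, bettiBound]
    refine ⟨fun i => ?_, ?_⟩
    · have h1 := abs_le.1 (bc i 0)
      have h2 := abs_le.1 (bb i 0)
      have h3 : (0 : ℝ) ≤ (B.card : ℝ) ^ (0 + 1) := by positivity
      rw [abs_le]
      constructor <;> linarith
    · obtain ⟨d1, h1⟩ := ec 0
      obtain ⟨d2, h2⟩ := eb 0
      refine ⟨d1 - d2, ?_⟩
      filter_upwards [h1, h2] with i h1 h2
      linarith
  | succ n =>
    have hL0 : ∀ i, (betti (L i) (n + 1) : ℝ) = _ := fun i => betti_succ (L i) n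
    have hK0 : ∀ i, (betti (K i) (n + 1) : ℝ) = _ := fun i => betti_succ (K i) n
    simp only [hL0, hK0, bettiBound]
    refine ⟨fun i => ?_, ?_⟩
    · have h1 := abs_le.1 (bc i (n + 1))
      have h2 := abs_le.1 (bb i n)
      have h3 := abs_le.1 (bb i (n + 1))
      rw [abs_le]
      constructor <;> linarith
    · obtain ⟨d1, h1⟩ := ec (n + 1)
      obtain ⟨d2, h2⟩ := eb n
      obtain ⟨d3, h3⟩ := eb (n + 1)
      refine ⟨d1 - d2 - d3, ?_⟩
      filter_upwards [h1, h2, h3] with i h1 h2 h3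
      linarith

/-- The map on chains induced by a map of vertices. -/
def relabel (f : V → V) :
    ExteriorAlgebra ℝ (VertexSpace V) →ₐ[ℝ] ExteriorAlgebra ℝ (VertexSpace V) :=
  ExteriorAlgebra.map (Finsupp.lmapDomain ℝ ℝ f)

theorem relabel_orientedSimplex (f : V → V) {n : ℕ} (v : Fin n → V) :
    relabel f (orientedSimplex v) = orientedSimplex (f ∘ v) := by
  rw [relabel, orientedSimplex, ExteriorAlgebra.map_apply_ιMulti, orientedSimplex]
  congr 1
  funext i
  simp

theorem injective_relabel (f : V ≃ V) : Function.Injective (relabel f) := by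
  refine ExteriorAlgebra.map_injective ⟨Finsupp.lmapDomain ℝ ℝ f.symm, ?_⟩
  rw [← Finsupp.lmapDomain_comp]
  simp

theorem chains_relabel {K L : PreAbstractSimplicialComplex V} (f : V ≃ V)
    (h : L.faces = (fun σ : Finset V => σ.map f.toEmbedding) '' K.faces) (n : ℕ) :
    chains L n = (chains K n).map (relabel f).toLinearMap := by
  have hm : ∀ σ : Finset V, σ.map f.toEmbedding ∈ L ↔ σ ∈ K := by
    intro σ
    change _ ∈ L.faces ↔ _ ∈ K.faces
    rw [h]
    exact (Finset.map_injective f.toEmbedding).mem_set_image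
  rw [chains, chains, Submodule.map_span]
  congr 1
  ext c
  constructor
  · rintro ⟨v, hv, rfl⟩
    refine ⟨_, ⟨v.trans f.symm.toEmbedding, ?_, rfl⟩, ?_⟩
    · rw [← hm, Finset.map_map]
      convert hv using 2
      ext i; simp
    · simp only [AlgHom.toLinearMap_apply, relabel_orientedSimplex]
      congr 1
      funext i; simp
  · rintro ⟨_, ⟨v, hv, rfl⟩, rfl⟩
    refine ⟨v.trans f.toEmbedding, ?_, ?_⟩
    · rw [← Finset.map_map, hm]; exact hv
    · simp only [AlgHom.toLinearMap_apply, relabel_orientedSimplex]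
      rfl

theorem boundary_relabel (f : V ≃ V) (K : PreAbstractSimplicialComplex V) (n : ℕ) :
    ∀ c ∈ chains K n, boundary V (relabel f c) = relabel f (boundary V c) := by
  intro c hc
  refine Submodule.span_induction ?_ ?_ ?_ ?_ hc
  · rintro _ ⟨v, -, rfl⟩
    rw [relabel_orientedSimplex, boundary_orientedSimplex, boundary_orientedSimplex, map_sum]
    refine Finset.sum_congr rfl fun i _ => ?_
    rw [map_smul, relabel_orientedSimplex]
    rfl
  · simp
  · intro x y _ _ hx hy
    simp only [map_add, hx, hy]
  · intro a x _ hx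
    simp only [map_smul, hx]

theorem boundaries_relabel {K L : PreAbstractSimplicialComplex V} (f : V ≃ V)
    (h : L.faces = (fun σ : Finset V => σ.map f.toEmbedding) '' K.faces) (n : ℕ) :
    boundaries L n = (boundaries K n).map (relabel f).toLinearMap := by
  rw [boundaries, chains_relabel f h, boundaries]
  ext c
  simp only [Submodule.mem_map, exists_exists_and_eq_and, AlgHom.toLinearMap_apply]
  constructor
  · rintro ⟨x, hx, rfl⟩
    exact ⟨x, hx, (boundary_relabel f K _ x hx).symm⟩
  · rintro ⟨x, hx, rfl⟩
    exact ⟨x, hx, boundary_relabel f K _ x hx⟩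

/-- The induced algebra map is injective and intertwines boundaries, so it preserves every dimension
in the rank formulas. The finite vertex set `A` makes those formulas applicable. -/
theorem betti_relabel {K L : PreAbstractSimplicialComplex V} (f : V ≃ V) {A : Finset V}
    (hA : ∀ σ ∈ K, (σ : Set V) ⊆ A)
    (h : L.faces = (fun σ : Finset V => σ.map f.toEmbedding) '' K.faces) (n : ℕ) :
    (betti L n : ℝ) = betti K n := by
  have hK : ∀ m, FiniteDimensional ℝ (chains K m) := finiteDimensional_chains hA
  have hL : ∀ m, FiniteDimensional ℝ (chains L m) := fun m => by
    rw [chains_relabel f h]; infer_instance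
  have hfin : ∀ M : Submodule ℝ (ExteriorAlgebra ℝ (VertexSpace V)),
      Module.finrank ℝ (M.map (relabel f).toLinearMap) = Module.finrank ℝ M := fun M =>
    (Submodule.equivMapOfInjective _ (injective_relabel f) M).finrank_eq.symm
  cases n with
  | zero => rw [betti_zero, betti_zero, chains_relabel f h, boundaries_relabel f h, hfin, hfin]
  | succ n =>
    rw [betti_succ, betti_succ, chains_relabel f h, boundaries_relabel f h, boundaries_relabel f h,
      hfin, hfin, hfin]

end Betti

/-! ### A martingale central limit theorem for functions of independent coins -/

section Analysis

theorem norm_one_add_mul_I_le (y : ℝ) : ‖(1 + y * Complex.I : ℂ)‖ ≤ Real.exp (y ^ 2 / 2) := by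
  have h1 : ‖(1 + y * Complex.I : ℂ)‖ ^ 2 = 1 + y ^ 2 := by
    rw [Complex.sq_norm, Complex.normSq_apply]
    simp; ring
  have h2 : Real.exp (y ^ 2 / 2) ^ 2 = Real.exp (y ^ 2) := by
    rw [← Real.exp_nat_mul]; congr 1; push_cast; ring
  refine (sq_le_sq₀ (norm_nonneg _) (Real.exp_pos _).le).1 ?_
  rw [h1, h2]
  linarith [Real.add_one_le_exp (y ^ 2)]

theorem norm_mul_exp_le_one (y : ℝ) :
    ‖(1 + y * Complex.I) * ((Real.exp (-y ^ 2 / 2) : ℝ) : ℂ)‖ ≤ 1 := by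
  rw [norm_mul, Complex.norm_real, Real.norm_eq_abs, abs_of_pos (Real.exp_pos _)]
  refine (mul_le_mul_of_nonneg_right (norm_one_add_mul_I_le y) (Real.exp_pos _).le).trans ?_
  rw [← Real.exp_add]
  simp [neg_div]

theorem norm_exp_mul_I_sub_exp_mul_I_le (x y : ℝ) :
    ‖Complex.exp (x * Complex.I) - Complex.exp (y * Complex.I)‖ ≤ |x - y| := by
  have h : Complex.exp (x * Complex.I) - Complex.exp (y * Complex.I) =
      Complex.exp (y * Complex.I) * (Complex.exp (Complex.I * ((x - y : ℝ) : ℂ)) - 1) := by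
    rw [mul_sub, ← Complex.exp_add, mul_one]
    congr 2
    push_cast; ring
  rw [h, norm_mul, Complex.norm_exp_ofReal_mul_I, one_mul]
  exact Real.norm_exp_I_mul_ofReal_sub_one_le

/-- Telescoping: exchange one factor at a time, the remaining factors having norm at most one. -/
theorem norm_prod_sub_prod_le_sum {ι : Type*} (s : Finset ι) {a b : ι → ℂ} (ha : ∀ i, ‖a i‖ ≤ 1)
    (hb : ∀ i, ‖b i‖ ≤ 1) : ‖∏ i ∈ s, a i - ∏ i ∈ s, b i‖ ≤ ∑ i ∈ s, ‖a i - b i‖ := by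
  induction s using Finset.cons_induction with
  | empty => simp
  | cons m s hm ih =>
    rw [Finset.prod_cons, Finset.prod_cons, Finset.sum_cons]
    have h : a m * ∏ i ∈ s, a i - b m * ∏ i ∈ s, b i =
        (a m - b m) * ∏ i ∈ s, a i + b m * (∏ i ∈ s, a i - ∏ i ∈ s, b i) := by ring
    rw [h]
    refine (norm_add_le _ _).trans (add_le_add ?_ ?_)
    · rw [norm_mul]
      refine mul_le_of_le_one_right (norm_nonneg _) ?_
      rw [norm_prod]
      exact Finset.prod_le_one (fun _ _ => norm_nonneg _) fun i _ => ha i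
    · rw [norm_mul]
      exact (mul_le_of_le_one_left (norm_nonneg _) (hb m)).trans ih

theorem abs_exp_neg_sub_exp_neg_le {x y : ℝ} (hx : 0 ≤ x) (hy : 0 ≤ y) :
    |Real.exp (-x) - Real.exp (-y)| ≤ |x - y| := by
  have key : ∀ {a b : ℝ}, 0 ≤ a → a ≤ b → Real.exp (-a) - Real.exp (-b) ≤ b - a := by
    intro a b ha hab
    have h1 := Real.add_one_le_exp (-(b - a))
    have h2 : Real.exp (-b) = Real.exp (-a) * Real.exp (-(b - a)) := by
      rw [← Real.exp_add]; congr 1; ring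
    have h3 : Real.exp (-a) ≤ 1 := Real.exp_le_one_iff.2 (by linarith)
    have h4 := Real.exp_pos (-a)
    rw [h2]
    nlinarith
  rcases le_total x y with h | h
  · rw [abs_of_nonneg (by linarith [Real.exp_le_exp.2 (neg_le_neg h)]), abs_sub_comm,
      abs_of_nonneg (by linarith)]
    exact key hx h
  · rw [abs_sub_comm, abs_of_nonneg (by linarith [Real.exp_le_exp.2 (neg_le_neg h)]),
      abs_of_nonneg (by linarith)]
    exact key hy h

theorem sq_integral_mul_le {Ω : Type*} [MeasurableSpace Ω] {μ : Measure Ω} [IsProbabilityMeasure μ]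
    {f g : Ω → ℝ} (hf : Measurable f) {C : ℝ} (hC : ∀ ω, |f ω| ≤ C) (hg : Measurable g) {D : ℝ}
    (hD : ∀ ω, |g ω| ≤ D) :
    (∫ ω, f ω * g ω ∂μ) ^ 2 ≤ (∫ ω, f ω ^ 2 ∂μ) * ∫ ω, g ω ^ 2 ∂μ := by
  have i1 : Integrable (fun ω => f ω ^ 2) μ := by
    refine integrable_of_abs_le (hf.pow_const 2) (C := C ^ 2) fun ω => ?_
    rw [abs_pow]; exact pow_le_pow_left₀ (abs_nonneg _) (hC ω) 2
  have i2 : Integrable (fun ω => g ω ^ 2) μ := by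
    refine integrable_of_abs_le (hg.pow_const 2) (C := D ^ 2) fun ω => ?_
    rw [abs_pow]; exact pow_le_pow_left₀ (abs_nonneg _) (hD ω) 2
  have i3 : Integrable (fun ω => f ω * g ω) μ := by
    refine integrable_of_abs_le (hf.mul hg) (C := C * D) fun ω => ?_
    rw [abs_mul]
    exact mul_le_mul (hC ω) (hD ω) (abs_nonneg _) ((abs_nonneg _).trans (hC ω))
  have h : ∀ x : ℝ, 0 ≤ (∫ ω, f ω ^ 2 ∂μ) * (x * x) + (2 * ∫ ω, f ω * g ω ∂μ) * x +
      ∫ ω, g ω ^ 2 ∂μ := by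
    intro x
    have h0 : 0 ≤ ∫ ω, (x * f ω + g ω) ^ 2 ∂μ := integral_nonneg fun ω => sq_nonneg _
    have h1 : ∀ ω, (x * f ω + g ω) ^ 2 = x ^ 2 * f ω ^ 2 + 2 * x * (f ω * g ω) + g ω ^ 2 :=
      fun ω => by ring
    simp only [h1] at h0
    have i4 : Integrable (fun ω => x ^ 2 * f ω ^ 2 + 2 * x * (f ω * g ω)) μ :=
      (i1.const_mul _).add (i3.const_mul _)
    rw [integral_add i4 i2, integral_add (i1.const_mul _) (i3.const_mul _), integral_const_mul,
      integral_const_mul] at h0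
    linarith
  have := discrim_le_zero h
  rw [discrim] at this
  linarith

theorem sq_integral_abs_le {Ω : Type*} [MeasurableSpace Ω] {μ : Measure Ω} [IsProbabilityMeasure μ]
    {f : Ω → ℝ} (hf : Measurable f) {C : ℝ} (hC : ∀ ω, |f ω| ≤ C) :
    (∫ ω, |f ω| ∂μ) ^ 2 ≤ ∫ ω, f ω ^ 2 ∂μ := by
  have := sq_integral_mul_le (μ := μ) (f := fun ω => |f ω|) (g := fun _ => 1) hf.abs
    (C := C) (by simpa using hC) measurable_const (D := 1) (by simp)
  simpa using this

/-- The two expressions agree to second order at zero, which gives the cubic error for small `y`.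
For large `y` both have norm at most one and the bound is trivial. -/
theorem norm_exp_I_sub_le (y : ℝ) :
    ‖Complex.exp (y * Complex.I) - (1 + y * Complex.I) * (Real.exp (-y ^ 2 / 2) : ℝ)‖ ≤
      3 * |y| ^ 3 := by
  rcases le_or_gt |y| 1 with hy | hy
  · have hyI : ‖(y * Complex.I : ℂ)‖ = |y| := by simp
    have h1 := Complex.exp_bound (x := y * Complex.I) (by rw [hyI]; exact hy) (n := 3) (by norm_num)
    rw [hyI] at h1
    have hy2 : |(-y ^ 2 / 2)| = |y| ^ 2 / 2 := by
      rw [neg_div, abs_neg, abs_div, abs_pow]; norm_num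
    have hy0 := abs_nonneg y
    have h2 := Real.exp_bound (x := -y ^ 2 / 2) (by rw [hy2]; nlinarith) (n := 2) (by norm_num)
    rw [hy2] at h2
    simp only [Finset.sum_range_succ, Finset.sum_range_zero] at h1 h2
    norm_num at h1 h2
    have h3 : ‖(1 + y * Complex.I : ℂ)‖ ≤ 2 := by
      refine (norm_add_le _ _).trans ?_
      rw [hyI, norm_one]; linarith
    have h2' : ‖((Real.exp (-y ^ 2 / 2) - (1 + -y ^ 2 / 2) : ℝ) : ℂ)‖ ≤ (|y| ^ 2 / 2) ^ 2 * (3 / 4) := by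
      rw [Complex.norm_real, Real.norm_eq_abs]; simpa using h2
    -- The last summand compensates the only third-order term of (1 + iy)(1 - y²/2).
    have key : Complex.exp (y * Complex.I) - (1 + y * Complex.I) * (Real.exp (-y ^ 2 / 2) : ℝ) =
        (Complex.exp (y * Complex.I) - (1 + y * Complex.I + (y * Complex.I) ^ 2 / 2)) -
        (1 + y * Complex.I) * ((Real.exp (-y ^ 2 / 2) - (1 + -y ^ 2 / 2) : ℝ) : ℂ) +
        ((y ^ 3 / 2 : ℝ) : ℂ) * Complex.I := by
      push_cast
      linear_combination (((y : ℂ) ^ 2 / 2)) * Complex.I_sq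
    rw [key]
    refine (norm_add_le _ _).trans ?_
    have h4 : ‖((y ^ 3 / 2 : ℝ) : ℂ) * Complex.I‖ = |y| ^ 3 / 2 := by
      rw [norm_mul, Complex.norm_I, mul_one, Complex.norm_real, Real.norm_eq_abs, abs_div, abs_pow]
      norm_num
    have h5 := (norm_mul_le (1 + y * Complex.I)
      ((Real.exp (-y ^ 2 / 2) - (1 + -y ^ 2 / 2) : ℝ) : ℂ)).trans
      (mul_le_mul h3 h2' (norm_nonneg _) (by norm_num))
    have h6 := norm_sub_le (Complex.exp (y * Complex.I) - (1 + y * Complex.I + (y * Complex.I) ^ 2 / 2))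
      ((1 + y * Complex.I) * ((Real.exp (-y ^ 2 / 2) - (1 + -y ^ 2 / 2) : ℝ) : ℂ))
    rw [h4]
    have h7 : |y| ^ 4 ≤ |y| ^ 3 := pow_le_pow_of_le_one hy0 hy (by norm_num)
    have h8 : (0 : ℝ) ≤ |y| ^ 3 := by positivity
    have h9 : (|y| ^ 2 / 2) ^ 2 = |y| ^ 4 / 4 := by ring
    rw [h9] at h5
    linarith
  · refine (norm_sub_le _ _).trans ?_
    have h1 := norm_mul_exp_le_one y
    have h2 : ‖Complex.exp (y * Complex.I)‖ = 1 := Complex.norm_exp_ofReal_mul_I y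
    have h3 : (1 : ℝ) ≤ |y| ^ 3 := one_le_pow₀ hy.le
    linarith

end Analysis

/-! ### Martingale differences built from predictable functions -/

section Martingale

variable {ι : Type*}

/-- Uniformly bounded measurable functions `Z e` of the coordinates strictly before `e`. -/
structure IsPredictable (le : ι → ι → Prop) (C : ℝ) (Z : ι → (ι → Bool) → ℝ) : Prop where
  measurable : ∀ e, Measurable (Z e)
  abs_le : ∀ e ω, |Z e ω| ≤ C
  dependsOn : ∀ e, DependsOn (Z e) {f | le f e ∧ f ≠ e}

/-- The martingale difference attached to a predictable function. -/
def increment (ν : Measure Bool) (Z : (ι → Bool) → ℝ) (e : ι) (ω : ι → Bool) : ℝ :=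
  cval ν (ω e) * Z ω

variable (ν : Measure Bool) [IsProbabilityMeasure ν]

omit [IsProbabilityMeasure ν] in
theorem measurable_increment {Z : (ι → Bool) → ℝ} (hZ : Measurable Z) (e : ι) :
    Measurable (increment ν Z e) :=
  ((measurable_cval ν).comp (measurable_pi_apply e)).mul hZ

theorem abs_increment_le {Z : (ι → Bool) → ℝ} {ω : ι → Bool} {C : ℝ} (hC : |Z ω| ≤ C) (e : ι) :
    |increment ν Z e ω| ≤ C := by
  rw [increment, abs_mul]
  exact (mul_le_of_le_one_left (abs_nonneg _) (abs_cval_le ν _)).trans hC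

omit [IsProbabilityMeasure ν] in
theorem dependsOn_increment {Z : (ι → Bool) → ℝ} {J : Set ι} (hZ : DependsOn Z J) {e : ι}
    (he : e ∈ J) : DependsOn (increment ν Z e) J := by
  intro ω ω' h
  rw [increment, increment, h e he, hZ h]

variable {le : ι → ι → Prop} {C : ℝ} {Z : ι → (ι → Bool) → ℝ}

omit [IsProbabilityMeasure ν] in
theorem IsPredictable.dependsOn_increment_of_le (hZ : IsPredictable le C Z)
    (hle : IsLinearOrder ι le) {e m : ι} (hem : le e m) (hne : e ≠ m) :
    DependsOn (increment ν (Z e) e) {f | le f m ∧ f ≠ m} := by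
  refine dependsOn_increment ν ((hZ.dependsOn e).mono fun f hf => ?_) ⟨hem, hne⟩
  refine ⟨hle.trans _ _ _ hf.1 hem, fun h => hne ?_⟩
  subst h
  exact hle.antisymm _ _ hem hf.1

theorem setOf_le_ne_subset (le : ι → ι → Prop) (m : ι) :
    {f | le f m ∧ f ≠ m} ⊆ ({m}ᶜ : Set ι) := fun _ hf => hf.2

/-- The martingale property: the coin at `m` is centred and independent of the predictable factor
and of the past. -/
theorem integral_increment_smul (hZ : IsPredictable le C Z) {E : Type*} [NormedAddCommGroup E]
    [NormedSpace ℝ E] (m : ι) {h : (ι → Bool) → E} (hh : StronglyMeasurable h)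
    (hd : DependsOn h {f | le f m ∧ f ≠ m}) :
    ∫ ω, increment ν (Z m) m ω • h ω ∂coinMeasure ι ν = 0 := by
  simp only [increment, mul_smul]
  refine integral_cval_smul ν m ((hZ.measurable m).stronglyMeasurable.smul hh) ?_
  intro ω ω' hω
  have h1 : ∀ f ∈ {f | le f m ∧ f ≠ m}, ω f = ω' f := fun f hf =>
    hω f (setOf_le_ne_subset le m hf)
  simp only [hZ.dependsOn m h1, hd h1]

theorem abs_sum_increment_le (hZ : IsPredictable le C Z) (s : Finset ι) (ω : ι → Bool) :
    |∑ e ∈ s, increment ν (Z e) e ω| ≤ s.card * C := by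
  refine (Finset.abs_sum_le_sum_abs _ _).trans ?_
  refine (Finset.sum_le_card_nsmul _ _ C fun e _ => abs_increment_le ν (hZ.abs_le e ω) e).trans ?_
  simp

omit [IsProbabilityMeasure ν] in
theorem measurable_sum_increment (hZ : IsPredictable le C Z) (s : Finset ι) :
    Measurable fun ω => ∑ e ∈ s, increment ν (Z e) e ω :=
  Finset.measurable_sum _ fun e _ => measurable_increment ν (hZ.measurable e) e

theorem abs_sq_le {x C : ℝ} (h : |x| ≤ C) : |x ^ 2| ≤ C ^ 2 := by
  rw [abs_pow]; exact pow_le_pow_left₀ (abs_nonneg _) h 2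

/-- Martingale differences are orthogonal. -/
theorem integral_sq_sum_increment (hle : IsLinearOrder ι le) (hZ : IsPredictable le C Z)
    (s : Finset ι) :
    ∫ ω, (∑ e ∈ s, increment ν (Z e) e ω) ^ 2 ∂coinMeasure ι ν =
      ∑ e ∈ s, ∫ ω, increment ν (Z e) e ω ^ 2 ∂coinMeasure ι ν := by
  refine finset_induction_on_linear (P := fun s =>
    ∫ ω, (∑ e ∈ s, increment ν (Z e) e ω) ^ 2 ∂coinMeasure ι ν =
      ∑ e ∈ s, ∫ ω, increment ν (Z e) e ω ^ 2 ∂coinMeasure ι ν) hle s (by simp)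
    fun m s hm hmax ih => ?_
  rw [Finset.sum_cons, ← ih]
  have h0 : ∀ ω, (∑ e ∈ Finset.cons m s hm, increment ν (Z e) e ω) ^ 2 =
      increment ν (Z m) m ω ^ 2 +
        2 * (increment ν (Z m) m ω • ∑ e ∈ s, increment ν (Z e) e ω) +
        (∑ e ∈ s, increment ν (Z e) e ω) ^ 2 := by
    intro ω; rw [Finset.sum_cons, smul_eq_mul]; ring
  simp only [h0]
  have hmS := measurable_sum_increment ν hZ s
  have hmX := measurable_increment ν (hZ.measurable m) m
  have i1 : Integrable (fun ω => increment ν (Z m) m ω ^ 2) (coinMeasure ι ν) :=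
    integrable_of_abs_le (hmX.pow_const 2) fun ω =>
      abs_sq_le (abs_increment_le ν (hZ.abs_le m ω) m)
  have i2 : Integrable (fun ω => (∑ e ∈ s, increment ν (Z e) e ω) ^ 2) (coinMeasure ι ν) :=
    integrable_of_abs_le (hmS.pow_const 2) fun ω => abs_sq_le (abs_sum_increment_le ν hZ s ω)
  have i3 : Integrable (fun ω => increment ν (Z m) m ω • ∑ e ∈ s, increment ν (Z e) e ω)
      (coinMeasure ι ν) := by
    refine integrable_of_abs_le (hmX.mul hmS) (C := C * (s.card * C)) fun ω => ?_
    rw [smul_eq_mul, abs_mul]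
    exact mul_le_mul (abs_increment_le ν (hZ.abs_le m ω) m) (abs_sum_increment_le ν hZ s ω)
      (abs_nonneg _) ((abs_nonneg _).trans (hZ.abs_le m ω))
  have i4 : Integrable (fun ω => increment ν (Z m) m ω ^ 2 +
      2 * (increment ν (Z m) m ω • ∑ e ∈ s, increment ν (Z e) e ω)) (coinMeasure ι ν) :=
    i1.add (i3.const_mul 2)
  rw [integral_add i4 i2, integral_add i1 (i3.const_mul 2), integral_const_mul,
    integral_increment_smul ν hZ m hmS.stronglyMeasurable, mul_zero, add_zero]
  intro ω ω' hω
  exact Finset.sum_congr rfl fun e he => hZ.dependsOn_increment_of_le ν hle (hmax e he)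
    (fun h => hm (h ▸ he)) hω

theorem integrable_of_norm_le {Ω : Type*} [MeasurableSpace Ω] {μ : Measure Ω} [IsFiniteMeasure μ]
    {f : Ω → ℂ} (hf : Measurable f) {C : ℝ} (hC : ∀ ω, ‖f ω‖ ≤ C) : Integrable f μ :=
  Integrable.of_bound hf.aestronglyMeasurable C (ae_of_all _ hC)

omit [IsProbabilityMeasure ν] in
theorem measurable_prod_increment (hZ : IsPredictable le C Z) (s : Finset ι) (u : ℝ) :
    Measurable fun ω => ∏ e ∈ s, (1 + ((u * increment ν (Z e) e ω : ℝ) : ℂ) * Complex.I) :=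
  Finset.measurable_prod _ fun e _ => measurable_const.add
    ((Complex.measurable_ofReal.comp (measurable_const.mul
      (measurable_increment ν (hZ.measurable e) e))).mul measurable_const)

theorem sum_sq_increment_le (hZ : IsPredictable le C Z) (s : Finset ι) (ω : ι → Bool) :
    ∑ e ∈ s, increment ν (Z e) e ω ^ 2 ≤ s.card * C ^ 2 := by
  refine (Finset.sum_le_card_nsmul _ _ (C ^ 2) fun e _ => ?_).trans (by simp)
  exact (le_abs_self _).trans (abs_sq_le (abs_increment_le ν (hZ.abs_le e ω) e))

omit [IsProbabilityMeasure ν] in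
theorem norm_prod_increment_le_exp (s : Finset ι) (u : ℝ) (ω : ι → Bool) :
    ‖∏ e ∈ s, (1 + ((u * increment ν (Z e) e ω : ℝ) : ℂ) * Complex.I)‖ ≤
      Real.exp (u ^ 2 * (∑ e ∈ s, increment ν (Z e) e ω ^ 2) / 2) := by
  rw [norm_prod]
  refine (Finset.prod_le_prod (fun _ _ => norm_nonneg _)
    fun e _ => norm_one_add_mul_I_le _).trans ?_
  rw [← Real.exp_sum]
  refine Real.exp_le_exp.2 (le_of_eq ?_)
  rw [Finset.mul_sum, Finset.sum_div]
  exact Finset.sum_congr rfl fun e _ => by ring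

theorem norm_prod_increment_le (hZ : IsPredictable le C Z) (s : Finset ι) (u : ℝ) (ω : ι → Bool) :
    ‖∏ e ∈ s, (1 + ((u * increment ν (Z e) e ω : ℝ) : ℂ) * Complex.I)‖ ≤
      Real.exp (u ^ 2 * (s.card * C ^ 2) / 2) := by
  refine (norm_prod_increment_le_exp ν s u ω).trans (Real.exp_le_exp.2 ?_)
  have := mul_le_mul_of_nonneg_left (sum_sq_increment_le ν hZ s ω) (sq_nonneg u)
  linarith

/-- Expanding the factor of the largest edge leaves the previous product plus a martingale
difference times a function of the past, which has mean zero. -/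
theorem integral_prod_increment (hle : IsLinearOrder ι le) (hZ : IsPredictable le C Z)
    (s : Finset ι) (u : ℝ) :
    ∫ ω, ∏ e ∈ s, (1 + ((u * increment ν (Z e) e ω : ℝ) : ℂ) * Complex.I) ∂coinMeasure ι ν = 1 := by
  refine finset_induction_on_linear (P := fun s =>
    ∫ ω, ∏ e ∈ s, (1 + ((u * increment ν (Z e) e ω : ℝ) : ℂ) * Complex.I) ∂coinMeasure ι ν = 1)
    hle s (by simp) fun m s hm hmax ih => ?_
  set T : (ι → Bool) → ℂ := fun ω =>
    ∏ e ∈ s, (1 + ((u * increment ν (Z e) e ω : ℝ) : ℂ) * Complex.I) with hT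
  have hTm : Measurable T := measurable_prod_increment ν hZ s u
  have h0 : ∀ ω, ∏ e ∈ Finset.cons m s hm,
      (1 + ((u * increment ν (Z e) e ω : ℝ) : ℂ) * Complex.I) =
      T ω + increment ν (Z m) m ω • (((u : ℂ) * Complex.I) * T ω) := by
    intro ω
    rw [Finset.prod_cons, Complex.real_smul, Complex.ofReal_mul]
    change (1 + (u : ℂ) * (increment ν (Z m) m ω : ℂ) * Complex.I) * T ω = _
    ring
  simp only [h0]
  have hmX := measurable_increment ν (hZ.measurable m) m
  have hTm' : Measurable fun ω => ((u : ℂ) * Complex.I) * T ω := measurable_const.mul hTm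
  have hTb := norm_prod_increment_le ν hZ s u
  rw [integral_add, ih, integral_increment_smul ν hZ m hTm'.stronglyMeasurable, add_zero]
  · intro ω ω' hω
    simp only [hT]
    congr 1
    refine Finset.prod_congr rfl fun e he => ?_
    rw [hZ.dependsOn_increment_of_le ν hle (hmax e he) (fun h => hm (h ▸ he)) hω]
  · exact integrable_of_norm_le hTm hTb
  · refine integrable_of_norm_le (C := C * (|u| * Real.exp (u ^ 2 * (s.card * C ^ 2) / 2)))
      (hmX.smul hTm') fun ω => ?_
    rw [norm_smul, norm_mul, norm_mul, Complex.norm_I, mul_one, Complex.norm_real]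
    refine mul_le_mul (abs_increment_le ν (hZ.abs_le m ω) m) ?_ (by positivity)
      ((abs_nonneg _).trans (hZ.abs_le m ω))
    exact mul_le_mul_of_nonneg_left (hTb ω) (abs_nonneg _)

/-- A quantitative bound for the characteristic function of a sum of martingale differences. -/
theorem norm_integral_exp_sum_increment_sub_le (hle : IsLinearOrder ι le)
    (hZ : IsPredictable le C Z) (s : Finset ι) (u : ℝ) {v : ℝ} (hv : 0 ≤ v) :
    ‖∫ ω, Complex.exp (((u * ∑ e ∈ s, increment ν (Z e) e ω : ℝ) : ℂ) * Complex.I)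
        ∂coinMeasure ι ν - (Real.exp (-(u ^ 2 * v / 2)) : ℝ)‖ ≤
      3 * |u| ^ 3 * (s.card * C ^ 3) + Real.exp (u ^ 2 * (s.card * C ^ 2) / 2) *
        (u ^ 2 / 2 * ∫ ω, |∑ e ∈ s, increment ν (Z e) e ω ^ 2 - v| ∂coinMeasure ι ν) := by
  set X : ι → (ι → Bool) → ℝ := fun e => increment ν (Z e) e with hX
  set T : (ι → Bool) → ℂ := fun ω => ∏ e ∈ s, (1 + ((u * X e ω : ℝ) : ℂ) * Complex.I) with hT
  set Q : (ι → Bool) → ℝ := fun ω => ∑ e ∈ s, X e ω ^ 2 with hQ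
  set R := Real.exp (u ^ 2 * (s.card * C ^ 2) / 2) with hR
  have hXm : ∀ e, Measurable (X e) := fun e => measurable_increment ν (hZ.measurable e) e
  have hXb : ∀ e ω, |X e ω| ≤ C := fun e ω => abs_increment_le ν (hZ.abs_le e ω) e
  have hTm : Measurable T := measurable_prod_increment ν hZ s u
  have hTb : ∀ ω, ‖T ω‖ ≤ R := norm_prod_increment_le ν hZ s u
  have hQm : Measurable Q := Finset.measurable_sum _ fun e _ => (hXm e).pow_const 2
  have hQ0 : ∀ ω, 0 ≤ Q ω := fun ω => Finset.sum_nonneg fun e _ => sq_nonneg _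
  have hQb : ∀ ω, Q ω ≤ s.card * C ^ 2 := sum_sq_increment_le ν hZ s
  have hE : ∫ ω, T ω ∂coinMeasure ι ν = 1 := integral_prod_increment ν hle hZ s u
  -- Since `T` has mean one, the Gaussian factor can be written as an expectation and the difference
  -- estimated pointwise.
  have hT2 : ∫ ω, T ω * (Real.exp (-(u ^ 2 * v / 2)) : ℝ) ∂coinMeasure ι ν =
      (Real.exp (-(u ^ 2 * v / 2)) : ℝ) := by
    rw [integral_mul_const, hE, one_mul]
  have iT : Integrable (fun ω => T ω * (Real.exp (-(u ^ 2 * v / 2)) : ℝ)) (coinMeasure ι ν) :=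
    (integrable_of_norm_le hTm hTb).mul_const _
  have iexp : Integrable (fun ω => Complex.exp (((u * ∑ e ∈ s, X e ω : ℝ) : ℂ) * Complex.I))
      (coinMeasure ι ν) := by
    refine integrable_of_norm_le ?_ (C := 1) fun ω => (Complex.norm_exp_ofReal_mul_I _).le
    have : Measurable fun ω => ∑ e ∈ s, X e ω := measurable_sum_increment ν hZ s
    fun_prop
  have iabs : Integrable (fun ω => |Q ω - v|) (coinMeasure ι ν) := by
    refine integrable_of_abs_le (hQm.sub_const v).abs (C := s.card * C ^ 2 + v) fun ω => ?_
    rw [abs_abs]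
    refine (abs_sub _ _).trans ?_
    rw [abs_of_nonneg (hQ0 ω), abs_of_nonneg hv]
    linarith [hQb ω]
  rw [← hT2, ← integral_sub iexp iT]
  have hpt : ∀ ω, ‖Complex.exp (((u * ∑ e ∈ s, X e ω : ℝ) : ℂ) * Complex.I) -
      T ω * (Real.exp (-(u ^ 2 * v / 2)) : ℝ)‖ ≤
      3 * |u| ^ 3 * (s.card * C ^ 3) + R * (u ^ 2 / 2 * |Q ω - v|) := by
    intro ω
    have e1 : Complex.exp (((u * ∑ e ∈ s, X e ω : ℝ) : ℂ) * Complex.I) =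
        ∏ e ∈ s, Complex.exp (((u * X e ω : ℝ) : ℂ) * Complex.I) := by
      rw [← Complex.exp_sum, ← Finset.sum_mul]
      push_cast
      rw [Finset.mul_sum]
    have e2 : T ω * (Real.exp (-(u ^ 2 * Q ω / 2)) : ℝ) = ∏ e ∈ s,
        ((1 + ((u * X e ω : ℝ) : ℂ) * Complex.I) *
          ((Real.exp (-(u * X e ω) ^ 2 / 2) : ℝ) : ℂ)) := by
      rw [Finset.prod_mul_distrib, ← Complex.ofReal_prod, ← Real.exp_sum]
      congr 4
      simp only [hQ, Finset.mul_sum, Finset.sum_div, ← Finset.sum_neg_distrib]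
      exact Finset.sum_congr rfl fun e _ => by ring
    -- The random quadratic variation `Q` is inserted as an intermediate exponent: the first
    -- difference is the Taylor error of the factors, the second measures how far `Q` is from `v`.
    have e3 : Complex.exp (((u * ∑ e ∈ s, X e ω : ℝ) : ℂ) * Complex.I) -
        T ω * (Real.exp (-(u ^ 2 * v / 2)) : ℝ) =
        (Complex.exp (((u * ∑ e ∈ s, X e ω : ℝ) : ℂ) * Complex.I) -
          T ω * (Real.exp (-(u ^ 2 * Q ω / 2)) : ℝ)) +
        T ω * ((Real.exp (-(u ^ 2 * Q ω / 2)) - Real.exp (-(u ^ 2 * v / 2)) : ℝ) : ℂ) := by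
      push_cast; ring
    rw [e3]
    refine (norm_add_le _ _).trans (add_le_add ?_ ?_)
    · rw [e1, e2]
      refine (norm_prod_sub_prod_le_sum s (fun e => (Complex.norm_exp_ofReal_mul_I _).le)
        fun e => norm_mul_exp_le_one _).trans ?_
      refine (Finset.sum_le_card_nsmul _ _ (3 * (|u| ^ 3 * C ^ 3)) fun e _ => ?_).trans
        (le_of_eq ?_)
      · refine (norm_exp_I_sub_le _).trans ?_
        rw [abs_mul, mul_pow]
        have := pow_le_pow_left₀ (abs_nonneg _) (hXb e ω) 3
        gcongr
      · rw [nsmul_eq_mul]; ring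
    · rw [norm_mul, Complex.norm_real, Real.norm_eq_abs]
      refine mul_le_mul (hTb ω) ?_ (abs_nonneg _) (Real.exp_pos _).le
      refine (abs_exp_neg_sub_exp_neg_le (by have := hQ0 ω; positivity) (by positivity)).trans
        (le_of_eq ?_)
      have : u ^ 2 * Q ω / 2 - u ^ 2 * v / 2 = u ^ 2 / 2 * (Q ω - v) := by ring
      rw [this, abs_mul, abs_of_nonneg (by positivity)]
  have i2 : Integrable (fun ω => R * (u ^ 2 / 2 * |Q ω - v|)) (coinMeasure ι ν) :=
    (iabs.const_mul _).const_mul _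
  have i3 : Integrable (fun ω => 3 * |u| ^ 3 * (s.card * C ^ 3) + R * (u ^ 2 / 2 * |Q ω - v|))
      (coinMeasure ι ν) := (integrable_const _).add i2
  refine (norm_integral_le_of_norm_le i3 (ae_of_all _ hpt)).trans (le_of_eq ?_)
  rw [integral_add (integrable_const _) i2, integral_const, probReal_univ, one_smul,
    integral_const_mul, integral_const_mul]

end Martingale

/-! ### Influences and the martingale decomposition -/

section Influence

variable {ι : Type*}

open Classical in
/-- The configuration `ω` with the state of `e` replaced by `b`. -/
def setState (e : ι) (b : Bool) (ω : ι → Bool) : ι → Bool := Function.update ω e b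

theorem setState_self (e : ι) (b : Bool) (ω : ι → Bool) : setState e b ω e = b := by
  simp [setState]

theorem setState_of_ne {e f : ι} (h : f ≠ e) (b : Bool) (ω : ι → Bool) :
    setState e b ω f = ω f := by
  simp [setState, h]

theorem setState_apply_self (e : ι) (ω : ι → Bool) : setState e (ω e) ω = ω := by
  simp [setState]

theorem measurable_setState (e : ι) (b : Bool) : Measurable (setState e b) := by
  refine measurable_pi_lambda _ fun f => ?_
  by_cases h : f = e
  · subst h; simp only [setState_self]; exact measurable_const
  · simp only [setState_of_ne h]; exact measurable_pi_apply f

/-- The change of `f` when the state of `e` is changed from closed to open. -/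
def influence (e : ι) (f : (ι → Bool) → ℝ) (ω : ι → Bool) : ℝ :=
  f (setState e true ω) - f (setState e false ω)

/-- Any function of a single bit is affine in that bit, with slope the influence. -/
theorem eq_add_val_mul_influence (e : ι) (f : (ι → Bool) → ℝ) (ω : ι → Bool) :
    f ω = f (setState e false ω) + val (ω e) * influence e f ω := by
  have h := setState_apply_self e ω
  cases hb : ω e with
  | false => rw [hb] at h; simp [val, h]
  | true => rw [hb] at h; simp [val, influence, h]

theorem measurable_influence {f : (ι → Bool) → ℝ} (hf : Measurable f) (e : ι) :
    Measurable (influence e f) :=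
  (hf.comp (measurable_setState e true)).sub (hf.comp (measurable_setState e false))

theorem setState_congr {J : Set ι} {e : ι} {ω ω' : ι → Bool} (h : ∀ i ∈ J \ {e}, ω i = ω' i)
    (b : Bool) : ∀ i ∈ J, setState e b ω i = setState e b ω' i := by
  intro i hi
  by_cases hie : i = e
  · subst hie; rw [setState_self, setState_self]
  · rw [setState_of_ne hie, setState_of_ne hie, h i ⟨hi, hie⟩]

theorem dependsOn_comp_setState {J : Set ι} {f : (ι → Bool) → ℝ} (hf : DependsOn f J) (e : ι)
    (b : Bool) : DependsOn (fun ω => f (setState e b ω)) (J \ {e}) :=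
  fun _ _ h => hf (setState_congr h b)

theorem dependsOn_influence {J : Set ι} {f : (ι → Bool) → ℝ} (hf : DependsOn f J) (e : ι) :
    DependsOn (influence e f) (J \ {e}) := by
  intro ω ω' h
  simp only [influence]
  rw [hf (setState_congr h true), hf (setState_congr h false)]

theorem dependsOn_influence_compl (f : (ι → Bool) → ℝ) (e : ι) :
    DependsOn (influence e f) {e}ᶜ := by
  have := dependsOn_influence (dependsOn_univ f) e
  rwa [← Set.compl_eq_univ_sdiff] at this

theorem influence_comp_equiv (σ : ι ≃ ι) (e : ι) (f : (ι → Bool) → ℝ) (ω : ι → Bool) :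
    influence (σ e) (fun ω => f (ω ∘ σ)) ω = influence e f (ω ∘ σ) := by
  have h : ∀ b, setState (σ e) b ω ∘ σ = setState e b (ω ∘ σ) := by
    intro b
    funext i
    by_cases hi : i = e
    · subst hi; rw [Function.comp, setState_self, setState_self]
    · rw [Function.comp, setState_of_ne (fun h => hi (σ.injective h)), setState_of_ne hi]; rfl
  simp only [influence, h]

variable (ν : Measure Bool) [IsProbabilityMeasure ν]

/-- In the affine expansion in the coin of `e`, the intercept cancels. The known coin minus the
averaged coin is the centred coin, and the term with the averaged centred coin vanishes by
independence from the influence. -/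
theorem avg_insert_sub_avg {f : (ι → Bool) → ℝ} (hf : Measurable f) {C : ℝ}
    (hC : ∀ ω, |f ω| ≤ C) {J : Set ι} {e : ι} (he : e ∉ J) (ω : ι → Bool) :
    increment ν (avg ν (insert e J) (influence e f)) e ω =
      avg ν (insert e J) f ω - avg ν J f ω := by
  have hmix : ∀ η, ∀ i ∈ ({e}ᶜ : Set ι), mix (insert e J) ω η i = mix J ω η i := by
    intro η i hi
    by_cases hJ : i ∈ J
    · rw [mix_of_mem (Set.mem_insert_of_mem e hJ), mix_of_mem hJ]
    · rw [mix_of_notMem hJ, mix_of_notMem]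
      rintro (h | h)
      · exact hi h
      · exact hJ h
  have h1 := dependsOn_influence_compl f e
  have h0 : DependsOn (fun ω => f (setState e false ω)) {e}ᶜ := by
    have := dependsOn_comp_setState (dependsOn_univ f) e false
    rwa [← Set.compl_eq_univ_sdiff] at this
  have him : Measurable (influence e f) := measurable_influence hf e
  have hib : ∀ ω, |influence e f ω| ≤ C + C := fun ω => by
    rw [influence]
    exact (abs_sub _ _).trans (add_le_add (hC _) (hC _))
  have hmJ := measurable_mix_right J ω
  have hv : Measurable fun η : ι → Bool => cval ν (η e) :=
    (measurable_cval ν).comp (measurable_pi_apply e)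
  have hpt : ∀ η, f (mix (insert e J) ω η) - f (mix J ω η) =
      cval ν (ω e) * influence e f (mix J ω η) - cval ν (η e) • influence e f (mix J ω η) := by
    intro η
    rw [eq_add_val_mul_influence e f (mix (insert e J) ω η),
      eq_add_val_mul_influence e f (mix J ω η), h1 (hmix η),
      show f (setState e false (mix (insert e J) ω η)) = f (setState e false (mix J ω η)) from
        h0 (hmix η), mix_of_mem (Set.mem_insert e J), mix_of_notMem he, cval, cval, smul_eq_mul]
    ring
  have i1 : Integrable (fun η => cval ν (ω e) * influence e f (mix J ω η)) (coinMeasure ι ν) :=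
    (integrable_of_abs_le (him.comp hmJ) fun _ => hib _).const_mul _
  have i2 : Integrable (fun η => cval ν (η e) • influence e f (mix J ω η)) (coinMeasure ι ν) := by
    refine integrable_of_abs_le (hv.mul (him.comp hmJ)) (C := 1 * (C + C)) fun η => ?_
    rw [smul_eq_mul, abs_mul]
    exact mul_le_mul (abs_cval_le ν _) (hib _) (abs_nonneg _) zero_le_one
  have i3 : Integrable (fun η => f (mix (insert e J) ω η)) (coinMeasure ι ν) :=
    integrable_of_abs_le (hf.comp (measurable_mix_right _ ω)) fun _ => hC _
  have i4 : Integrable (fun η => f (mix J ω η)) (coinMeasure ι ν) :=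
    integrable_of_abs_le (hf.comp hmJ) fun _ => hC _
  have h2 : avg ν (insert e J) (influence e f) ω = avg ν J (influence e f) ω :=
    integral_congr_ae (ae_of_all _ fun η => h1 (hmix η))
  have h3 : ∫ η, cval ν (η e) • influence e f (mix J ω η) ∂coinMeasure ι ν = 0 := by
    refine integral_cval_smul ν e (him.comp hmJ).stronglyMeasurable ?_
    intro η η' h
    refine h1 fun i hi => ?_
    by_cases hJ : i ∈ J
    · rw [mix_of_mem hJ, mix_of_mem hJ]
    · rw [mix_of_notMem hJ, mix_of_notMem hJ, h i hi]
  rw [increment, h2, avg, avg, avg, ← integral_sub i3 i4]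
  simp only [hpt]
  rw [integral_sub i1 i2, h3, sub_zero, integral_const_mul]

/-- The martingale decomposition of a function of finitely many coordinates. -/
theorem sum_increment_avg_influence {le : ι → ι → Prop} (hle : IsLinearOrder ι le)
    {f : (ι → Bool) → ℝ} (hf : Measurable f) {C : ℝ} (hC : ∀ ω, |f ω| ≤ C) {s : Finset ι}
    (hs : DependsOn f s) (ω : ι → Bool) :
    ∑ e ∈ s, increment ν (avg ν {i | le i e} (influence e f)) e ω =
      f ω - ∫ η, f η ∂coinMeasure ι ν := by
  -- Initial segments are cut down to `s`, so that adjoining a new maximum leaves the earlier terms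
  -- unchanged and the sum telescopes. The cut is removed at the end, since `f` depends only on
  -- coordinates in `s`.
  have key : ∑ e ∈ s, increment ν (avg ν ({i | le i e} ∩ s) (influence e f)) e ω =
      avg ν s f ω - avg ν ∅ f ω := by
    refine finset_induction_on_linear (P := fun s : Finset ι =>
      ∑ e ∈ s, increment ν (avg ν ({i | le i e} ∩ s) (influence e f)) e ω =
      avg ν s f ω - avg ν ∅ f ω) hle s (by simp) fun m s hm hmax ih => ?_
    rw [Finset.sum_cons]
    have h1 : {i | le i m} ∩ (Finset.cons m s hm : Finset ι) = insert m (s : Set ι) := by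
      ext i
      simp only [Set.mem_inter_iff, Set.mem_ofPred_eq, Finset.coe_cons, Set.mem_insert_iff,
        Finset.mem_coe]
      refine ⟨fun h => h.2, fun h => ⟨?_, h⟩⟩
      rcases h with rfl | h
      · exact hle.refl _
      · exact hmax i h
    have h2 : ∀ e ∈ s, {i | le i e} ∩ (Finset.cons m s hm : Finset ι) =
        {i | le i e} ∩ (s : Set ι) := by
      intro e he
      ext i
      simp only [Set.mem_inter_iff, Set.mem_ofPred_eq, Finset.coe_cons, Set.mem_insert_iff,
        Finset.mem_coe]
      refine ⟨fun ⟨h, h'⟩ => ⟨h, ?_⟩, fun ⟨h, h'⟩ => ⟨h, Or.inr h'⟩⟩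
      rcases h' with rfl | h'
      · have : i = e := hle.antisymm _ _ h (hmax e he)
        rwa [this]
      · exact h'
    rw [h1, avg_insert_sub_avg ν hf hC (by simpa using hm), Finset.sum_congr rfl fun e he => by
      rw [h2 e he], ih, Finset.coe_cons]
    ring
  rw [avg_of_dependsOn ν hs, avg_empty] at key
  rw [← key]
  refine Finset.sum_congr rfl fun e _ => ?_
  rw [avg_congr_set ν ((dependsOn_influence hs e).mono Set.sdiff_subset)
    (J' := {i | le i e} ∩ s)]
  rw [Set.inter_assoc, Set.inter_self]

theorem exists_abs_le_of_dependsOn_finite {J : Set ι} (hJ : J.Finite) {f : (ι → Bool) → ℝ}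
    (hf : DependsOn f J) : ∃ C, ∀ ω, |f ω| ≤ C := by
  have := hJ.to_subtype
  obtain ⟨g, hg⟩ : ∃ g : (J → Bool) → ℝ, f = g ∘ J.domRestrict :=
    dependsOn_iff_exists_comp.1 hf
  obtain ⟨C, hC⟩ := (Set.finite_range fun x => |g x|).bddAbove
  exact ⟨C, fun ω => by rw [hg]; exact hC ⟨_, rfl⟩⟩

/-- The segment contains `e` itself, but `D e` ignores that coordinate, so its average depends only
on the strict past. -/
theorem isPredictable_avg {le : ι → ι → Prop} {D : ι → (ι → Bool) → ℝ} {C : ℝ}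
    (hDm : ∀ e, Measurable (D e)) (hDb : ∀ e ω, |D e ω| ≤ C) (hDd : ∀ e, DependsOn (D e) {e}ᶜ) :
    IsPredictable le C fun e => avg ν {i | le i e} (D e) where
  measurable e := measurable_avg ν _ (hDm e)
  abs_le e ω := abs_avg_le ν _ (hDb e) ω
  dependsOn e := dependsOn_avg ν (hDd e)

theorem integral_increment_sq_le {Z : (ι → Bool) → ℝ} (hZ : Measurable Z) {C : ℝ}
    (hC : ∀ ω, |Z ω| ≤ C) (e : ι) :
    ∫ ω, increment ν Z e ω ^ 2 ∂coinMeasure ι ν ≤ ∫ ω, Z ω ^ 2 ∂coinMeasure ι ν := by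
  refine integral_mono (integrable_of_abs_le ((measurable_increment ν hZ e).pow_const 2) fun ω =>
    abs_sq_le (abs_increment_le ν (hC ω) e))
    (integrable_of_abs_le (hZ.pow_const 2) fun ω => abs_sq_le (hC ω)) fun ω => ?_
  exact sq_le_sq.2 (abs_increment_le ν le_rfl e)

end Influence

/-! ### From convergence of influences to the central limit theorem -/

section CLT

variable {ι : Type*}

/-- The hypotheses of the central limit theorem for a sequence `F r` of functions of the finitely
many coins in `E r`: at scale `n r`, the influences of `F r` are close to a fixed family `D`, and
the squares of the martingale differences of `D` obey a law of large numbers. -/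
structure CLTData (ν : Measure Bool) (le : ι → ι → Prop) (E : ℕ → Finset ι) (n : ℕ → ℝ)
    (F : ℕ → (ι → Bool) → ℝ) (D : ι → (ι → Bool) → ℝ) (C K σ2 : ℝ) : Prop where
  linear : IsLinearOrder ι le
  nonneg : 0 ≤ C
  pos : ∀ r, 0 < n r
  tendsto : Tendsto n atTop atTop
  card_le : ∀ r, ((E r).card : ℝ) ≤ K * n r
  dependsOn : ∀ r, DependsOn (F r) (E r)
  influence_le : ∀ r e ω, |influence e (F r) ω| ≤ C
  measurable : ∀ e, Measurable (D e)
  abs_le : ∀ e ω, |D e ω| ≤ C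
  dependsOn_compl : ∀ e, DependsOn (D e) {e}ᶜ
  approx : Tendsto (fun r => (n r)⁻¹ * ∑ e ∈ E r,
    ∫ ω, (influence e (F r) ω - D e ω) ^ 2 ∂coinMeasure ι ν) atTop (𝓝 0)
  variance_tendsto : Tendsto (fun r => (n r)⁻¹ * ∑ e ∈ E r,
    ∫ ω, increment ν (avg ν {i | le i e} (D e)) e ω ^ 2 ∂coinMeasure ι ν) atTop (𝓝 σ2)
  lln : Tendsto (fun r => (n r)⁻¹ * ∫ ω, |∑ e ∈ E r,
    (increment ν (avg ν {i | le i e} (D e)) e ω ^ 2 -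
      ∫ η, increment ν (avg ν {i | le i e} (D e)) e η ^ 2 ∂coinMeasure ι ν)|
      ∂coinMeasure ι ν) atTop (𝓝 0)

variable {ν : Measure Bool} [IsProbabilityMeasure ν] {le : ι → ι → Prop} {E : ℕ → Finset ι}
  {n : ℕ → ℝ} {F : ℕ → (ι → Bool) → ℝ} {D : ι → (ι → Bool) → ℝ} {C K σ2 : ℝ}

namespace CLTData

/-- The sum of the limiting martingale differences. -/
def limitSum (ν : Measure Bool) (le : ι → ι → Prop) (E : ℕ → Finset ι)
    (D : ι → (ι → Bool) → ℝ) (r : ℕ) (ω : ι → Bool) : ℝ :=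
  ∑ e ∈ E r, increment ν (avg ν {i | le i e} (D e)) e ω

omit [IsProbabilityMeasure ν] in
theorem measurable_F (h : CLTData ν le E n F D C K σ2) (r : ℕ) : Measurable (F r) :=
  measurable_of_dependsOn_finite (E r).finite_toSet (h.dependsOn r)

omit [IsProbabilityMeasure ν] in
theorem measurable_influence (h : CLTData ν le E n F D C K σ2) (r : ℕ) (e : ι) :
    Measurable (influence e (F r)) :=
  PercHom.measurable_influence (h.measurable_F r) e

theorem predictable_limit (h : CLTData ν le E n F D C K σ2) :
    IsPredictable le C fun e => avg ν {i | le i e} (D e) :=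
  isPredictable_avg ν h.measurable h.abs_le h.dependsOn_compl

theorem predictable_sub (h : CLTData ν le E n F D C K σ2) (r : ℕ) :
    IsPredictable le (C + C) fun e =>
      avg ν {i | le i e} (fun ω => influence e (F r) ω - D e ω) := by
  refine isPredictable_avg ν (fun e => (h.measurable_influence r e).sub (h.measurable e))
    (fun e ω => (abs_sub _ _).trans (add_le_add (h.influence_le r e ω) (h.abs_le e ω)))
    fun e ω ω' hω => ?_
  simp only [dependsOn_influence_compl (F r) e hω, h.dependsOn_compl e hω]

theorem centred_eq (h : CLTData ν le E n F D C K σ2) (r : ℕ) (ω : ι → Bool) :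
    F r ω - ∫ η, F r η ∂coinMeasure ι ν =
      ∑ e ∈ E r, increment ν (avg ν {i | le i e} (influence e (F r))) e ω := by
  obtain ⟨B, hB⟩ := exists_abs_le_of_dependsOn_finite (E r).finite_toSet (h.dependsOn r)
  exact (sum_increment_avg_influence ν h.linear (h.measurable_F r) hB (h.dependsOn r) ω).symm

theorem centred_sub_limitSum (h : CLTData ν le E n F D C K σ2) (r : ℕ) (ω : ι → Bool) :
    F r ω - ∫ η, F r η ∂coinMeasure ι ν - limitSum ν le E D r ω =
      ∑ e ∈ E r, increment ν
        (avg ν {i | le i e} (fun ω => influence e (F r) ω - D e ω)) e ω := by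
  rw [h.centred_eq, limitSum, ← Finset.sum_sub_distrib]
  refine Finset.sum_congr rfl fun e _ => ?_
  rw [increment, increment, increment, avg_sub ν _ (h.measurable_influence r e)
    (h.influence_le r e) (h.measurable e) (h.abs_le e)]
  ring

/-- The difference is again a sum of martingale differences. Orthogonality, then contraction by the
centred coin and by conditional expectation, bounds its second moment by the sum in `approx`. -/
theorem tendsto_sq_sub (h : CLTData ν le E n F D C K σ2) :
    Tendsto (fun r => (n r)⁻¹ * ∫ ω, (F r ω - ∫ η, F r η ∂coinMeasure ι ν -
      limitSum ν le E D r ω) ^ 2 ∂coinMeasure ι ν) atTop (𝓝 0) := by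
  refine squeeze_zero (fun r => ?_) (fun r => ?_) h.approx
  · exact mul_nonneg (inv_nonneg.2 (h.pos r).le) (integral_nonneg fun ω => sq_nonneg _)
  · refine mul_le_mul_of_nonneg_left ?_ (inv_nonneg.2 (h.pos r).le)
    simp only [h.centred_sub_limitSum]
    rw [integral_sq_sum_increment ν h.linear (h.predictable_sub r)]
    refine Finset.sum_le_sum fun e _ => ?_
    have hb : ∀ ω, |influence e (F r) ω - D e ω| ≤ C + C := fun ω =>
      (abs_sub _ _).trans (add_le_add (h.influence_le r e ω) (h.abs_le e ω))
    exact (integral_increment_sq_le ν ((h.predictable_sub r).measurable e)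
      ((h.predictable_sub r).abs_le e) e).trans
      (integral_avg_sq_le ν _ ((h.measurable_influence r e).sub (h.measurable e)) hb)

theorem measurable_limitSum (h : CLTData ν le E n F D C K σ2) (r : ℕ) :
    Measurable (limitSum ν le E D r) :=
  measurable_sum_increment ν h.predictable_limit (E r)

omit [IsProbabilityMeasure ν] in
theorem measurable_centred (h : CLTData ν le E n F D C K σ2) (r : ℕ) :
    Measurable fun ω => F r ω - ∫ η, F r η ∂coinMeasure ι ν :=
  (h.measurable_F r).sub_const _

theorem tendsto_sq_limitSum (h : CLTData ν le E n F D C K σ2) :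
    Tendsto (fun r => (n r)⁻¹ * ∫ ω, limitSum ν le E D r ω ^ 2 ∂coinMeasure ι ν) atTop
      (𝓝 σ2) := by
  refine h.variance_tendsto.congr fun r => ?_
  rw [← integral_sq_sum_increment ν h.linear h.predictable_limit]
  rfl

/-- Expand the square around `limitSum`; Cauchy–Schwarz bounds the normalised cross term by the root
of a null sequence times a convergent one. -/
theorem tendsto_sq_centred (h : CLTData ν le E n F D C K σ2) :
    Tendsto (fun r => (n r)⁻¹ * ∫ ω, (F r ω - ∫ η, F r η ∂coinMeasure ι ν) ^ 2
      ∂coinMeasure ι ν) atTop (𝓝 σ2) := by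
  have h1 := h.tendsto_sq_sub
  have h2 := h.tendsto_sq_limitSum
  have h3 : Tendsto (fun r => 2 * √(((n r)⁻¹ * ∫ ω, (F r ω - ∫ η, F r η ∂coinMeasure ι ν -
      limitSum ν le E D r ω) ^ 2 ∂coinMeasure ι ν) *
      ((n r)⁻¹ * ∫ ω, limitSum ν le E D r ω ^ 2 ∂coinMeasure ι ν))) atTop (𝓝 0) := by
    have := ((h1.mul h2).sqrt).const_mul 2
    simpa using this
  have h4 : Tendsto (fun r => (n r)⁻¹ * (2 * ∫ ω, (F r ω - ∫ η, F r η ∂coinMeasure ι ν -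
      limitSum ν le E D r ω) * limitSum ν le E D r ω ∂coinMeasure ι ν)) atTop (𝓝 0) := by
    refine squeeze_zero_norm (fun r => ?_) h3
    have hcs := sq_integral_mul_le (μ := coinMeasure ι ν)
      (f := fun ω => F r ω - ∫ η, F r η ∂coinMeasure ι ν - limitSum ν le E D r ω)
      (g := limitSum ν le E D r) ((h.measurable_centred r).sub (h.measurable_limitSum r))
      (C := (E r).card * (C + C))
      (fun ω => by
        rw [h.centred_sub_limitSum]; exact abs_sum_increment_le ν (h.predictable_sub r) _ ω)
      (h.measurable_limitSum r) (abs_sum_increment_le ν h.predictable_limit (E r))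
    have hn := inv_nonneg.2 (h.pos r).le
    rw [Real.norm_eq_abs, abs_mul, abs_mul, abs_of_nonneg hn, abs_two, mul_left_comm]
    refine mul_le_mul_of_nonneg_left (Real.le_sqrt_of_sq_le ?_) zero_le_two
    rw [mul_pow, sq_abs]
    calc _ ≤ (n r)⁻¹ ^ 2 * _ := mul_le_mul_of_nonneg_left hcs (sq_nonneg _)
      _ = _ := by ring
  have h5 := (h1.add h4).add h2
  simp only [zero_add] at h5
  refine h5.congr fun r => ?_
  rw [← mul_add, ← mul_add]
  congr 1
  have hb1 : ∀ ω, |F r ω - ∫ η, F r η ∂coinMeasure ι ν - limitSum ν le E D r ω| ≤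
      (E r).card * (C + C) := fun ω => by
    rw [h.centred_sub_limitSum]; exact abs_sum_increment_le ν (h.predictable_sub r) _ ω
  have hb2 : ∀ ω, |limitSum ν le E D r ω| ≤ (E r).card * C :=
    abs_sum_increment_le ν h.predictable_limit (E r)
  have hm1 := (h.measurable_centred r).sub (h.measurable_limitSum r)
  have hm2 := h.measurable_limitSum r
  have i1 : Integrable (fun ω => (F r ω - ∫ η, F r η ∂coinMeasure ι ν -
      limitSum ν le E D r ω) ^ 2) (coinMeasure ι ν) :=
    integrable_of_abs_le (hm1.pow_const 2) fun ω => abs_sq_le (hb1 ω)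
  have i2 : Integrable (fun ω => limitSum ν le E D r ω ^ 2) (coinMeasure ι ν) :=
    integrable_of_abs_le (hm2.pow_const 2) fun ω => abs_sq_le (hb2 ω)
  have i3 : Integrable (fun ω => 2 * ((F r ω - ∫ η, F r η ∂coinMeasure ι ν -
      limitSum ν le E D r ω) * limitSum ν le E D r ω)) (coinMeasure ι ν) := by
    refine Integrable.const_mul (integrable_of_abs_le (hm1.mul hm2)
      (C := (E r).card * (C + C) * ((E r).card * C)) fun ω => ?_) 2
    rw [Pi.mul_apply, abs_mul]
    exact mul_le_mul (hb1 ω) (hb2 ω) (abs_nonneg _) ((abs_nonneg _).trans (hb1 ω))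
  have i4 : Integrable (fun ω => (F r ω - ∫ η, F r η ∂coinMeasure ι ν -
      limitSum ν le E D r ω) ^ 2 + 2 * ((F r ω - ∫ η, F r η ∂coinMeasure ι ν -
      limitSum ν le E D r ω) * limitSum ν le E D r ω)) (coinMeasure ι ν) := i1.add i3
  rw [← integral_const_mul, ← integral_add i1 i3, ← integral_add i4 i2]
  refine integral_congr_ae (ae_of_all _ fun ω => ?_)
  ring

theorem tendsto_variance (h : CLTData ν le E n F D C K σ2) :
    Tendsto (fun r => (1 / n r) * variance (F r) (coinMeasure ι ν)) atTop (𝓝 σ2) := by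
  refine h.tendsto_sq_centred.congr fun r => ?_
  rw [variance_eq_integral (h.measurable_F r).aemeasurable, one_div]

theorem tendsto_integral_exp_limitSum (h : CLTData ν le E n F D C K σ2) (t : ℝ) :
    Tendsto (fun r => ∫ ω, Complex.exp
      ((((√(n r))⁻¹ * t * limitSum ν le E D r ω : ℝ) : ℂ) * Complex.I) ∂coinMeasure ι ν) atTop
      (𝓝 (Real.exp (-(t ^ 2 * σ2 / 2)) : ℝ)) := by
  set v : ℕ → ℝ := fun r => ∑ e ∈ E r,
    ∫ ω, increment ν (avg ν {i | le i e} (D e)) e ω ^ 2 ∂coinMeasure ι ν with hv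
  have hv0 : ∀ r, 0 ≤ v r := fun r => Finset.sum_nonneg fun e _ =>
    integral_nonneg fun ω => sq_nonneg _
  have hsq : ∀ r, (√(n r))⁻¹ ^ 2 = (n r)⁻¹ := fun r => by
    rw [inv_pow, Real.sq_sqrt (h.pos r).le]
  have hu2 : ∀ r, ((√(n r))⁻¹ * t) ^ 2 = t ^ 2 * (n r)⁻¹ := fun r => by
    rw [mul_pow, hsq, mul_comm]
  have hC := h.nonneg
  have hninv : Tendsto (fun r => (√(n r))⁻¹) atTop (𝓝 0) :=
    tendsto_inv_atTop_zero.comp (Real.tendsto_sqrt_atTop.comp h.tendsto)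
  have hv : Tendsto (fun r => (Real.exp (-(((√(n r))⁻¹ * t) ^ 2 * v r / 2)) : ℂ)) atTop
      (𝓝 (Real.exp (-(t ^ 2 * σ2 / 2)) : ℝ)) := by
    have h1 : Tendsto (fun r => Real.exp (-(t ^ 2 * ((n r)⁻¹ * v r) / 2))) atTop
        (𝓝 (Real.exp (-(t ^ 2 * σ2 / 2)))) :=
      (Real.continuous_exp.tendsto _).comp (((h.variance_tendsto.const_mul _).div_const _).neg)
    refine (Complex.continuous_ofReal.tendsto _).comp (h1.congr fun r => ?_)
    rw [hu2, mul_assoc]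
  have hbound : Tendsto (fun r => 3 * |t| ^ 3 * (K * C ^ 3) * (√(n r))⁻¹ +
      Real.exp (t ^ 2 * (K * C ^ 2) / 2) * (t ^ 2 / 2 * ((n r)⁻¹ * ∫ ω, |∑ e ∈ E r,
      (increment ν (avg ν {i | le i e} (D e)) e ω ^ 2 -
      ∫ η, increment ν (avg ν {i | le i e} (D e)) e η ^ 2 ∂coinMeasure ι ν)|
      ∂coinMeasure ι ν))) atTop (𝓝 0) := by
    have := (hninv.const_mul (3 * |t| ^ 3 * (K * C ^ 3))).add
      ((h.lln.const_mul (t ^ 2 / 2)).const_mul (Real.exp (t ^ 2 * (K * C ^ 2) / 2)))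
    simpa using this
  have hdiff : Tendsto (fun r => (∫ ω, Complex.exp
      ((((√(n r))⁻¹ * t * limitSum ν le E D r ω : ℝ) : ℂ) * Complex.I) ∂coinMeasure ι ν) -
      (Real.exp (-(((√(n r))⁻¹ * t) ^ 2 * v r / 2)) : ℂ)) atTop (𝓝 0) := by
    refine squeeze_zero_norm (fun r => ?_) hbound
    refine (norm_integral_exp_sum_increment_sub_le ν h.linear h.predictable_limit (E r)
      ((√(n r))⁻¹ * t) (hv0 r)).trans (add_le_add ?_ ?_)
    -- At most `K * n r` cubic errors, each of order `n r` to the power -3/2.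
    · have ha : 0 ≤ (√(n r))⁻¹ := inv_nonneg.2 (Real.sqrt_nonneg _)
      have hn := (h.pos r).ne'
      have h3 : (√(n r))⁻¹ ^ 3 * n r = (√(n r))⁻¹ := by
        rw [pow_succ, hsq]; field_simp
      rw [abs_mul, abs_of_nonneg ha, mul_pow]
      calc 3 * ((√(n r))⁻¹ ^ 3 * |t| ^ 3) * ((E r).card * C ^ 3)
          ≤ 3 * ((√(n r))⁻¹ ^ 3 * |t| ^ 3) * (K * n r * C ^ 3) := by
            gcongr
            exact h.card_le r
        _ = 3 * |t| ^ 3 * (K * C ^ 3) * ((√(n r))⁻¹ ^ 3 * n r) := by ring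
        _ = _ := by rw [h3]
    · rw [hu2]
      have hn := (h.pos r).ne'
      have hnn := inv_nonneg.2 (h.pos r).le
      -- The linear bound on the number of edges cancels the normalisation, so the exponential
      -- prefactor stays bounded in `r`.
      have h1 : t ^ 2 * (n r)⁻¹ * ((E r).card * C ^ 2) / 2 ≤ t ^ 2 * (K * C ^ 2) / 2 := by
        calc t ^ 2 * (n r)⁻¹ * ((E r).card * C ^ 2) / 2
            ≤ t ^ 2 * (n r)⁻¹ * (K * n r * C ^ 2) / 2 := by
              gcongr
              exact h.card_le r
          _ = t ^ 2 * (K * C ^ 2) / 2 := by field_simp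
      refine mul_le_mul (Real.exp_le_exp.2 h1) (le_of_eq ?_) ?_ (Real.exp_pos _).le
      · simp only [Finset.sum_sub_distrib]
        ring
      · exact mul_nonneg (by positivity) (integral_nonneg fun ω => abs_nonneg _)
  simpa using hdiff.add hv

theorem tendsto_integral_exp (h : CLTData ν le E n F D C K σ2) (t : ℝ) :
    Tendsto (fun r => ∫ ω, Complex.exp ((((√(n r))⁻¹ * t *
      (F r ω - ∫ η, F r η ∂coinMeasure ι ν) : ℝ) : ℂ) * Complex.I) ∂coinMeasure ι ν) atTop
      (𝓝 (Real.exp (-(t ^ 2 * σ2 / 2)) : ℝ)) := by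
  have hb : Tendsto (fun r => |t| * √((n r)⁻¹ * ∫ ω, (F r ω - ∫ η, F r η ∂coinMeasure ι ν -
      limitSum ν le E D r ω) ^ 2 ∂coinMeasure ι ν)) atTop (𝓝 0) := by
    simpa using h.tendsto_sq_sub.sqrt.const_mul |t|
  have hdiff : Tendsto (fun r => (∫ ω, Complex.exp ((((√(n r))⁻¹ * t *
      (F r ω - ∫ η, F r η ∂coinMeasure ι ν) : ℝ) : ℂ) * Complex.I) ∂coinMeasure ι ν) -
      ∫ ω, Complex.exp ((((√(n r))⁻¹ * t * limitSum ν le E D r ω : ℝ) : ℂ) * Complex.I)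
      ∂coinMeasure ι ν) atTop (𝓝 0) := by
    refine squeeze_zero_norm (fun r => ?_) hb
    have hm1 := h.measurable_centred r
    have hm2 := h.measurable_limitSum r
    have hb1 : ∀ ω, |F r ω - ∫ η, F r η ∂coinMeasure ι ν - limitSum ν le E D r ω| ≤
        (E r).card * (C + C) := fun ω => by
      rw [h.centred_sub_limitSum]; exact abs_sum_increment_le ν (h.predictable_sub r) _ ω
    have ha : 0 ≤ (√(n r))⁻¹ := inv_nonneg.2 (Real.sqrt_nonneg _)
    have i1 : Integrable (fun ω => Complex.exp ((((√(n r))⁻¹ * t *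
        (F r ω - ∫ η, F r η ∂coinMeasure ι ν) : ℝ) : ℂ) * Complex.I)) (coinMeasure ι ν) :=
      integrable_of_norm_le (by fun_prop) (C := 1) fun ω => (Complex.norm_exp_ofReal_mul_I _).le
    have i2 : Integrable (fun ω => Complex.exp ((((√(n r))⁻¹ * t *
        limitSum ν le E D r ω : ℝ) : ℂ) * Complex.I)) (coinMeasure ι ν) :=
      integrable_of_norm_le (by fun_prop) (C := 1) fun ω => (Complex.norm_exp_ofReal_mul_I _).le
    have i3 : Integrable (fun ω => |F r ω - ∫ η, F r η ∂coinMeasure ι ν - limitSum ν le E D r ω|)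
        (coinMeasure ι ν) :=
      integrable_of_abs_le (hm1.sub hm2).abs fun ω => (abs_abs _).trans_le (hb1 ω)
    rw [← integral_sub i1 i2]
    refine (norm_integral_le_of_norm_le (i3.const_mul ((√(n r))⁻¹ * |t|))
      (ae_of_all _ fun ω => ?_)).trans ?_
    · refine (norm_exp_mul_I_sub_exp_mul_I_le _ _).trans (le_of_eq ?_)
      rw [← mul_sub, abs_mul, abs_mul, abs_of_nonneg ha]
    · rw [integral_const_mul, mul_comm (√(n r))⁻¹, mul_assoc]
      refine mul_le_mul_of_nonneg_left (Real.le_sqrt_of_sq_le ?_) (abs_nonneg _)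
      rw [mul_pow, inv_pow, Real.sq_sqrt (h.pos r).le]
      exact mul_le_mul_of_nonneg_left (sq_integral_abs_le (hm1.sub hm2) hb1)
        (inv_nonneg.2 (h.pos r).le)
  simpa using hdiff.add (h.tendsto_integral_exp_limitSum t)

/-- Lévy's continuity theorem. The degenerate case needs no separate treatment, as the formula for
the Gaussian characteristic function also covers variance zero. -/
theorem tendstoInDistribution (h : CLTData ν le E n F D C K σ2) {s : ℝ≥0} (hs : (s : ℝ) = σ2) :
    TendstoInDistribution
      (fun r ω => (√(n r))⁻¹ * (F r ω - ∫ η, F r η ∂coinMeasure ι ν)) atTop (id : ℝ → ℝ)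
      (fun _ => coinMeasure ι ν) (gaussianReal 0 s) where
  forall_aemeasurable r := ((h.measurable_centred r).const_mul _).aemeasurable
  tendsto := by
    refine ProbabilityMeasure.tendsto_of_tendsto_charFun fun t => ?_
    simp only [ProbabilityMeasure.coe_mk, Measure.map_id]
    rw [charFun_gaussianReal]
    have h1 := h.tendsto_integral_exp t
    convert h1 using 2 with r
    · rw [charFun_apply_real, integral_map ((h.measurable_centred r).const_mul _).aemeasurable
        (by fun_prop)]
      refine integral_congr_ae (ae_of_all _ fun ω => ?_)
      simp only
      congr 1
      push_cast
      ring
    · rw [← hs]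
      push_cast
      congr 1
      simp
      ring

end CLTData

end CLT

/-! ### The action of a group on the edges of its Cayley graph -/

section Edges

variable {Γ : Type*} [Group Γ] {S : Finset Γ}

theorem edgeTranslate_one (e : (cayley S).edgeSet) : edgeTranslate S 1 e = e := by
  apply Subtype.ext
  have : (fun x : Γ => 1 * x) = id := by funext x; simp
  simp [edgeTranslate]

theorem edgeTranslate_mul (g h : Γ) (e : (cayley S).edgeSet) :
    edgeTranslate S (g * h) e = edgeTranslate S g (edgeTranslate S h e) := by
  apply Subtype.ext
  have : (fun x : Γ => g * h * x) = (fun x => g * x) ∘ fun x => h * x := by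
    funext x; simp [mul_assoc]
  simp [edgeTranslate, Sym2.map_map, this]

theorem mem_edgeTranslate {g x : Γ} {e : (cayley S).edgeSet} :
    x ∈ (edgeTranslate S g e).1 ↔ g⁻¹ * x ∈ e.1 := by
  simp only [edgeTranslate, Sym2.mem_map]
  constructor
  · rintro ⟨y, hy, rfl⟩
    simpa using hy
  · intro h
    exact ⟨_, h, by simp⟩

/-- Left translation by `g` as a permutation of the edges. -/
def edgeEquiv (S : Finset Γ) (g : Γ) : (cayley S).edgeSet ≃ (cayley S).edgeSet where
  toFun := edgeTranslate S g
  invFun := edgeTranslate S g⁻¹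
  left_inv e := by rw [← edgeTranslate_mul, inv_mul_cancel, edgeTranslate_one]
  right_inv e := by rw [← edgeTranslate_mul, mul_inv_cancel, edgeTranslate_one]

theorem exists_adj_of_edge (e : (cayley S).edgeSet) :
    ∃ u v, ∃ h : (cayley S).Adj u v, e = ⟨s(u, v), h⟩ := by
  obtain ⟨e, he⟩ := e
  induction e with
  | _ u v => exact ⟨u, v, he, rfl⟩

/-- If h < 1, then multiplying by h gives h² < h < 1, and dually for 1 < h. Only the absence of
involutions is needed to prevent an element from swapping the endpoints of an edge. -/
theorem eq_one_of_sq_eq_one {H : Type*} [Group H] (hH : IsLeftOrderable H) {h : H}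
    (h2 : h * h = 1) : h = 1 := by
  obtain ⟨lt, hlt, hinv⟩ := hH
  have htri := hlt.trichotomous h 1
  by_contra hne
  by_cases h1 : lt h 1
  · have h3 := hinv _ _ h h1
    rw [h2, mul_one] at h3
    exact hlt.irrefl _ (hlt.trans _ _ _ h1 h3)
  · by_cases h4 : lt 1 h
    · have h3 := hinv _ _ h h4
      rw [h2, mul_one] at h3
      exact hlt.irrefl _ (hlt.trans _ _ _ h4 h3)
    · exact hne (htri h1 h4)

/-- A left-orderable subgroup acts freely on the edges. -/
theorem eq_one_of_edgeTranslate_eq {H : Subgroup Γ} (hH : IsLeftOrderable H) {h : Γ} (hh : h ∈ H)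
    {e : (cayley S).edgeSet} (he : edgeTranslate S h e = e) : h = 1 := by
  obtain ⟨u, v, huv, rfl⟩ := exists_adj_of_edge e
  have h1 : s(h * u, h * v) = s(u, v) := congrArg Subtype.val he
  rw [Sym2.eq_iff] at h1
  rcases h1 with ⟨h1, -⟩ | ⟨h1, h2⟩
  · exact mul_eq_right.1 h1
  · have h3 : h * h = 1 := by
      rw [← h1, ← mul_assoc] at h2
      exact mul_eq_right.1 h2
    have := eq_one_of_sq_eq_one hH (h := ⟨h, hh⟩) (Subtype.ext h3)
    exact congrArg Subtype.val this

theorem edgeTranslate_injective_left {H : Subgroup Γ} (hH : IsLeftOrderable H) {g h : Γ}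
    (hg : g ∈ H) (hh : h ∈ H) {e : (cayley S).edgeSet}
    (he : edgeTranslate S g e = edgeTranslate S h e) : g = h := by
  have : edgeTranslate S (h⁻¹ * g) e = e := by
    rw [edgeTranslate_mul, he, ← edgeTranslate_mul, inv_mul_cancel, edgeTranslate_one]
  have := eq_one_of_edgeTranslate_eq hH (H.mul_mem (H.inv_mem hh) hg) this
  exact (inv_mul_eq_one.1 this).symm

theorem finite_edgesIn (A : Finset Γ) : {e : (cayley S).edgeSet | ∀ x ∈ e.1, x ∈ A}.Finite := by
  classical
  refine Set.Finite.of_finite_image (f := Subtype.val) ?_ Subtype.val_injective.injOn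
  refine A.sym2.finite_toSet.subset ?_
  rintro _ ⟨e, he, rfl⟩
  exact Finset.mem_coe.2 (Finset.mem_sym2_iff.2 he)

/-- The edges with both endpoints in `A`. -/
def edgesIn (S : Finset Γ) (A : Finset Γ) : Finset (cayley S).edgeSet :=
  (finite_edgesIn A).toFinset

theorem mem_edgesIn {A : Finset Γ} {e : (cayley S).edgeSet} :
    e ∈ edgesIn S A ↔ ∀ x ∈ e.1, x ∈ A := by
  simp [edgesIn]

theorem card_edgesIn_le (A : Finset Γ) : (edgesIn S A).card ≤ S.card * A.card := by
  classical
  have h : (edgesIn S A).map (Function.Embedding.subtype _) ⊆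
      (S ×ˢ A).image fun q => s(q.2, q.2 * q.1) := by
    intro e he
    obtain ⟨e, he', rfl⟩ := Finset.mem_map.1 he
    obtain ⟨u, v, huv, rfl⟩ := exists_adj_of_edge e
    rw [mem_edgesIn] at he'
    obtain ⟨-, h⟩ := (SimpleGraph.mulCayley_adj _ _ _).1 huv
    rw [Finset.mem_image]
    rcases h with h | h
    · exact ⟨(u⁻¹ * v, u), Finset.mem_product.2 ⟨h, he' u (by simp)⟩, by simp⟩
    · refine ⟨(v⁻¹ * u, v), Finset.mem_product.2 ⟨h, he' v (by simp)⟩, ?_⟩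
      simp [Sym2.eq_swap]
  have h2 := (Finset.card_le_card h).trans Finset.card_image_le
  rwa [Finset.card_map, Finset.card_product] at h2

/-- Orbits of left multiplication by `H` are right cosets, while `Γ ⧸ H` consists of left cosets;
inversion translates between them. -/
theorem exists_finset_mul (H : Subgroup Γ) (hH : H.FiniteIndex) :
    ∃ R : Finset Γ, ∀ g, ∃ h ∈ H, h * g ∈ R := by
  classical
  have := H.fintypeQuotientOfFiniteIndex
  refine ⟨(Finset.univ : Finset (Γ ⧸ H)).image fun q => q.out⁻¹, fun g => ?_⟩
  refine ⟨((QuotientGroup.mk g⁻¹ : Γ ⧸ H).out)⁻¹ * g⁻¹, ?_, ?_⟩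
  · rw [← QuotientGroup.eq, QuotientGroup.out_eq']
  · simp only [inv_mul_cancel_right]
    exact Finset.mem_image_of_mem _ (Finset.mem_univ _)

/-- Finitely many edges meet all orbits of a subgroup of finite index. -/
theorem exists_finset_edges (S : Finset Γ) (H : Subgroup Γ) (hH : H.FiniteIndex) :
    ∃ F : Finset (cayley S).edgeSet, ∀ e, ∃ h ∈ H, edgeTranslate S h e ∈ F := by
  classical
  obtain ⟨R, hR⟩ := exists_finset_mul H hH
  -- Once one endpoint is moved into `R`, the other differs from it by a generator or the inverse of
  -- one.
  refine ⟨edgesIn S (R ∪ Finset.image₂ (fun r s => r * s) R (S ∪ S.image fun s => s⁻¹)),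
    fun e => ?_⟩
  obtain ⟨u, v, huv, rfl⟩ := exists_adj_of_edge e
  obtain ⟨h, hh, hu⟩ := hR u
  refine ⟨h, hh, mem_edgesIn.2 fun x hx => ?_⟩
  obtain ⟨-, hs⟩ := (SimpleGraph.mulCayley_adj _ _ _).1 huv
  rw [mem_edgeTranslate] at hx
  rw [Finset.mem_union]
  rcases Sym2.mem_iff.1 hx with hx | hx
  · left
    rwa [← hx, mul_inv_cancel_left] at hu
  · right
    refine Finset.mem_image₂.2 ⟨h * u, hu, u⁻¹ * v, ?_, ?_⟩
    · rw [Finset.mem_union]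
      rcases hs with hs | hs
      · exact Or.inl hs
      · exact Or.inr (Finset.mem_image.2 ⟨_, hs, by simp⟩)
    · rw [← hx]; simp [mul_assoc]

/-- Representatives of the orbits of `H` on the edges: `e` is the translate by `shift e` of its
representative `rep e`. -/
structure OrbitReps (S : Finset Γ) (H : Subgroup Γ) where
  /-- the representative of the orbit of an edge -/
  rep : (cayley S).edgeSet → (cayley S).edgeSet
  /-- the element that translates the representative to the edge -/
  shift : (cayley S).edgeSet → Γ
  /-- the finite set of representatives -/
  reps : Finset (cayley S).edgeSet
  shift_mem : ∀ e, shift e ∈ H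
  translate_rep : ∀ e, edgeTranslate S (shift e) (rep e) = e
  rep_translate : ∀ h ∈ H, ∀ e, rep (edgeTranslate S h e) = rep e
  shift_translate : ∀ h ∈ H, ∀ e, shift (edgeTranslate S h e) = h * shift e
  rep_mem : ∀ e, rep e ∈ reps
  rep_of_mem : ∀ t ∈ reps, rep t = t
  shift_of_mem : ∀ t ∈ reps, shift t = 1

theorem nonempty_orbitReps (S : Finset Γ) (H : Subgroup Γ) (hfin : H.FiniteIndex)
    (hH : IsLeftOrderable H) : Nonempty (OrbitReps S H) := by
  classical
  let r : Setoid (cayley S).edgeSet :=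
    { r := fun e f => ∃ h ∈ H, edgeTranslate S h e = f
      iseqv :=
        { refl := fun e => ⟨1, H.one_mem, edgeTranslate_one e⟩
          symm := by
            rintro e f ⟨h, hh, rfl⟩
            exact ⟨h⁻¹, H.inv_mem hh, by
              rw [← edgeTranslate_mul, inv_mul_cancel, edgeTranslate_one]⟩
          trans := by
            rintro e f g ⟨h, hh, rfl⟩ ⟨k, hk, rfl⟩
            exact ⟨k * h, H.mul_mem hk hh, edgeTranslate_mul k h e⟩ } }
  let rep : (cayley S).edgeSet → (cayley S).edgeSet := fun e => (Quotient.mk r e).out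
  have hrep : ∀ e, ∃ h ∈ H, edgeTranslate S h (rep e) = e := fun e => Quotient.mk_out (s := r) e
  choose shift hs1 hs2 using hrep
  have hrt : ∀ h ∈ H, ∀ e, rep (edgeTranslate S h e) = rep e := fun h hh e => by
    have : Quotient.mk r (edgeTranslate S h e) = Quotient.mk r e :=
      (Quotient.sound (s := r) ⟨h, hh, rfl⟩).symm
    simp only [rep, this]
  have hrr : ∀ e, rep (rep e) = rep e := fun e => by
    conv_rhs => rw [← hs2 e]
    rw [hrt _ (hs1 e)]
  obtain ⟨F, hF⟩ := exists_finset_edges S H hfin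
  have hmem : ∀ t ∈ F.image rep, rep t = t := by
    intro t ht
    obtain ⟨e, -, rfl⟩ := Finset.mem_image.1 ht
    exact hrr e
  refine ⟨⟨rep, shift, F.image rep, hs1, hs2, hrt, fun h hh e => ?_, fun e => ?_, hmem,
    fun t ht => ?_⟩⟩
  -- Freeness makes the translating element unique, hence equivariant although it was obtained by
  -- choice.
  · refine edgeTranslate_injective_left hH (hs1 _) (H.mul_mem hh (hs1 e)) (e := rep e) ?_
    rw [edgeTranslate_mul, hs2, ← hrt h hh e, hs2]
  · obtain ⟨h, hh, he⟩ := hF e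
    exact Finset.mem_image.2 ⟨_, he, hrt h hh e⟩
  · refine eq_one_of_edgeTranslate_eq hH (hs1 t) (e := t) ?_
    conv_rhs => rw [← hs2 t]
    rw [hmem t ht]

/-- The lexicographic order on `E` for an injective map to the product of a left-ordered group
and a set. -/
theorem exists_linearOrder_lex {E H R : Type*} [Group H] (hH : IsLeftOrderable H) {s : E → H}
    {ρ : E → R} (hinj : ∀ e e', s e = s e' → ρ e = ρ e' → e = e') :
    ∃ le : E → E → Prop, IsLinearOrder E le ∧ ∀ h e e' f f', s f = h * s e → ρ f = ρ e →
      s f' = h * s e' → ρ f' = ρ e' → le e e' → le f f' := by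
  classical
  obtain ⟨lt, hlt, hinv⟩ := hH
  let _ : LinearOrder H := linearOrderOfSTO lt
  let _ : LinearOrder R := linearOrderOfSTO WellOrderingRel
  let F : E → Lex (H × R) := fun e => toLex (s e, ρ e)
  have hF : Function.Injective F := by
    intro e e' h
    have h1 : (s e, ρ e) = (s e', ρ e') := toLex.injective h
    rw [Prod.mk.injEq] at h1
    exact hinj e e' h1.1 h1.2
  refine ⟨fun e e' => F e ≤ F e', ?_, ?_⟩
  · exact
      { refl := fun e => le_refl _
        trans := fun a b c => le_trans
        antisymm := fun a b h1 h2 => hF (le_antisymm h1 h2)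
        total := fun a b => le_total (F a) (F b) }
  · intro h e e' f f' h1 h2 h3 h4 hle
    simp only [F] at hle ⊢
    rw [h1, h2, h3, h4]
    rw [Prod.Lex.toLex_le_toLex] at hle ⊢
    rcases hle with hle | ⟨h5, h6⟩
    · exact Or.inl (hinv _ _ _ hle)
    · exact Or.inr ⟨congrArg (h * ·) h5, h6⟩

theorem OrbitReps.exists_isInvariantOrder {H : Subgroup Γ} (O : OrbitReps S H)
    (hH : IsLeftOrderable H) : ∃ le, IsInvariantOrder S H le := by
  obtain ⟨le, h1, h2⟩ := exists_linearOrder_lex hH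
    (s := fun e => (⟨O.shift e, O.shift_mem e⟩ : H)) (ρ := O.rep) fun e e' h1 h2 => by
      have h1' : O.shift e = O.shift e' := congrArg Subtype.val h1
      rw [← O.translate_rep e, ← O.translate_rep e', h2, h1']
  refine ⟨le, h1, fun h hh e e' => h2 ⟨h, hh⟩ e e' _ _ ?_ ?_ ?_ ?_⟩
  · exact Subtype.ext (O.shift_translate h hh e)
  · exact O.rep_translate h hh e
  · exact Subtype.ext (O.shift_translate h hh e')
  · exact O.rep_translate h hh e'

end Edges

/-! ### Følner sequences -/

section Folner

variable {Γ : Type*} [Group Γ] {S : Finset Γ}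

open Classical in
/-- The number of elements of `A` that right multiplication by `w` moves out of `A`. -/
def escape (A : Finset Γ) (w : Γ) : ℕ := (A.filter fun g => g * w ∉ A).card

theorem escape_one (A : Finset Γ) : escape A 1 = 0 := by
  simp [escape]

/-- An element expelled by `x * y` either leaves at the first step or reaches a point of `A`
expelled by `y`. -/
theorem escape_mul_le (A : Finset Γ) (x y : Γ) : escape A (x * y) ≤ escape A x + escape A y := by
  classical
  have h : (A.filter fun g => g * (x * y) ∉ A) ⊆ (A.filter fun g => g * x ∉ A) ∪
      ((A.filter fun g => g * y ∉ A).image fun g => g * x⁻¹) := by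
    intro g hg
    rw [Finset.mem_filter] at hg
    rw [Finset.mem_union, Finset.mem_filter, Finset.mem_image]
    by_cases hx : g * x ∈ A
    · right
      exact ⟨g * x, Finset.mem_filter.2 ⟨hx, by rw [mul_assoc]; exact hg.2⟩, by simp⟩
    · exact Or.inl ⟨hg.1, hx⟩
  exact (Finset.card_le_card h).trans ((Finset.card_union_le _ _).trans
    (Nat.add_le_add_left Finset.card_image_le _))

/-- Right multiplication by `x` matches the elements that stay under `x` with those that stay under
its inverse; the complements in `A` then have equal size. -/
theorem escape_inv (A : Finset Γ) (x : Γ) : escape A x⁻¹ = escape A x := by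
  classical
  have key : ∀ y : Γ, (A.filter fun g => g * y ∈ A).card ≤ (A.filter fun g => g * y⁻¹ ∈ A).card := by
    intro y
    refine Finset.card_le_card_of_injOn (fun g => g * y) ?_ (fun _ _ _ _ h => mul_right_cancel h)
    intro g hg
    have hg := Finset.mem_filter.1 (Finset.mem_coe.1 hg)
    exact Finset.mem_coe.2 (Finset.mem_filter.2 ⟨hg.2, by simpa using hg.1⟩)
  have h1 := key x
  have h2 := key x⁻¹
  rw [inv_inv] at h2
  have h3 := A.card_filter_add_card_filter_not (fun g => g * x ∈ A)
  have h4 := A.card_filter_add_card_filter_not (fun g => g * x⁻¹ ∈ A)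
  simp only [escape]
  omega

theorem escape_le_of_mem (A : Finset Γ) {s : Γ} (hs : s ∈ S) :
    escape A s ≤ (innerBoundary (cayley S) (A : Set Γ)).ncard := by
  classical
  rw [escape, ← Set.ncard_coe_finset]
  refine Set.ncard_le_ncard ?_ (A.finite_toSet.subset fun x hx => hx.1)
  intro g hg
  have hg := Finset.mem_filter.1 (Finset.mem_coe.1 hg)
  refine ⟨hg.1, g * s, fun h => hg.2 h, (SimpleGraph.mulCayley_adj _ _ _).2 ⟨?_, Or.inl ?_⟩⟩
  · intro h; apply hg.2; rw [← h]; exact hg.1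
  · simpa using hs

variable {A : ℕ → Finset Γ}

/-- Subadditivity and symmetry of `escape` reduce to generators, whose escaping elements lie in the
inner boundary. This is the form in which the Følner condition is used. -/
theorem tendsto_escape (hgen : Subgroup.closure (S : Set Γ) = ⊤)
    (hA : IsExhaustiveFolner (cayley S) A) (w : Γ) :
    Tendsto (fun r => (escape (A r) w : ℝ) / (A r).card) atTop (𝓝 0) := by
  have hw : w ∈ Subgroup.closure (S : Set Γ) := by rw [hgen]; trivial
  induction hw using Subgroup.closure_induction with
  | mem s hs =>
    refine squeeze_zero (fun r => by positivity) (fun r => ?_) hA.folner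
    have := escape_le_of_mem (A r) (S := S) hs
    gcongr
  | one => simp [escape_one]
  | mul x y _ _ hx hy =>
    refine squeeze_zero (fun r => by positivity) (fun r => ?_) (by simpa using hx.add hy)
    rw [← add_div]
    have := escape_mul_le (A r) x y
    gcongr
    exact_mod_cast this
  | inv x _ hx => simpa only [escape_inv] using hx

omit [Group Γ] in
theorem IsExhaustiveFolner.tendsto_atTop {G : SimpleGraph Γ} (hA : IsExhaustiveFolner G A) :
    Tendsto A atTop atTop :=
  tendsto_atTop_finset_of_monotone (monotone_nat_of_le_succ hA.mono) hA.exhaust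

omit [Group Γ] in
theorem IsExhaustiveFolner.tendsto_card [Infinite Γ] {G : SimpleGraph Γ}
    (hA : IsExhaustiveFolner G A) : Tendsto (fun r => ((A r).card : ℝ)) atTop atTop := by
  refine tendsto_natCast_atTop_atTop.comp (Filter.tendsto_atTop.2 fun n => ?_)
  obtain ⟨B, hB⟩ := Infinite.exists_subset_card_eq Γ n
  filter_upwards [hA.tendsto_atTop.eventually (eventually_ge_atTop B)] with r hr
  rw [← hB]
  exact Finset.card_le_card hr

omit [Group Γ] in
theorem IsExhaustiveFolner.card_pos {G : SimpleGraph Γ} (hA : IsExhaustiveFolner G A) (r : ℕ) :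
    (0 : ℝ) < (A r).card := by
  exact_mod_cast (hA.nonempty r).card_pos

theorem tendsto_translate_atTop [DecidableEq Γ] (g : Γ) :
    Tendsto (fun A : Finset Γ => A.image (g * ·)) atTop atTop := by
  refine tendsto_atTop.2 fun B => ?_
  filter_upwards [eventually_ge_atTop (B.image (g⁻¹ * ·))] with A hAB x hx
  refine Finset.mem_image.2 ⟨g⁻¹ * x, hAB (Finset.mem_image_of_mem _ hx), by simp⟩

open Classical in
/-- The number of elements of `A` in a right coset, labelled by the left coset of inverses. -/
def cosetCount (H : Subgroup Γ) (A : Finset Γ) (q : Γ ⧸ H) : ℕ :=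
  (A.filter fun g => (QuotientGroup.mk g⁻¹ : Γ ⧸ H) = q).card

/-- Right multiplication by `w` carries one class injectively into the other, apart from the
elements that leave `A`. -/
theorem cosetCount_le (H : Subgroup Γ) (A : Finset Γ) (w : Γ) (q : Γ ⧸ H) :
    cosetCount H A q ≤ cosetCount H A (w⁻¹ • q) + escape A w := by
  classical
  have h : (A.filter fun g => (QuotientGroup.mk g⁻¹ : Γ ⧸ H) = q) ⊆
      ((A.filter fun g => (QuotientGroup.mk g⁻¹ : Γ ⧸ H) = w⁻¹ • q).image fun g => g * w⁻¹) ∪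
      (A.filter fun g => g * w ∉ A) := by
    intro g hg
    rw [Finset.mem_filter] at hg
    rw [Finset.mem_union, Finset.mem_filter, Finset.mem_image]
    by_cases hx : g * w ∈ A
    · left
      refine ⟨g * w, Finset.mem_filter.2 ⟨hx, ?_⟩, by simp⟩
      rw [← hg.2, mul_inv_rev]; rfl
    · exact Or.inr ⟨hg.1, hx⟩
  exact (Finset.card_le_card h).trans ((Finset.card_union_le _ _).trans
    (Nat.add_le_add_right Finset.card_image_le _))

/-- `Γ` acts transitively on the cosets, so all densities differ by null sequences; they add up to
one, hence each tends to the reciprocal of the index. -/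
theorem tendsto_cosetCount (hgen : Subgroup.closure (S : Set Γ) = ⊤)
    (hA : IsExhaustiveFolner (cayley S) A) (H : Subgroup Γ) (hH : H.FiniteIndex) (q : Γ ⧸ H) :
    Tendsto (fun r => (cosetCount H (A r) q : ℝ) / (A r).card) atTop (𝓝 (1 / H.index)) := by
  classical
  have := H.fintypeQuotientOfFiniteIndex
  have hdiff : ∀ q', Tendsto (fun r => (cosetCount H (A r) q : ℝ) / (A r).card -
      (cosetCount H (A r) q' : ℝ) / (A r).card) atTop (𝓝 0) := by
    intro q'
    obtain ⟨w, hw⟩ := MulAction.exists_smul_eq Γ q q'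
    refine squeeze_zero_norm (fun r => ?_) (tendsto_escape hgen hA w)
    have h1 := cosetCount_le H (A r) w⁻¹ q
    have h2 := cosetCount_le H (A r) w q'
    rw [inv_inv, hw, escape_inv] at h1
    rw [← hw, inv_smul_smul, hw] at h2
    have h1' : (cosetCount H (A r) q : ℝ) ≤ cosetCount H (A r) q' + escape (A r) w := by
      exact_mod_cast h1
    have h2' : (cosetCount H (A r) q' : ℝ) ≤ cosetCount H (A r) q + escape (A r) w := by
      exact_mod_cast h2
    rw [← sub_div, Real.norm_eq_abs, abs_div, abs_of_pos (hA.card_pos r)]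
    refine div_le_div_of_nonneg_right ?_ (hA.card_pos r).le
    rw [abs_le]
    constructor <;> linarith
  have hsum : ∀ r, ∑ q', (cosetCount H (A r) q' : ℝ) / (A r).card = 1 := by
    intro r
    rw [← Finset.sum_div, div_eq_one_iff_eq (hA.card_pos r).ne']
    have := Finset.card_eq_sum_card_fiberwise (s := A r) (t := Finset.univ)
      (f := fun g => (QuotientGroup.mk g⁻¹ : Γ ⧸ H)) (by simp [Set.MapsTo])
    rw [this]
    push_cast
    rfl
  have hlim := (tendsto_finsetSum Finset.univ fun q' _ => hdiff q')
  simp only [Finset.sum_sub_distrib, hsum, Finset.sum_const,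
    Finset.card_univ, nsmul_eq_mul] at hlim
  have hcard : (Fintype.card (Γ ⧸ H) : ℝ) = H.index := by
    rw [Subgroup.index_eq_card, Nat.card_eq_fintype_card]
  rw [hcard] at hlim
  have hne : (H.index : ℝ) ≠ 0 := by exact_mod_cast hH.index_ne_zero
  have h3 := (hlim.add_const 1).div_const (H.index : ℝ)
  rw [mul_zero, zero_add] at h3
  refine h3.congr fun r => ?_
  field_simp
  ring

end Folner

/-! ### The Betti number functional of percolation -/

section Functional

variable {Γ : Type*} [Group Γ] {S : Finset Γ}

open Classical in
open scoped Pointwise in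
/-- The elements of `Γ` of word length at most `T`. -/
def wordBall (S : Finset Γ) (T : ℕ) : Finset Γ := (insert 1 (S ∪ S⁻¹)) ^ T

open scoped Pointwise in
theorem inv_mul_mem_wordBall {T : ℕ} {u v : Γ} (h : (cayley S).edist u v ≤ T) :
    u⁻¹ * v ∈ wordBall S T := by
  classical
  have key : ∀ {u v : Γ} (w : (cayley S).Walk u v), u⁻¹ * v ∈ wordBall S w.length := by
    intro u v w
    induction w with
    | nil => simp [wordBall]
    | @cons u v w hadj q ih =>
      rw [SimpleGraph.Walk.length_cons, wordBall, pow_succ']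
      have h1 : u⁻¹ * w = (u⁻¹ * v) * (v⁻¹ * w) := by group
      rw [h1]
      refine Finset.mul_mem_mul ?_ ih
      obtain ⟨-, hs⟩ := (SimpleGraph.mulCayley_adj _ _ _).1 hadj
      refine Finset.mem_insert_of_mem (Finset.mem_union.2 ?_)
      rcases hs with hs | hs
      · exact Or.inl hs
      · refine Or.inr (Finset.mem_inv'.2 ?_)
        simpa using hs
  obtain ⟨w, hw⟩ := SimpleGraph.exists_walk_of_edist_ne_top
    (ne_top_of_le_ne_top (ENat.natCast_ne_top T) h)
  rw [← hw] at h
  have hle : w.length ≤ T := by exact_mod_cast h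
  exact Finset.pow_subset_pow_right (Finset.mem_insert_self _ _) hle (key w)

variable (Δ : LocalComplexRule (cayley S)) (k : ℕ)

/-- The Betti number of the complex of the open subgraph on a finite set of vertices. -/
def bettiOn (A : Finset Γ) (ω : Config (cayley S)) : ℝ := bettiFunctional Δ k ω (A : Set Γ)

theorem openSubgraph_congr {A : Finset Γ} {ω ω' : Config (cayley S)}
    (h : ∀ e ∈ edgesIn S A, ω e = ω' e) :
    openSubgraph ω (A : Set Γ) = openSubgraph ω' (A : Set Γ) := by
  refine SimpleGraph.Subgraph.ext rfl ?_
  funext u v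
  refine propext (and_congr_right fun hu => and_congr_right fun hv =>
    exists_congr fun huv => ?_)
  rw [h ⟨s(u, v), huv⟩ (mem_edgesIn.2 fun x hx => ?_)]
  rcases Sym2.mem_iff.1 hx with rfl | rfl
  · exact hu
  · exact hv

theorem dependsOn_bettiOn (A : Finset Γ) :
    DependsOn (bettiOn Δ k A) (edgesIn S A : Set (cayley S).edgeSet) := by
  intro ω ω' h
  rw [bettiOn, bettiOn, bettiFunctional, bettiFunctional, openSubgraph_congr h]

theorem measurable_bettiOn (A : Finset Γ) : Measurable (bettiOn Δ k A) :=
  measurable_of_dependsOn_finite (Finset.finite_toSet _) (dependsOn_bettiOn Δ k A)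

/-- Left translation by `g` as an automorphism of the Cayley graph. -/
def translateIso (S : Finset Γ) (g : Γ) : cayley S ≃g cayley S where
  toEquiv := Equiv.mulLeft g
  map_rel_iff' := SimpleGraph.mulCayley_adj_mul_iff_right

theorem openSubgraph_translate [DecidableEq Γ] (g : Γ) (A : Finset Γ) (ω : Config (cayley S)) :
    openSubgraph ω ((A.image (g * ·) : Finset Γ) : Set Γ) =
      (openSubgraph (ω ∘ edgeEquiv S g) (A : Set Γ)).map (translateIso S g).toHom := by
  refine SimpleGraph.Subgraph.ext ?_ ?_
  · simp only [openSubgraph, Finset.coe_image, SimpleGraph.Subgraph.map_verts]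
    rfl
  · funext u v
    refine propext ⟨?_, ?_⟩
    · rintro ⟨hu, hv, huv, hω⟩
      obtain ⟨u, hu', rfl⟩ := Finset.mem_image.1 hu
      obtain ⟨v, hv', rfl⟩ := Finset.mem_image.1 hv
      exact ⟨u, v, ⟨hu', hv', SimpleGraph.mulCayley_adj_mul_iff_right.1 huv, hω⟩, rfl, rfl⟩
    · rintro ⟨u, v, ⟨hu, hv, huv, hω⟩, rfl, rfl⟩
      exact ⟨Finset.mem_image_of_mem _ hu, Finset.mem_image_of_mem _ hv,
        SimpleGraph.mulCayley_adj_mul_iff_right.2 huv, hω⟩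

theorem bettiOn_translate [DecidableEq Γ] (g : Γ) (A : Finset Γ) (ω : Config (cayley S)) :
    bettiOn Δ k (A.image (g * ·)) ω = bettiOn Δ k A (ω ∘ edgeEquiv S g) := by
  rw [bettiOn, bettiFunctional, openSubgraph_translate, bettiOn, bettiFunctional]
  exact betti_relabel (translateIso S g).toEquiv (A := A) (fun σ hσ => Δ.subset_verts _ σ hσ)
    (Δ.equivariant (translateIso S g) _) k

theorem openSubgraph_mono_set (ω : Config (cayley S)) {A B : Set Γ} (h : A ⊆ B) :
    openSubgraph ω A ≤ openSubgraph ω B :=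
  ⟨h, fun _ _ ⟨hu, hv, huv⟩ => ⟨h hu, h hv, huv⟩⟩

theorem openSubgraph_mono_config {ω ω' : Config (cayley S)} (h : ∀ e, ω e = true → ω' e = true)
    (A : Set Γ) : openSubgraph ω A ≤ openSubgraph ω' A :=
  ⟨subset_rfl, fun _ _ ⟨hu, hv, huv, ho⟩ => ⟨hu, hv, huv, h _ ho⟩⟩

/-- A uniform bound for the influence of one edge on a Betti number. -/
theorem exists_influence_bound : ∃ C : ℝ, 0 ≤ C ∧ ∀ e ω,
    (∀ A, |influence e (bettiOn Δ k A) ω| ≤ C) ∧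
    ∃ d, ∀ᶠ A in atTop, influence e (bettiOn Δ k A) ω = d := by
  classical
  obtain ⟨T, hT⟩ := Δ.confined
  have hnn : ∀ N, 0 ≤ bettiBound N k := fun N => by unfold bettiBound; positivity
  refine ⟨bettiBound (wordBall S T).card k, hnn _, fun e ω => ?_⟩
  obtain ⟨u, v, huv, rfl⟩ := exists_adj_of_edge e
  set e : (cayley S).edgeSet := ⟨s(u, v), huv⟩ with he
  have hopen : ∀ f, setState e false ω f = true → setState e true ω f = true := by
    intro f hf
    by_cases h : f = e
    · rw [h, setState_self]
    · rwa [setState_of_ne h] at hf ⊢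
  -- Translating the ball does not change its size, so the bound is the same for all edges.
  have hcard : ((wordBall S T).image (u * ·)).card = (wordBall S T).card :=
    Finset.card_image_of_injective _ (mul_right_injective u)
  have main := betti_sub_betti (ι := Finset Γ)
    (K := fun A => Δ.complex (openSubgraph (setState e false ω) (A : Set Γ)))
    (L := fun A => Δ.complex (openSubgraph (setState e true ω) (A : Set Γ)))
    (A := id) (B := (wordBall S T).image (u * ·))
    (fun A A' h => Δ.monotone _ _ (openSubgraph_mono_set _ (Finset.coe_subset.2 h)))
    (fun A A' h => Δ.monotone _ _ (openSubgraph_mono_set _ (Finset.coe_subset.2 h)))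
    (fun A => Δ.monotone _ _ (openSubgraph_mono_config hopen _))
    (fun A σ hσ => Δ.subset_verts _ σ hσ)
    (fun A σ hσ => ?_) k
  · rw [hcard] at main
    exact main
  · obtain ⟨L, hL, -, hdist, hσL⟩ := hT _ σ hσ
    -- If the confining subgraph avoids the edge, the simplex is already present when the edge is
    -- closed. Otherwise `u` is one of its vertices, and the simplex lies in the ball around `u`.
    by_cases hLe : L.Adj u v
    · right
      intro x hx
      have hxL := Δ.subset_verts L σ hσL hx
      have := inv_mul_mem_wordBall (hdist u (L.edge_vert hLe) x hxL)
      exact Finset.mem_coe.2 (Finset.mem_image.2 ⟨_, this, by simp⟩)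
    · left
      refine Δ.monotone L (openSubgraph (setState e false ω) (A : Set Γ))
        ⟨hL.1, fun a b hab => ?_⟩ hσL
      obtain ⟨ha, hb, hadj, ho⟩ := hL.2 hab
      refine ⟨ha, hb, hadj, ?_⟩
      rwa [setState_of_ne] at ho ⊢
      all_goals
        intro h
        apply hLe
        have h1 : s(a, b) = s(u, v) := congrArg Subtype.val h
        rcases Sym2.eq_iff.1 h1 with ⟨rfl, rfl⟩ | ⟨rfl, rfl⟩
        · exact hab
        · exact hab.symm

/-- The uniform bound for the influence of one edge. -/
def influenceBound : ℝ := (exists_influence_bound Δ k).choose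

theorem influenceBound_nonneg : 0 ≤ influenceBound Δ k :=
  (exists_influence_bound Δ k).choose_spec.1

theorem abs_influence_bettiOn_le (A : Finset Γ) (e : (cayley S).edgeSet) (ω : Config (cayley S)) :
    |influence e (bettiOn Δ k A) ω| ≤ influenceBound Δ k :=
  ((exists_influence_bound Δ k).choose_spec.2 e ω).1 A

/-- The influence of an edge on the Betti number of the infinite percolation configuration. -/
def limitInfluence (e : (cayley S).edgeSet) (ω : Config (cayley S)) : ℝ :=
  ((exists_influence_bound Δ k).choose_spec.2 e ω).2.choose

theorem tendsto_influence_bettiOn (e : (cayley S).edgeSet) (ω : Config (cayley S)) :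
    Tendsto (fun A => influence e (bettiOn Δ k A) ω) atTop (𝓝 (limitInfluence Δ k e ω)) :=
  tendsto_const_nhds.congr' (((exists_influence_bound Δ k).choose_spec.2 e ω).2.choose_spec.mono
    fun _ h => h.symm)

theorem abs_limitInfluence_le (e : (cayley S).edgeSet) (ω : Config (cayley S)) :
    |limitInfluence Δ k e ω| ≤ influenceBound Δ k :=
  le_of_tendsto (tendsto_influence_bettiOn Δ k e ω).abs
    (Eventually.of_forall fun A => abs_influence_bettiOn_le Δ k A e ω)

theorem dependsOn_limitInfluence (e : (cayley S).edgeSet) :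
    DependsOn (limitInfluence Δ k e) {e}ᶜ := by
  intro ω ω' h
  refine tendsto_nhds_unique (tendsto_influence_bettiOn Δ k e ω)
    ((tendsto_influence_bettiOn Δ k e ω').congr fun A => ?_)
  exact (dependsOn_influence_compl _ e h).symm

theorem influence_bettiOn_translate [DecidableEq Γ] (g : Γ) (A : Finset Γ)
    (e : (cayley S).edgeSet) (ω : Config (cayley S)) :
    influence (edgeTranslate S g e) (bettiOn Δ k (A.image (g * ·))) ω =
      influence e (bettiOn Δ k A) (ω ∘ edgeEquiv S g) := by
  have : bettiOn Δ k (A.image (g * ·)) = fun ω => bettiOn Δ k A (ω ∘ edgeEquiv S g) :=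
    funext fun ω => bettiOn_translate Δ k g A ω
  rw [this]
  exact influence_comp_equiv (edgeEquiv S g) e (bettiOn Δ k A) ω

/-- Translation is cofinal on finite sets, so both sides are limits of the same net. Covariance is
available because the limit runs over all finite windows rather than along `A`. -/
theorem limitInfluence_translate (g : Γ) (e : (cayley S).edgeSet) (ω : Config (cayley S)) :
    limitInfluence Δ k (edgeTranslate S g e) ω = limitInfluence Δ k e (ω ∘ edgeEquiv S g) := by
  classical
  refine tendsto_nhds_unique ((tendsto_influence_bettiOn Δ k (edgeTranslate S g e) ω).comp
    (tendsto_translate_atTop g)) ?_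
  refine (tendsto_influence_bettiOn Δ k e (ω ∘ edgeEquiv S g)).congr fun A => ?_
  exact (influence_bettiOn_translate Δ k g A e ω).symm

theorem measurable_influence_bettiOn (A : Finset Γ) (e : (cayley S).edgeSet) :
    Measurable (influence e (bettiOn Δ k A)) :=
  measurable_influence (measurable_bettiOn Δ k A) e

theorem measurable_limitInfluence [Countable Γ] (e : (cayley S).edgeSet) :
    Measurable (limitInfluence Δ k e) :=
  measurable_of_tendsto_metrizable' atTop (fun A => measurable_influence_bettiOn Δ k A e)
    (tendsto_pi_nhds.2 (tendsto_influence_bettiOn Δ k e))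

/-- Bounded convergence along the net of finite sets, which countability of `Γ` makes legitimate. -/
theorem tendsto_integral_sq_influence_sub [Countable Γ] (ν : Measure Bool) [IsProbabilityMeasure ν]
    (e : (cayley S).edgeSet) :
    Tendsto (fun A => ∫ ω, (influence e (bettiOn Δ k A) ω - limitInfluence Δ k e ω) ^ 2
      ∂coinMeasure (cayley S).edgeSet ν) atTop (𝓝 0) := by
  have h := tendsto_integral_filter_of_dominated_convergence
    (μ := coinMeasure (cayley S).edgeSet ν) (l := (atTop : Filter (Finset Γ)))
    (F := fun A ω => (influence e (bettiOn Δ k A) ω - limitInfluence Δ k e ω) ^ 2)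
    (f := fun _ => 0) (fun _ => (influenceBound Δ k + influenceBound Δ k) ^ 2)
    (Eventually.of_forall fun A => (((measurable_influence_bettiOn Δ k A e).sub
      (measurable_limitInfluence Δ k e)).pow_const 2).aestronglyMeasurable)
    (Eventually.of_forall fun A => ae_of_all _ fun ω => abs_sq_le ((abs_sub _ _).trans
      (add_le_add (abs_influence_bettiOn_le Δ k A e ω) (abs_limitInfluence_le Δ k e ω))))
    (integrable_const _)
    (ae_of_all _ fun ω => ?_)
  · simpa using h
  · have := (((tendsto_influence_bettiOn Δ k e ω).sub_const (limitInfluence Δ k e ω)).pow 2)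
    simpa using this

theorem integral_sq_influence_sub_translate [Countable Γ] [DecidableEq Γ] (ν : Measure Bool)
    [IsProbabilityMeasure ν] (g : Γ) (A : Finset Γ) (e : (cayley S).edgeSet) :
    ∫ ω, (influence (edgeTranslate S g e) (bettiOn Δ k (A.image (g * ·))) ω -
        limitInfluence Δ k (edgeTranslate S g e) ω) ^ 2 ∂coinMeasure (cayley S).edgeSet ν =
      ∫ ω, (influence e (bettiOn Δ k A) ω - limitInfluence Δ k e ω) ^ 2
        ∂coinMeasure (cayley S).edgeSet ν := by
  rw [← integral_comp_equiv ν (edgeEquiv S g)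
    (f := fun ω => (influence e (bettiOn Δ k A) ω - limitInfluence Δ k e ω) ^ 2)
    (((measurable_influence_bettiOn Δ k A e).sub
    (measurable_limitInfluence Δ k e)).pow_const 2)]
  refine integral_congr_ae (ae_of_all _ fun ω => ?_)
  simp only [influence_bettiOn_translate, limitInfluence_translate]

/-- Invariance of the order, applied to `h` and its inverse, says that translation maps the past of
`e` onto the past of its translate. -/
theorem increment_avg_translate (ν : Measure Bool) [IsProbabilityMeasure ν] {H : Subgroup Γ}
    {le : (cayley S).edgeSet → (cayley S).edgeSet → Prop} (hle : IsInvariantOrder S H le) {h : Γ}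
    (hh : h ∈ H) {f f' : Config (cayley S) → ℝ} (hf : Measurable f)
    (hff' : ∀ ω, f' ω = f (ω ∘ edgeEquiv S h)) (e : (cayley S).edgeSet) (ω : Config (cayley S)) :
    increment ν (avg ν {i | le i (edgeTranslate S h e)} f') (edgeTranslate S h e) ω =
      increment ν (avg ν {i | le i e} f) e (ω ∘ edgeEquiv S h) := by
  have hf' : f' = fun ω => f (ω ∘ edgeEquiv S h) := funext hff'
  rw [increment, increment, hf', avg_comp_equiv ν (edgeEquiv S h) (J := {i | le i e}) ?_ hf]
  · rfl
  · intro i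
    refine ⟨fun h1 => ?_, fun h1 => hle.invariant h hh _ _ h1⟩
    have h2 := hle.invariant h⁻¹ (H.inv_mem hh) _ _ h1
    rw [← edgeTranslate_mul, inv_mul_cancel, edgeTranslate_one] at h2
    change le (edgeTranslate S h⁻¹ (edgeTranslate S h i)) e at h2
    rwa [← edgeTranslate_mul, inv_mul_cancel, edgeTranslate_one] at h2

end Functional

/-! ### Averages over the edges in a Følner set -/

section Averages

variable {Γ : Type*} [Group Γ] {S : Finset Γ} {H : Subgroup Γ}

/-- An endpoint of an edge. -/
def endpoint (e : (cayley S).edgeSet) : Γ := (exists_adj_of_edge e).choose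

theorem endpoint_mem (e : (cayley S).edgeSet) : endpoint e ∈ e.1 := by
  obtain ⟨v, h, he⟩ := (exists_adj_of_edge e).choose_spec
  have h2 : e.1 = s(endpoint e, v) := congrArg Subtype.val he
  rw [h2]
  simp

theorem OrbitReps.ext (O : OrbitReps S H) {e e' : (cayley S).edgeSet} (h1 : O.shift e = O.shift e')
    (h2 : O.rep e = O.rep e') : e = e' := by
  rw [← O.translate_rep e, ← O.translate_rep e', h1, h2]

theorem OrbitReps.shift_mul_mem (O : OrbitReps S H) {A : Finset Γ} {e : (cayley S).edgeSet}
    (he : e ∈ edgesIn S A) {x : Γ} (hx : x ∈ (O.rep e).1) : O.shift e * x ∈ A := by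
  refine mem_edgesIn.1 he _ ?_
  rw [← O.translate_rep e, mem_edgeTranslate, O.translate_rep, inv_mul_cancel_left]
  exact hx

open Classical in
/-- The number of edges inside `A` in the orbit of `t`. -/
def orbitCount (O : OrbitReps S H) (A : Finset Γ) (t : (cayley S).edgeSet) : ℕ :=
  ((edgesIn S A).filter fun e => O.rep e = t).card

/-- An edge in the orbit is determined by the translate of the chosen endpoint, which lies in `A`
and in a fixed right coset. -/
theorem orbitCount_le (O : OrbitReps S H) (A : Finset Γ) (t : (cayley S).edgeSet) :
    orbitCount O A t ≤ cosetCount H A (QuotientGroup.mk (endpoint t)⁻¹) := by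
  classical
  refine Finset.card_le_card_of_injOn (fun e => O.shift e * endpoint t) ?_ ?_
  · intro e he
    obtain ⟨heA, rfl⟩ := Finset.mem_filter.1 (Finset.mem_coe.1 he)
    refine Finset.mem_coe.2 (Finset.mem_filter.2 ⟨O.shift_mul_mem heA (endpoint_mem _), ?_⟩)
    rw [QuotientGroup.eq]
    simpa using O.shift_mem e
  · intro e he e' he' h
    obtain ⟨he, h1⟩ := Finset.mem_filter.1 (Finset.mem_coe.1 he)
    obtain ⟨he', h2⟩ := Finset.mem_filter.1 (Finset.mem_coe.1 he')
    exact O.ext (mul_right_cancel h) (h1.trans h2.symm)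

/-- Conversely, a point of that coset is such an endpoint unless the other endpoint of the
translated edge falls outside `A`; `w` is the step between the endpoints. -/
theorem cosetCount_le_orbitCount (O : OrbitReps S H) {t : (cayley S).edgeSet} (ht : t ∈ O.reps) :
    ∃ w, ∀ A, cosetCount H A (QuotientGroup.mk (endpoint t)⁻¹) ≤ orbitCount O A t + escape A w := by
  classical
  obtain ⟨v, h, hev⟩ := (exists_adj_of_edge t).choose_spec
  have htv : t.1 = s(endpoint t, v) := congrArg Subtype.val hev
  refine ⟨(endpoint t)⁻¹ * v, fun A => ?_⟩
  have hsub : (A.filter fun g => (QuotientGroup.mk g⁻¹ : Γ ⧸ H) =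
      QuotientGroup.mk (endpoint t)⁻¹) ⊆
      (((edgesIn S A).filter fun e => O.rep e = t).image fun e => O.shift e * endpoint t) ∪
      (A.filter fun g => g * ((endpoint t)⁻¹ * v) ∉ A) := by
    intro g hg
    obtain ⟨hgA, hg⟩ := Finset.mem_filter.1 hg
    rw [Finset.mem_union, Finset.mem_filter, Finset.mem_image]
    by_cases hx : g * ((endpoint t)⁻¹ * v) ∈ A
    · left
      rw [QuotientGroup.eq, inv_inv] at hg
      refine ⟨edgeTranslate S (g * (endpoint t)⁻¹) t, Finset.mem_filter.2
        ⟨mem_edgesIn.2 fun x hx' => ?_, ?_⟩, ?_⟩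
      · rw [mem_edgeTranslate, htv, Sym2.mem_iff] at hx'
        rcases hx' with hx' | hx'
        · have : x = g := by rw [inv_mul_eq_iff_eq_mul] at hx'; simpa using hx'
          rwa [this]
        · have : x = g * ((endpoint t)⁻¹ * v) := by
            rw [inv_mul_eq_iff_eq_mul] at hx'; rw [hx', mul_assoc]
          rwa [this]
      · rw [O.rep_translate _ hg, O.rep_of_mem t ht]
      · rw [O.shift_translate _ hg, O.shift_of_mem t ht]; simp
    · exact Or.inr ⟨hgA, hx⟩
  exact (Finset.card_le_card hsub).trans ((Finset.card_union_le _ _).trans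
    (Nat.add_le_add_right Finset.card_image_le _))

variable {A : ℕ → Finset Γ}

theorem tendsto_orbitCount (hgen : Subgroup.closure (S : Set Γ) = ⊤)
    (hA : IsExhaustiveFolner (cayley S) A) (hH : H.FiniteIndex) (O : OrbitReps S H)
    {t : (cayley S).edgeSet} (ht : t ∈ O.reps) :
    Tendsto (fun r => (orbitCount O (A r) t : ℝ) / (A r).card) atTop (𝓝 (1 / H.index)) := by
  obtain ⟨w, hw⟩ := cosetCount_le_orbitCount O ht
  have h1 := tendsto_cosetCount hgen hA H hH (QuotientGroup.mk (endpoint t)⁻¹)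
  have h2 := h1.sub (tendsto_escape hgen hA w)
  rw [sub_zero] at h2
  refine tendsto_of_tendsto_of_tendsto_of_le_of_le h2 h1 (fun r => ?_) fun r => ?_
  · have : (cosetCount H (A r) (QuotientGroup.mk (endpoint t)⁻¹) : ℝ) ≤
        orbitCount O (A r) t + escape (A r) w := by exact_mod_cast hw (A r)
    simp only
    rw [← sub_div]
    have h0 := hA.card_pos r
    gcongr
    linarith
  · have := orbitCount_le O (A r) t
    simp only
    gcongr

/-- Averages of functions that are constant on the orbits. -/
theorem tendsto_average (hgen : Subgroup.closure (S : Set Γ) = ⊤)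
    (hA : IsExhaustiveFolner (cayley S) A) (hH : H.FiniteIndex) (O : OrbitReps S H)
    {φ : (cayley S).edgeSet → ℝ} (hφ : ∀ e, φ e = φ (O.rep e)) :
    Tendsto (fun r => ((A r).card : ℝ)⁻¹ * ∑ e ∈ edgesIn S (A r), φ e) atTop
      (𝓝 (1 / H.index * ∑ t ∈ O.reps, φ t)) := by
  classical
  have h1 : Tendsto (fun r => ∑ t ∈ O.reps, (orbitCount O (A r) t : ℝ) / (A r).card * φ t) atTop
      (𝓝 (∑ t ∈ O.reps, 1 / H.index * φ t)) :=
    tendsto_finsetSum _ fun t ht => (tendsto_orbitCount hgen hA hH O ht).mul_const _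
  rw [← Finset.mul_sum] at h1
  refine h1.congr fun r => ?_
  rw [← Finset.sum_fiberwise_of_maps_to (s := edgesIn S (A r)) (t := O.reps) (g := O.rep)
    (fun e _ => O.rep_mem e), Finset.mul_sum]
  refine Finset.sum_congr rfl fun t ht => ?_
  have : ∑ e ∈ edgesIn S (A r) with O.rep e = t, φ e = orbitCount O (A r) t * φ t := by
    rw [Finset.sum_congr rfl (g := fun _ => φ t) fun e he => by
      rw [hφ, (Finset.mem_filter.1 he).2], Finset.sum_const, nsmul_eq_mul]
    rfl
  rw [this]
  ring

open Classical in
/-- The edges in `A` for which the translate of `B` is not inside `A`. -/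
def badEdges (O : OrbitReps S H) (B A : Finset Γ) : Finset (cayley S).edgeSet :=
  (edgesIn S A).filter fun e => ¬ B.image (O.shift e * ·) ⊆ A

/-- For a bad edge some translated `b` is missing from `A`. Its marked endpoint then escapes under
the step leading to that point, and together with the orbit this endpoint determines the edge. -/
theorem card_badEdges_le (O : OrbitReps S H) (B A : Finset Γ) :
    (badEdges O B A).card ≤ ∑ t ∈ O.reps, ∑ b ∈ B, escape A ((endpoint t)⁻¹ * b) := by
  classical
  have hsub : badEdges O B A ⊆ O.reps.biUnion fun t => B.biUnion fun b =>
      (edgesIn S A).filter fun e => O.rep e = t ∧ O.shift e * b ∉ A := by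
    intro e he
    obtain ⟨he, hB⟩ := Finset.mem_filter.1 he
    obtain ⟨x, hx, hxA⟩ := Finset.not_subset.1 hB
    obtain ⟨b, hb, rfl⟩ := Finset.mem_image.1 hx
    exact Finset.mem_biUnion.2 ⟨O.rep e, O.rep_mem e, Finset.mem_biUnion.2
      ⟨b, hb, Finset.mem_filter.2 ⟨he, rfl, hxA⟩⟩⟩
  refine (Finset.card_le_card hsub).trans (Finset.card_biUnion_le.trans
    (Finset.sum_le_sum fun t _ => Finset.card_biUnion_le.trans (Finset.sum_le_sum fun b _ => ?_)))
  refine Finset.card_le_card_of_injOn (fun e => O.shift e * endpoint t) ?_ ?_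
  · intro e he
    obtain ⟨heA, rfl, hb⟩ := Finset.mem_filter.1 (Finset.mem_coe.1 he)
    refine Finset.mem_coe.2 (Finset.mem_filter.2 ⟨O.shift_mul_mem heA (endpoint_mem _), ?_⟩)
    rwa [mul_assoc, mul_inv_cancel_left]
  · intro e he e' he' h
    obtain ⟨-, h1, -⟩ := Finset.mem_filter.1 (Finset.mem_coe.1 he)
    obtain ⟨-, h2, -⟩ := Finset.mem_filter.1 (Finset.mem_coe.1 he')
    exact O.ext (mul_right_cancel h) (h1.trans h2.symm)

theorem tendsto_card_badEdges (hgen : Subgroup.closure (S : Set Γ) = ⊤)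
    (hA : IsExhaustiveFolner (cayley S) A) (O : OrbitReps S H) (B : Finset Γ) :
    Tendsto (fun r => ((badEdges O B (A r)).card : ℝ) / (A r).card) atTop (𝓝 0) := by
  have h1 : Tendsto (fun r => ∑ t ∈ O.reps, ∑ b ∈ B,
      (escape (A r) ((endpoint t)⁻¹ * b) : ℝ) / (A r).card) atTop
      (𝓝 (∑ t ∈ O.reps, ∑ b ∈ B, 0)) :=
    tendsto_finsetSum _ fun t _ => tendsto_finsetSum _ fun b _ => tendsto_escape hgen hA _
  simp only [Finset.sum_const_zero] at h1
  refine squeeze_zero (fun r => by positivity) (fun r => ?_) h1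
  simp only [← Finset.sum_div]
  refine div_le_div_of_nonneg_right ?_ (Nat.cast_nonneg _)
  exact_mod_cast card_badEdges_le O B (A r)

end Averages

/-! ### Approximation by local functions -/

section LocalApproximation

variable {Γ : Type*} [Group Γ] {S : Finset Γ} {H : Subgroup Γ} {A : ℕ → Finset Γ}
  (Δ : LocalComplexRule (cayley S)) (k : ℕ)

theorem exists_local_approx [Countable Γ] (ν : Measure Bool) [IsProbabilityMeasure ν]
    (O : OrbitReps S H) {ε : ℝ} (hε : 0 < ε) :
    ∃ B : Finset Γ, ∀ t ∈ O.reps, ∀ A, B ⊆ A →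
      ∫ ω, (influence t (bettiOn Δ k A) ω - limitInfluence Δ k t ω) ^ 2
        ∂coinMeasure (cayley S).edgeSet ν < ε := by
  have h : ∀ᶠ A : Finset Γ in atTop, ∀ t ∈ O.reps,
      ∫ ω, (influence t (bettiOn Δ k A) ω - limitInfluence Δ k t ω) ^ 2
        ∂coinMeasure (cayley S).edgeSet ν < ε :=
    (Finset.eventually_all O.reps).2 fun t _ =>
      (tendsto_integral_sq_influence_sub Δ k ν t).eventually_lt_const hε
  obtain ⟨B, hB⟩ := eventually_atTop.1 h
  exact ⟨B, fun t ht A hA => hB A hA t ht⟩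

theorem integral_sq_influence_sub_le [Countable Γ] (ν : Measure Bool) [IsProbabilityMeasure ν]
    (A : Finset Γ) (e : (cayley S).edgeSet) :
    ∫ ω, (influence e (bettiOn Δ k A) ω - limitInfluence Δ k e ω) ^ 2
        ∂coinMeasure (cayley S).edgeSet ν ≤ (influenceBound Δ k + influenceBound Δ k) ^ 2 := by
  have hb : ∀ ω, |(influence e (bettiOn Δ k A) ω - limitInfluence Δ k e ω) ^ 2| ≤
      (influenceBound Δ k + influenceBound Δ k) ^ 2 := fun ω => abs_sq_le ((abs_sub _ _).trans
      (add_le_add (abs_influence_bettiOn_le Δ k A e ω) (abs_limitInfluence_le Δ k e ω)))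
  have := integral_mono (μ := coinMeasure (cayley S).edgeSet ν)
    (integrable_of_abs_le (((measurable_influence_bettiOn Δ k A e).sub
    (measurable_limitInfluence Δ k e)).pow_const 2) hb) (integrable_const _)
    fun ω => (le_abs_self _).trans (hb ω)
  rwa [integral_const, probReal_univ, one_smul] at this

theorem integral_sq_influence_sub_shift [Countable Γ] (ν : Measure Bool) [IsProbabilityMeasure ν]
    [DecidableEq Γ] (O : OrbitReps S H) (A : Finset Γ) (e : (cayley S).edgeSet) :
    ∫ ω, (influence e (bettiOn Δ k A) ω - limitInfluence Δ k e ω) ^ 2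
        ∂coinMeasure (cayley S).edgeSet ν =
      ∫ ω, (influence (O.rep e) (bettiOn Δ k (A.image ((O.shift e)⁻¹ * ·))) ω -
        limitInfluence Δ k (O.rep e) ω) ^ 2 ∂coinMeasure (cayley S).edgeSet ν := by
  have h := integral_sq_influence_sub_translate Δ k ν (O.shift e)
    (A.image ((O.shift e)⁻¹ * ·)) (O.rep e)
  rw [O.translate_rep, Finset.image_image] at h
  rw [← h]
  congr! 7
  have : ((fun x => O.shift e * x) ∘ fun x => (O.shift e)⁻¹ * x) = id := by funext x; simp
  rw [this, Finset.image_id]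

/-- Translate each edge back to its representative. If the translated window contains the fixed set
`B`, the error is small; the remaining edges are a vanishing fraction and have bounded error. -/
theorem tendsto_average_sq_influence_sub [Countable Γ] (ν : Measure Bool) [IsProbabilityMeasure ν]
    (hgen : Subgroup.closure (S : Set Γ) = ⊤)
    (hA : IsExhaustiveFolner (cayley S) A) (O : OrbitReps S H) :
    Tendsto (fun r => ((A r).card : ℝ)⁻¹ * ∑ e ∈ edgesIn S (A r),
      ∫ ω, (influence e (bettiOn Δ k (A r)) ω - limitInfluence Δ k e ω) ^ 2
        ∂coinMeasure (cayley S).edgeSet ν) atTop (𝓝 0) := by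
  classical
  rw [Metric.tendsto_atTop']
  intro ε hε
  set M := (influenceBound Δ k + influenceBound Δ k) ^ 2 with hM
  have hM0 : 0 ≤ M := sq_nonneg _
  -- There are at most `S.card` edges per vertex, so the good edges contribute at most ε/2; adding
  -- one keeps the denominator positive.
  obtain ⟨B, hB⟩ := exists_local_approx Δ k ν O (ε := ε / (2 * (S.card + 1))) (by positivity)
  have hbad := ((tendsto_card_badEdges hgen hA O B).mul_const M)
  rw [zero_mul] at hbad
  obtain ⟨R, hR⟩ := eventually_atTop.1 (hbad.eventually_lt_const (half_pos hε))
  refine ⟨R, fun r hr => ?_⟩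
  have hn := hA.card_pos r
  have hle : ∑ e ∈ edgesIn S (A r), ∫ ω, (influence e (bettiOn Δ k (A r)) ω -
      limitInfluence Δ k e ω) ^ 2 ∂coinMeasure (cayley S).edgeSet ν ≤
      (edgesIn S (A r)).card * (ε / (2 * (S.card + 1))) + (badEdges O B (A r)).card * M := by
    have hpt : ∀ e ∈ edgesIn S (A r), ∫ ω, (influence e (bettiOn Δ k (A r)) ω -
        limitInfluence Δ k e ω) ^ 2 ∂coinMeasure (cayley S).edgeSet ν ≤
        ε / (2 * (S.card + 1)) + if ¬ B.image (O.shift e * ·) ⊆ A r then M else 0 := by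
      intro e he
      split_ifs with h
      · rw [integral_sq_influence_sub_shift Δ k ν O, add_zero]
        refine (hB _ (O.rep_mem e) _ fun b hb => ?_).le
        exact Finset.mem_image.2 ⟨_, h (Finset.mem_image_of_mem _ hb), by simp⟩
      · have h1 := integral_sq_influence_sub_le Δ k ν (A r) e
        have : 0 < ε / (2 * ((S.card : ℝ) + 1)) := by positivity
        linarith
    refine (Finset.sum_le_sum hpt).trans (le_of_eq ?_)
    rw [Finset.sum_add_distrib, Finset.sum_const, nsmul_eq_mul, ← Finset.sum_filter,
      Finset.sum_const, nsmul_eq_mul]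
    rfl
  have hE : ((edgesIn S (A r)).card : ℝ) ≤ S.card * (A r).card := by
    exact_mod_cast card_edgesIn_le (A r)
  have h0 : 0 ≤ ∑ e ∈ edgesIn S (A r), ∫ ω, (influence e (bettiOn Δ k (A r)) ω -
      limitInfluence Δ k e ω) ^ 2 ∂coinMeasure (cayley S).edgeSet ν :=
    Finset.sum_nonneg fun e _ => integral_nonneg fun ω => sq_nonneg _
  rw [Real.dist_0_eq_abs, abs_of_nonneg (mul_nonneg (inv_nonneg.2 hn.le) h0)]
  have h1 : ((A r).card : ℝ)⁻¹ * ((edgesIn S (A r)).card * (ε / (2 * (S.card + 1)))) ≤ ε / 2 := by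
    calc ((A r).card : ℝ)⁻¹ * ((edgesIn S (A r)).card * (ε / (2 * (S.card + 1))))
        ≤ ((A r).card : ℝ)⁻¹ * ((S.card * (A r).card) * (ε / (2 * (S.card + 1)))) := by gcongr
      _ = (S.card / (S.card + 1)) * (ε / 2) := by field_simp
      _ ≤ 1 * (ε / 2) := by
        gcongr
        rw [div_le_one (by positivity)]
        linarith
      _ = ε / 2 := one_mul _
  have h2 := hR r hr.le
  have h3 : ((A r).card : ℝ)⁻¹ * ((badEdges O B (A r)).card * M) =
      ((badEdges O B (A r)).card : ℝ) / (A r).card * M := by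
    rw [div_eq_inv_mul]; ring
  have h4 := mul_le_mul_of_nonneg_left hle (inv_nonneg.2 hn.le)
  rw [mul_add, h3] at h4
  linarith

end LocalApproximation

/-! ### A law of large numbers for approximately local functions -/

section LawOfLargeNumbers

variable {ι : Type*} (ν : Measure Bool) [IsProbabilityMeasure ν]

theorem abs_integral_le_of_abs_le {Ω : Type*} [MeasurableSpace Ω] {μ : Measure Ω}
    [IsProbabilityMeasure μ] {f : Ω → ℝ} {C : ℝ} (hC : ∀ ω, |f ω| ≤ C) : |∫ ω, f ω ∂μ| ≤ C := by
  have := norm_integral_le_of_norm_le_const (μ := μ)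
    (ae_of_all _ fun ω => (Real.norm_eq_abs _).trans_le (hC ω))
  simpa using this

theorem abs_sub_integral_le {Ω : Type*} [MeasurableSpace Ω] {μ : Measure Ω}
    [IsProbabilityMeasure μ] {f : Ω → ℝ} {C : ℝ} (hC : ∀ ω, |f ω| ≤ C) (ω : Ω) :
    |f ω - ∫ η, f η ∂μ| ≤ C + C :=
  (abs_sub _ _).trans (add_le_add (hC ω) (abs_integral_le_of_abs_le hC))

-- Covariances of functions with disjoint supports vanish, leaving at most `M` terms for each `e`.
open Classical in
theorem integral_sq_sum_le {U : ι → (ι → Bool) → ℝ} {s : ι → Set ι} {C : ℝ} {M : ℕ} (t : Finset ι)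
    (hU : ∀ e, Measurable (U e)) (hC : ∀ e ω, |U e ω| ≤ C) (hs : ∀ e, DependsOn (U e) (s e))
    (hM : ∀ e, (t.filter fun e' => ¬ Disjoint (s e) (s e')).card ≤ M) :
    ∫ ω, (∑ e ∈ t, (U e ω - ∫ η, U e η ∂coinMeasure ι ν)) ^ 2 ∂coinMeasure ι ν ≤
      t.card * (M * (C + C) ^ 2) := by
  set G : ι → (ι → Bool) → ℝ := fun e ω => U e ω - ∫ η, U e η ∂coinMeasure ι ν with hG
  have hGm : ∀ e, Measurable (G e) := fun e => (hU e).sub_const _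
  have hGC : ∀ e ω, |G e ω| ≤ C + C := fun e => abs_sub_integral_le (hC e)
  have hGs : ∀ e, DependsOn (G e) (s e) := fun e ω ω' h => by simp only [hG, hs e h]
  have hG0 : ∀ e, ∫ ω, G e ω ∂coinMeasure ι ν = 0 := fun e => by
    simp only [hG]
    rw [integral_sub (integrable_of_abs_le (hU e) (hC e)) (integrable_const _)]
    simp
  have hGG : ∀ e e' ω, |G e ω * G e' ω| ≤ (C + C) ^ 2 := fun e e' ω => by
    rw [abs_mul, pow_two]
    exact mul_le_mul (hGC e ω) (hGC e' ω) (abs_nonneg _) ((abs_nonneg _).trans (hGC e ω))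
  have hint : ∀ e e', Integrable (fun ω => G e ω * G e' ω) (coinMeasure ι ν) := fun e e' =>
    integrable_of_abs_le ((hGm e).mul (hGm e')) (hGG e e')
  have h1 : ∫ ω, (∑ e ∈ t, G e ω) ^ 2 ∂coinMeasure ι ν =
      ∑ e ∈ t, ∑ e' ∈ t, ∫ ω, G e ω * G e' ω ∂coinMeasure ι ν := by
    simp only [pow_two, Finset.sum_mul_sum]
    rw [integral_finsetSum _ fun e _ => integrable_finsetSum _ fun e' _ => hint e e']
    exact Finset.sum_congr rfl fun e _ => integral_finsetSum _ fun e' _ => hint e e'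
  rw [h1, ← nsmul_eq_mul]
  refine Finset.sum_le_card_nsmul _ _ _ fun e _ => ?_
  rw [← Finset.sum_filter_add_sum_filter_not t fun e' => ¬ Disjoint (s e) (s e')]
  have h2 : ∑ e' ∈ t with ¬¬Disjoint (s e) (s e'), ∫ ω, G e ω * G e' ω ∂coinMeasure ι ν = 0 := by
    refine Finset.sum_eq_zero fun e' he' => ?_
    rw [integral_mul_of_disjoint ν (not_not.1 (Finset.mem_filter.1 he').2) (hGm e) (hGm e')
      (hGs e) (hGs e'), hG0, zero_mul]
  rw [h2, add_zero]
  refine (Finset.sum_le_card_nsmul _ _ ((C + C) ^ 2) fun e' _ =>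
    (le_abs_self _).trans (abs_integral_le_of_abs_le (hGG e e'))).trans ?_
  rw [nsmul_eq_mul]
  exact mul_le_mul_of_nonneg_right (by exact_mod_cast hM e) (sq_nonneg _)

open Classical in
/-- The weak law of large numbers for bounded functions that can be approximated in mean by
functions of boundedly overlapping sets of coordinates. -/
theorem tendsto_integral_abs_sum_sub {X : ι → (ι → Bool) → ℝ} {C K : ℝ} {E : ℕ → Finset ι}
    {n : ℕ → ℝ} (hn : ∀ r, 0 < n r) (hn' : Tendsto n atTop atTop)
    (hE : ∀ r, ((E r).card : ℝ) ≤ K * n r) (hX : ∀ e, Measurable (X e))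
    (hC : ∀ e ω, |X e ω| ≤ C)
    (h : ∀ ε : ℝ, 0 < ε → ∃ (U : ι → (ι → Bool) → ℝ) (s : ι → Set ι) (M : ℕ),
      (∀ e, Measurable (U e)) ∧ (∀ e ω, |U e ω| ≤ C) ∧ (∀ e, DependsOn (U e) (s e)) ∧
      (∀ (t : Finset ι) e, (t.filter fun e' => ¬ Disjoint (s e) (s e')).card ≤ M) ∧
      ∀ e, ∫ ω, |X e ω - U e ω| ∂coinMeasure ι ν ≤ ε) :
    Tendsto (fun r => (n r)⁻¹ * ∫ ω, |∑ e ∈ E r, (X e ω - ∫ η, X e η ∂coinMeasure ι ν)|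
      ∂coinMeasure ι ν) atTop (𝓝 0) := by
  have hK : 0 ≤ K := by
    have := (Nat.cast_nonneg _).trans (hE 0)
    exact nonneg_of_mul_nonneg_left this (hn 0)
  rw [Metric.tendsto_atTop']
  intro ε hε
  -- The approximation error is paid twice, once for the function and once for its mean, and is
  -- multiplied by at most `K` edges per unit of scale.
  obtain ⟨U, s, M, hU, hUC, hs, hM, happ⟩ := h (ε / (4 * (K + 1))) (by positivity)
  set c : ℝ := K * (M * (C + C) ^ 2) with hc
  have hlim : Tendsto (fun r => √(c / n r)) atTop (𝓝 0) := by
    have := (tendsto_const_nhds (x := c)).div_atTop hn'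
    have h2 := (Real.continuous_sqrt.tendsto 0).comp this
    rwa [Real.sqrt_zero] at h2
  obtain ⟨R, hR⟩ := eventually_atTop.1 (hlim.eventually_lt_const (half_pos hε))
  refine ⟨R, fun r hr => ?_⟩
  have hnr := hn r
  rw [Real.dist_0_eq_abs, abs_of_nonneg (mul_nonneg (inv_nonneg.2 hnr.le)
    (integral_nonneg fun ω => abs_nonneg _))]
  set V : (ι → Bool) → ℝ := fun ω => ∑ e ∈ E r, (U e ω - ∫ η, U e η ∂coinMeasure ι ν) with hV
  have hVm : Measurable V := Finset.measurable_sum _ fun e _ => (hU e).sub_const _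
  have hVb : ∀ ω, |V ω| ≤ (E r).card • (C + C) := fun ω =>
    (Finset.abs_sum_le_sum_abs _ _).trans (Finset.sum_le_card_nsmul _ _ _ fun e _ =>
      abs_sub_integral_le (hUC e) ω)
  have iX : ∀ e, Integrable (X e) (coinMeasure ι ν) := fun e => integrable_of_abs_le (hX e) (hC e)
  have iU : ∀ e, Integrable (U e) (coinMeasure ι ν) := fun e =>
    integrable_of_abs_le (hU e) (hUC e)
  have hδ : 0 < ε / (4 * (K + 1)) := by positivity
  have hbound : ∀ ω, |∑ e ∈ E r, (X e ω - ∫ η, X e η ∂coinMeasure ι ν)| ≤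
      |V ω| + ∑ e ∈ E r, (|X e ω - U e ω| + ε / (4 * (K + 1))) := by
    intro ω
    have h1 : ∑ e ∈ E r, (X e ω - ∫ η, X e η ∂coinMeasure ι ν) = V ω +
        ∑ e ∈ E r, ((X e ω - U e ω) - ∫ η, (X e η - U e η) ∂coinMeasure ι ν) := by
      rw [hV, ← Finset.sum_add_distrib]
      refine Finset.sum_congr rfl fun e _ => ?_
      rw [integral_sub (iX e) (iU e)]
      ring
    rw [h1]
    refine (abs_add_le _ _).trans (add_le_add_right ((Finset.abs_sum_le_sum_abs _ _).trans
      (Finset.sum_le_sum fun e _ => (abs_sub _ _).trans (add_le_add_right ?_ _))) _)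
    exact (abs_integral_le_integral_abs).trans (happ e)
  have iD : ∀ e, Integrable (fun ω => |X e ω - U e ω| + ε / (4 * (K + 1))) (coinMeasure ι ν) :=
    fun e => ((iX e).sub (iU e)).abs.add (integrable_const _)
  have iV : Integrable (fun ω => |V ω|) (coinMeasure ι ν) := (integrable_of_abs_le hVm hVb).abs
  have hint : ∫ ω, |∑ e ∈ E r, (X e ω - ∫ η, X e η ∂coinMeasure ι ν)| ∂coinMeasure ι ν ≤
      ∫ ω, |V ω| ∂coinMeasure ι ν + (E r).card * (ε / (2 * (K + 1))) := by
    have i1 : Integrable (fun ω => |∑ e ∈ E r, (X e ω - ∫ η, X e η ∂coinMeasure ι ν)|)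
        (coinMeasure ι ν) :=
      (integrable_finsetSum _ fun e _ => (iX e).sub (integrable_const _)).abs
    have i2 := integrable_finsetSum (E r) fun e _ => iD e
    refine (integral_mono i1 (iV.add i2) hbound).trans ?_
    simp only [Pi.add_apply]
    rw [integral_add iV i2, integral_finsetSum _ fun e _ => iD e, ← nsmul_eq_mul]
    refine add_le_add_right (Finset.sum_le_card_nsmul _ _ _ fun e _ => ?_) _
    have i3 : Integrable (fun ω => |X e ω - U e ω|) (coinMeasure ι ν) := ((iX e).sub (iU e)).abs
    rw [integral_add i3 (integrable_const _), integral_const, probReal_univ, one_smul]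
    have h1 := happ e
    have h2 : ε / (2 * (K + 1)) = ε / (4 * (K + 1)) + ε / (4 * (K + 1)) := by field_simp; ring
    rw [h2]
    exact add_le_add_left h1 _
  have hsq : (∫ ω, |V ω| ∂coinMeasure ι ν) ^ 2 ≤ c * n r := by
    refine (sq_integral_abs_le hVm hVb).trans ((integral_sq_sum_le ν (E r) hU hUC hs
      (hM (E r))).trans ?_)
    calc ((E r).card : ℝ) * (M * (C + C) ^ 2) ≤ (K * n r) * (M * (C + C) ^ 2) := by
          gcongr
          exact hE r
      _ = c * n r := by rw [hc]; ring
  have h1 : (n r)⁻¹ * ∫ ω, |V ω| ∂coinMeasure ι ν ≤ √(c / n r) := by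
    refine Real.le_sqrt_of_sq_le ?_
    rw [mul_pow, div_eq_mul_inv]
    calc (n r)⁻¹ ^ 2 * (∫ ω, |V ω| ∂coinMeasure ι ν) ^ 2 ≤ (n r)⁻¹ ^ 2 * (c * n r) := by gcongr
      _ = c * (n r)⁻¹ := by field_simp
  have h2 : (n r)⁻¹ * ((E r).card * (ε / (2 * (K + 1)))) ≤ ε / 2 := by
    calc (n r)⁻¹ * ((E r).card * (ε / (2 * (K + 1))))
        ≤ (n r)⁻¹ * ((K * n r) * (ε / (2 * (K + 1)))) := by
          gcongr
          exact hE r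
      _ = (K / (K + 1)) * (ε / 2) := by field_simp
      _ ≤ 1 * (ε / 2) := by
        gcongr
        rw [div_le_one (by positivity)]
        linarith
      _ = ε / 2 := one_mul _
  have h3 := hR r hr.le
  have h4 := mul_le_mul_of_nonneg_left hint (inv_nonneg.2 hnr.le)
  rw [mul_add] at h4
  linarith

end LawOfLargeNumbers

/-! ### The weak law of large numbers for squared limiting increments -/

section Increments

variable {Γ : Type*} [Group Γ] {S : Finset Γ} {H : Subgroup Γ} {A : ℕ → Finset Γ}
  (Δ : LocalComplexRule (cayley S)) (k : ℕ)

/-- The limiting martingale difference of an edge. -/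
def limitIncrement (ν : Measure Bool) (le : (cayley S).edgeSet → (cayley S).edgeSet → Prop)
    (e : (cayley S).edgeSet) (ω : Config (cayley S)) : ℝ :=
  increment ν (avg ν {i | le i e} (limitInfluence Δ k e)) e ω

/-- The edges in the translate of a finite set by the shift of an edge. -/
def localSupport (O : OrbitReps S H) (F : Finset (cayley S).edgeSet) (e : (cayley S).edgeSet) :
    Set (cayley S).edgeSet :=
  {f | ∃ a ∈ F, edgeTranslate S (O.shift e) a = f}

-- If the supports of `e` and `e'` meet, freeness recovers the shift of `e'` from the pair of
-- elements of `F` that meet. With the orbit of `e'` this determines `e'`, so the overlap is bounded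
-- uniformly.
open Classical in
theorem card_localSupport_le (O : OrbitReps S H) (hH : IsLeftOrderable H)
    (F t : Finset (cayley S).edgeSet) (e : (cayley S).edgeSet) :
    (t.filter fun e' => ¬ Disjoint (localSupport O F e) (localSupport O F e')).card ≤
      (F ×ˢ F ×ˢ O.reps).card := by
  refine Finset.card_le_card_of_forall_subsingleton
    (fun e' q => edgeTranslate S (O.shift e) q.1 = edgeTranslate S (O.shift e') q.2.1 ∧
      O.rep e' = q.2.2) ?_ ?_
  · intro e' he'
    obtain ⟨f, ⟨a, ha, h1⟩, b, hb, h2⟩ := Set.not_disjoint_iff.1 (Finset.mem_filter.1 he').2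
    exact ⟨(a, b, O.rep e'), Finset.mem_product.2 ⟨ha, Finset.mem_product.2 ⟨hb, O.rep_mem e'⟩⟩,
      h1.trans h2.symm, rfl⟩
  · rintro ⟨a, b, c⟩ - e1 ⟨-, h1, h1'⟩ e2 ⟨-, h2, h2'⟩
    exact O.ext (edgeTranslate_injective_left hH (O.shift_mem e1) (O.shift_mem e2)
      (h1.symm.trans h2)) (h1'.trans h2'.symm)

theorem integral_abs_sq_sub_sq_le {Ω : Type*} [MeasurableSpace Ω] {μ : Measure Ω}
    [IsProbabilityMeasure μ] {f g : Ω → ℝ} {C δ : ℝ} (hf : Measurable f) (hfC : ∀ ω, |f ω| ≤ C)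
    (hg : Measurable g) (hgC : ∀ ω, |g ω| ≤ C) (hδ : 0 ≤ δ)
    (h : ∫ ω, (f ω - g ω) ^ 2 ∂μ ≤ δ ^ 2) :
    ∫ ω, |f ω ^ 2 - g ω ^ 2| ∂μ ≤ (C + C) * δ := by
  have hd : ∀ ω, |f ω - g ω| ≤ C + C := fun ω => (abs_sub _ _).trans (add_le_add (hfC ω) (hgC ω))
  have hs : ∀ ω, |f ω + g ω| ≤ C + C := fun ω =>
    (abs_add_le _ _).trans (add_le_add (hfC ω) (hgC ω))
  have h1 : ∫ ω, |f ω - g ω| ∂μ ≤ δ :=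
    le_of_sq_le_sq ((sq_integral_abs_le (hf.sub hg) hd).trans h) hδ
  obtain ⟨ω0⟩ : Nonempty Ω := nonempty_of_isProbabilityMeasure μ
  have hC : 0 ≤ C + C := (abs_nonneg _).trans (hs ω0)
  have i1 : Integrable (fun ω => |f ω - g ω|) μ := (integrable_of_abs_le (hf.sub hg) hd).abs
  calc ∫ ω, |f ω ^ 2 - g ω ^ 2| ∂μ ≤ ∫ ω, (C + C) * |f ω - g ω| ∂μ := by
        refine integral_mono_of_nonneg (ae_of_all _ fun ω => abs_nonneg _) (i1.const_mul _)
          (ae_of_all _ fun ω => ?_)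
        simp only [sq_sub_sq, abs_mul]
        exact mul_le_mul_of_nonneg_right (hs ω) (abs_nonneg _)
    _ ≤ (C + C) * δ := by
        rw [integral_const_mul]
        exact mul_le_mul_of_nonneg_left h1 hC

variable [Countable Γ] (ν : Measure Bool) [IsProbabilityMeasure ν]
  (le : (cayley S).edgeSet → (cayley S).edgeSet → Prop)

theorem measurable_limitIncrement (e : (cayley S).edgeSet) :
    Measurable (limitIncrement Δ k ν le e) :=
  measurable_increment ν (measurable_avg ν _ (measurable_limitInfluence Δ k e)) e

omit [Countable Γ] in
theorem abs_limitIncrement_le (e : (cayley S).edgeSet) (ω : Config (cayley S)) :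
    |limitIncrement Δ k ν le e ω| ≤ influenceBound Δ k :=
  abs_increment_le ν (abs_avg_le ν _ (abs_limitInfluence_le Δ k e) ω) e

/-- Each limiting influence is replaced by the influence in a translate of a fixed finite window
`B`. Averaging over later edges does not enlarge the set of coins involved, so the approximants have
boundedly overlapping supports, whatever the order is. -/
theorem tendsto_limitIncrement_lln [Infinite Γ] (hA : IsExhaustiveFolner (cayley S) A)
    (hH : IsLeftOrderable H) (O : OrbitReps S H) :
    Tendsto (fun r => ((A r).card : ℝ)⁻¹ * ∫ ω, |∑ e ∈ edgesIn S (A r),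
      (limitIncrement Δ k ν le e ω ^ 2 -
        ∫ η, limitIncrement Δ k ν le e η ^ 2 ∂coinMeasure (cayley S).edgeSet ν)|
      ∂coinMeasure (cayley S).edgeSet ν) atTop (𝓝 0) := by
  classical
  set C := influenceBound Δ k with hCdef
  have hC0 : 0 ≤ C := influenceBound_nonneg Δ k
  refine tendsto_integral_abs_sum_sub ν (K := S.card) hA.card_pos hA.tendsto_card
    (fun r => by exact_mod_cast card_edgesIn_le (A r)) (C := C ^ 2)
    (fun e => (measurable_limitIncrement Δ k ν le e).pow_const 2)
    (fun e ω => abs_sq_le (abs_limitIncrement_le Δ k ν le e ω)) fun ε hε => ?_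
  -- Chosen so that `(C + C) * δ ≤ ε`, the factor arising from the difference of squares; the extra
  -- one covers `C = 0`.
  set δ := ε / (C + C + 1) with hδdef
  have hδ : 0 < δ := by positivity
  obtain ⟨B, hB⟩ := exists_local_approx Δ k ν O (ε := δ ^ 2) (by positivity)
  set I : (cayley S).edgeSet → Config (cayley S) → ℝ := fun e =>
    influence e (bettiOn Δ k (B.image (O.shift e * ·))) with hI
  have hIm : ∀ e, Measurable (I e) := fun e => measurable_influence_bettiOn Δ k _ e
  have hIb : ∀ e ω, |I e ω| ≤ C := fun e ω => abs_influence_bettiOn_le Δ k _ e ω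
  set U : (cayley S).edgeSet → Config (cayley S) → ℝ := fun e =>
    increment ν (avg ν {i | le i e} (I e)) e with hU
  have hUm : ∀ e, Measurable (U e) := fun e => measurable_increment ν (measurable_avg ν _ (hIm e)) e
  have hUb : ∀ e ω, |U e ω| ≤ C := fun e ω => abs_increment_le ν (abs_avg_le ν _ (hIb e) ω) e
  -- The representatives are included because the increment also uses the coin of `e` itself, which
  -- need not lie in the translated window.
  refine ⟨fun e ω => U e ω ^ 2, localSupport O (O.reps ∪ edgesIn S B), _,
    fun e => (hUm e).pow_const 2, fun e ω => abs_sq_le (hUb e ω), fun e => ?_,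
    fun t e => card_localSupport_le O hH _ t e, fun e => ?_⟩
  · have h1 : DependsOn (U e) (localSupport O (O.reps ∪ edgesIn S B) e) := by
      refine dependsOn_increment ν ((dependsOn_avg ν (dependsOn_influence
        (dependsOn_bettiOn Δ k _) e)).mono fun f hf => ?_) ?_
      · have hf' := mem_edgesIn.1 (Finset.mem_coe.1 hf.2.1)
        refine ⟨edgeTranslate S (O.shift e)⁻¹ f, Finset.mem_union_right _
          (mem_edgesIn.2 fun x hx => ?_), ?_⟩
        · rw [mem_edgeTranslate, inv_inv] at hx
          obtain ⟨b, hb, hbx⟩ := Finset.mem_image.1 (hf' _ hx)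
          rwa [← mul_left_cancel hbx]
        · rw [← edgeTranslate_mul, mul_inv_cancel, edgeTranslate_one]
      · exact ⟨O.rep e, Finset.mem_union_left _ (O.rep_mem e), O.translate_rep e⟩
    intro ω ω' h
    simp only [h1 h]
  · refine (integral_abs_sq_sub_sq_le (measurable_limitIncrement Δ k ν le e)
      (abs_limitIncrement_le Δ k ν le e) (hUm e) (hUb e) hδ.le ?_).trans ?_
    · have hDm := measurable_limitInfluence Δ k e
      have hDb := abs_limitInfluence_le Δ k e
      have hdm : Measurable fun ω => limitInfluence Δ k e ω - I e ω := hDm.sub (hIm e)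
      have hdb : ∀ ω, |limitInfluence Δ k e ω - I e ω| ≤ C + C := fun ω =>
        (abs_sub _ _).trans (add_le_add (hDb ω) (hIb e ω))
      have h1 : ∀ ω, limitIncrement Δ k ν le e ω - U e ω =
          increment ν (avg ν {i | le i e} fun ω => limitInfluence Δ k e ω - I e ω) e ω := by
        intro ω
        simp only [limitIncrement, hU, increment]
        rw [avg_sub ν _ hDm hDb (hIm e) (hIb e), mul_sub]
      simp only [h1]
      refine (integral_increment_sq_le ν (measurable_avg ν _ hdm) (abs_avg_le ν _ hdb) e).trans
        ((integral_avg_sq_le ν _ hdm hdb).trans ?_)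
      have h2 := integral_sq_influence_sub_translate Δ k ν (O.shift e) B (O.rep e)
      rw [O.translate_rep] at h2
      have h3 := hB _ (O.rep_mem e) B le_rfl
      rw [← h2] at h3
      refine le_trans (le_of_eq ?_) h3.le
      refine integral_congr_ae (ae_of_all _ fun ω => ?_)
      simp only [hI]
      ring
    · rw [hδdef, ← mul_div_assoc, div_le_iff₀ (by positivity)]
      nlinarith

end Increments

/-! ### The central limit theorem and the limiting variance -/

section LimitingVariance

variable {Γ : Type*} [Group Γ] {S : Finset Γ} {H : Subgroup Γ} {A : ℕ → Finset Γ}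
  (Δ : LocalComplexRule (cayley S)) (k : ℕ)

theorem IsExhaustiveFolner.countable {V : Type*} {G : SimpleGraph V} {A : ℕ → Finset V}
    (hA : IsExhaustiveFolner G A) : Countable V := by
  have h : (⋃ r, (A r : Set V)) = Set.univ :=
    Set.eq_univ_of_forall fun v => Set.mem_iUnion.2 (hA.exhaust v)
  exact Set.countable_univ_iff.1 (h ▸ Set.countable_iUnion fun r => (A r).countable_toSet)

variable (ν : Measure Bool) [IsProbabilityMeasure ν]

theorem integral_sq_limitIncrement_translate [Countable Γ]
    {le : (cayley S).edgeSet → (cayley S).edgeSet → Prop} (hle : IsInvariantOrder S H le) {h : Γ}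
    (hh : h ∈ H) (e : (cayley S).edgeSet) :
    ∫ ω, limitIncrement Δ k ν le (edgeTranslate S h e) ω ^ 2 ∂coinMeasure (cayley S).edgeSet ν =
      ∫ ω, limitIncrement Δ k ν le e ω ^ 2 ∂coinMeasure (cayley S).edgeSet ν := by
  rw [← integral_comp_equiv ν (edgeEquiv S h) (f := fun ω => limitIncrement Δ k ν le e ω ^ 2)
    ((measurable_limitIncrement Δ k ν le e).pow_const 2)]
  refine integral_congr_ae (ae_of_all _ fun ω => ?_)
  simp only [limitIncrement]
  rw [increment_avg_translate ν hle hh (measurable_limitInfluence Δ k e)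
    (limitInfluence_translate Δ k h e)]

/-- The limiting variance, computed from a total order of the edges. -/
def limitVariance (O : OrbitReps S H) (le : (cayley S).edgeSet → (cayley S).edgeSet → Prop) : ℝ :=
  1 / H.index * ∑ t ∈ O.reps,
    ∫ ω, limitIncrement Δ k ν le t ω ^ 2 ∂coinMeasure (cayley S).edgeSet ν

omit [IsProbabilityMeasure ν] in
theorem limitVariance_nonneg (O : OrbitReps S H)
    (le : (cayley S).edgeSet → (cayley S).edgeSet → Prop) : 0 ≤ limitVariance Δ k ν O le :=
  mul_nonneg (by positivity)
    (Finset.sum_nonneg fun t _ => integral_nonneg fun ω => sq_nonneg _)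

theorem cltData [Infinite Γ] (hgen : Subgroup.closure (S : Set Γ) = ⊤)
    (hA : IsExhaustiveFolner (cayley S) A) (hfin : H.FiniteIndex) (hH : IsLeftOrderable H)
    (O : OrbitReps S H) {le : (cayley S).edgeSet → (cayley S).edgeSet → Prop}
    (hle : IsInvariantOrder S H le) :
    CLTData ν le (fun r => edgesIn S (A r)) (fun r => ((A r).card : ℝ))
      (fun r => bettiOn Δ k (A r)) (limitInfluence Δ k) (influenceBound Δ k) S.card
      (limitVariance Δ k ν O le) :=
  have := hA.countable
  { linear := hle.isLinearOrder
    nonneg := influenceBound_nonneg Δ k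
    pos := hA.card_pos
    tendsto := hA.tendsto_card
    card_le := fun r => by exact_mod_cast card_edgesIn_le (A r)
    dependsOn := fun r => dependsOn_bettiOn Δ k (A r)
    influence_le := fun r e ω => abs_influence_bettiOn_le Δ k (A r) e ω
    measurable := measurable_limitInfluence Δ k
    abs_le := abs_limitInfluence_le Δ k
    dependsOn_compl := dependsOn_limitInfluence Δ k
    approx := tendsto_average_sq_influence_sub Δ k ν hgen hA O
    -- This is the only field where invariance of the order enters: it makes the second moments
    -- constant on orbits.
    variance_tendsto := tendsto_average hgen hA hfin O
      (φ := fun e => ∫ ω, limitIncrement Δ k ν le e ω ^ 2 ∂coinMeasure (cayley S).edgeSet ν)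
      fun e => by
        rw [← integral_sq_limitIncrement_translate Δ k ν hle (O.shift_mem e) (O.rep e),
          O.translate_rep]
    lln := tendsto_limitIncrement_lln Δ k ν le hA hH O }

end LimitingVariance

/-! ### Conditional expectations of resampling differences -/

section Resampling

theorem integral_val_eval {ι : Type*} (ν : Measure Bool) [IsProbabilityMeasure ν] (e : ι) :
    ∫ ω, val (ω e) ∂coinMeasure ι ν = ∫ b, val b ∂ν :=
  integral_comp_of_measurePreserving (measurePreserving_eval_infinitePi (fun _ : ι => ν) e)
    (measurable_of_finite val).stronglyMeasurable

theorem abs_val_sub_le (a b : Bool) : |val a - val b| ≤ 1 := by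
  cases a <;> cases b <;> simp [val]

/-- Integrating out the resampled state of an edge. -/
theorem integral_resample {ι : Type*} (ν : Measure Bool) [IsProbabilityMeasure ν] (e : ι)
    {f : (ι → Bool) → ℝ} (hf : Measurable f) {C : ℝ} (hC : ∀ ω, |f ω| ≤ C) :
    ∫ q : (ι → Bool) × (ι → Bool), f q.1 * (val (q.1 e) - val (q.2 e))
      ∂(coinMeasure ι ν).prod (coinMeasure ι ν) =
      ∫ ω, f ω * cval ν (ω e) ∂coinMeasure ι ν := by
  have hv : Measurable fun ω : ι → Bool => val (ω e) :=
    (measurable_of_finite val).comp (measurable_pi_apply e)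
  have hvb : ∀ ω : ι → Bool, |val (ω e)| ≤ 1 := fun ω => by cases ω e <;> simp [val]
  rw [integral_prod]
  · refine integral_congr_ae (ae_of_all _ fun ω => ?_)
    simp only
    rw [integral_const_mul, integral_sub (integrable_const _) (integrable_of_abs_le hv hvb),
      integral_val_eval, integral_const, probReal_univ, one_smul, cval]
  · refine integrable_of_abs_le (C := C * 1) ((hf.comp measurable_fst).mul
      ((hv.comp measurable_fst).sub (hv.comp measurable_snd))) fun q => ?_
    rw [abs_mul]
    exact mul_le_mul (hC _) (abs_val_sub_le _ _) (abs_nonneg _) ((abs_nonneg _).trans (hC q.1))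

variable {V : Type*} {G : SimpleGraph V}

theorem edgeSigma_le (le : G.edgeSet → G.edgeSet → Prop) (e : G.edgeSet) :
    edgeSigma le e ≤ (inferInstance : MeasurableSpace (Config G × Config G)) :=
  iSup_le fun f => ((measurable_pi_apply f.1).comp measurable_fst).comap_le

/-- Every event of the past becomes the preimage of an event under the map that freezes all later
coins, so its indicator is a function of the past coins. -/
theorem edgeSigma_le_comap (le : G.edgeSet → G.edgeSet → Prop) (e : G.edgeSet) :
    edgeSigma le e ≤ MeasurableSpace.comap
      (fun q : Config G × Config G => mix {f | le f e} q.1 fun _ => false) inferInstance := by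
  refine iSup_le fun f => ?_
  have : (fun q : Config G × Config G => q.1 f.1) =
      (fun ω : Config G => ω f.1) ∘ fun q => mix {f | le f e} q.1 fun _ => false := by
    funext q
    exact (mix_of_mem (J := {f | le f e}) f.2 q.1 fun _ => false).symm
  rw [this, ← MeasurableSpace.comap_comp]
  exact MeasurableSpace.comap_mono (measurable_pi_apply f.1).comap_le

theorem measurable_edgeSigma {le : G.edgeSet → G.edgeSet → Prop} {e : G.edgeSet}
    {f : Config G → ℝ} (hf : Measurable f) (hd : DependsOn f {f | le f e}) :
    Measurable[edgeSigma le e] fun q : Config G × Config G => f q.1 := by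
  have h1 : Measurable[edgeSigma le e] fun q : Config G × Config G =>
      mix {f | le f e} q.1 fun _ => false := by
    refine @measurable_pi_lambda _ _ _ (edgeSigma le e) _ _ fun i => ?_
    by_cases hi : le i e
    · have h2 : (fun q : Config G × Config G => mix {f | le f e} q.1 (fun _ => false) i) =
          fun q => q.1 i := funext fun q => mix_of_mem (J := {f | le f e}) hi _ _
      rw [h2, measurable_iff_comap_le]
      exact le_iSup (fun f : {f : G.edgeSet // le f e} => MeasurableSpace.comap
        (fun q : Config G × Config G => q.1 f.1) inferInstance) ⟨i, hi⟩
    · have h2 : (fun q : Config G × Config G => mix {f | le f e} q.1 (fun _ => false) i) =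
          fun _ => false := funext fun q => mix_of_notMem (J := {f | le f e}) hi _ _
      rw [h2]
      exact measurable_const
  have h3 : (fun q : Config G × Config G => f q.1) =
      fun q => f (mix {f | le f e} q.1 fun _ => false) :=
    funext fun q => hd fun i hi => (mix_of_mem hi _ _).symm
  rw [h3]
  exact hf.comp h1

/-- Integrating out the independent copy turns the difference of coins into the centred coin, and
projecting on the past averages `f`. Reflexivity at `e` ensures that the coin of `e` belongs to the
past. -/
theorem condExp_resample (p : unitInterval) {le : G.edgeSet → G.edgeSet → Prop} {e : G.edgeSet}
    (hle : le e e) {f : Config G → ℝ} (hf : Measurable f) {C : ℝ} (hC : ∀ ω, |f ω| ≤ C) :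
    (fun q : Config G × Config G =>
      increment (bernoulliMeasure true false p) (avg (bernoulliMeasure true false p)
        {i | le i e} f) e q.1) =ᵐ[resampling G p]
      (resampling G p)[fun q => f q.1 * (val (q.1 e) - val (q.2 e)) | edgeSigma le e] := by
  classical
  set ν := bernoulliMeasure true false p with hν
  have hY : Measurable (increment ν (avg ν {i | le i e} f) e) :=
    measurable_increment ν (measurable_avg ν _ hf) e
  have hYb : ∀ ω, |increment ν (avg ν {i | le i e} f) e ω| ≤ C := fun ω =>
    abs_increment_le ν (abs_avg_le ν _ hC ω) e
  have hYd : DependsOn (increment ν (avg ν {i | le i e} f) e) {i | le i e} :=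
    dependsOn_increment ν ((dependsOn_avg ν (dependsOn_univ f)).mono Set.inter_subset_left) hle
  have hval : Measurable val := measurable_of_finite _
  have hDm : Measurable fun q : Config G × Config G => f q.1 * (val (q.1 e) - val (q.2 e)) :=
    (hf.comp measurable_fst).mul ((hval.comp ((measurable_pi_apply e).comp measurable_fst)).sub
      (hval.comp ((measurable_pi_apply e).comp measurable_snd)))
  have hDb : ∀ q : Config G × Config G, |f q.1 * (val (q.1 e) - val (q.2 e))| ≤ C * 1 := fun q => by
    rw [abs_mul]
    exact mul_le_mul (hC _) (abs_val_sub_le _ _) (abs_nonneg _) ((abs_nonneg _).trans (hC q.1))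
  refine ae_eq_condExp_of_forall_setIntegral_eq (edgeSigma_le le e)
    (integrable_of_abs_le hDm hDb)
    (fun s _ _ => (integrable_of_abs_le (hY.comp measurable_fst) fun q => hYb q.1).integrableOn)
    (fun s hs _ => ?_) (measurable_edgeSigma hY hYd).stronglyMeasurable.aestronglyMeasurable
  obtain ⟨s', hs', rfl⟩ := edgeSigma_le_comap le e s hs
  set h : Config G → ℝ := fun ω =>
    s'.indicator (fun _ => 1) (mix {f | le f e} ω fun _ => false) with hh
  have hhm : Measurable h := (measurable_const.indicator hs').comp
    ((measurable_mix _).comp (measurable_id.prodMk measurable_const))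
  have hhb : ∀ ω, |h ω| ≤ 1 := fun ω => by
    simp only [hh, Set.indicator_apply]
    split_ifs <;> simp
  have hhd : DependsOn h {i | le i e} := fun ω ω' hω => by
    have : mix {f | le f e} ω (fun _ => false) = mix {f | le f e} ω' fun _ => false := by
      funext i
      exact mix_congr (K := Set.univ) (fun i hi => hω i hi.1) _ i trivial
    simp only [hh, this]
  have hset : ∀ F : Config G × Config G → ℝ,
      ∫ q in (fun q : Config G × Config G => mix {f | le f e} q.1 fun _ => false) ⁻¹' s', F q
        ∂resampling G p = ∫ q, h q.1 * F q ∂resampling G p := by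
    intro F
    rw [← integral_indicator (edgeSigma_le le e _ hs)]
    refine integral_congr_ae (ae_of_all _ fun q => ?_)
    simp only [hh, Set.indicator_apply, Set.mem_preimage]
    split_ifs <;> simp
  rw [hset, hset]
  have hcm : Measurable fun ω : Config G => h ω * cval ν (ω e) :=
    hhm.mul ((measurable_cval ν).comp (measurable_pi_apply e))
  have hcb : ∀ ω : Config G, |h ω * cval ν (ω e)| ≤ 1 * 1 := fun ω => by
    rw [abs_mul]
    exact mul_le_mul (hhb ω) (abs_cval_le ν _) (abs_nonneg _) zero_le_one
  have hcd : DependsOn (fun ω : Config G => h ω * cval ν (ω e)) {i | le i e} := fun ω ω' hω => by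
    simp only [hhd hω, hω e hle]
  -- First the resampled coin is integrated out, then `integral_mul_avg` replaces `f` by its average
  -- against a test function of the past.
  have h1 := integral_resample ν e (f := fun ω => h ω * f ω) (hhm.mul hf) (C := 1 * C) fun ω => by
    rw [abs_mul]
    exact mul_le_mul (hhb ω) (hC ω) (abs_nonneg _) zero_le_one
  have h2 := integral_mul_avg ν {i | le i e} hf hC hcm hcb hcd
  have h3 : ∫ q : Config G × Config G, h q.1 * increment ν (avg ν {i | le i e} f) e q.1
      ∂resampling G p = ∫ ω, h ω * increment ν (avg ν {i | le i e} f) e ω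
        ∂coinMeasure G.edgeSet ν :=
    integral_comp_of_measurePreserving (f := fun ω => h ω * increment ν (avg ν {i | le i e} f) e ω)
      (measurePreserving_fst (μ := percolation G p) (ν := percolation G p))
      (hhm.mul hY).stronglyMeasurable
  rw [h3]
  have h4 : ∫ q : Config G × Config G, h q.1 * (f q.1 * (val (q.1 e) - val (q.2 e)))
      ∂resampling G p = ∫ ω, h ω * f ω * cval ν (ω e) ∂coinMeasure G.edgeSet ν := by
    rw [← h1]
    refine integral_congr_ae (ae_of_all _ fun q => ?_)
    simp only [mul_assoc]
  rw [h4]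
  simp only [increment, ← mul_assoc]
  rw [h2]
  refine integral_congr_ae (ae_of_all _ fun ω => ?_)
  simp only [mul_right_comm]

end Resampling

/-! ### Resampling differences and their limits -/

section LimitDifference

variable {Γ : Type*} [Group Γ] {S : Finset Γ} (Δ : LocalComplexRule (cayley S)) (k : ℕ)

/-- The Betti number is affine in the single coin being resampled. -/
theorem bettiDifference_eq (e : (cayley S).edgeSet) (A : Finset Γ)
    (q : Config (cayley S) × Config (cayley S)) :
    bettiDifference Δ k e (A : Set Γ) q =
      influence e (bettiOn Δ k A) q.1 * (val (q.1 e) - val (q.2 e)) := by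
  have h1 : ∀ b, bettiOn Δ k A (setState e b q.1) =
      bettiOn Δ k A (setState e false q.1) + val b * influence e (bettiOn Δ k A) q.1 := by
    intro b
    cases b <;> simp [val, influence]
  have h2 := h1 (q.1 e)
  rw [setState_apply_self] at h2
  have h3 : bettiDifference Δ k e (A : Set Γ) q =
      bettiOn Δ k A q.1 - bettiOn Δ k A (setState e (q.2 e) q.1) := by
    simp only [bettiDifference, bettiOn, setState]
    congr!
  rw [h3, h2, h1 (q.2 e)]
  ring

/-- The limit of the change of the Betti number when an edge is resampled. -/
def limitDifference (e : (cayley S).edgeSet) (q : Config (cayley S) × Config (cayley S)) : ℝ :=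
  limitInfluence Δ k e q.1 * (val (q.1 e) - val (q.2 e))

theorem measurable_resample {f : Config (cayley S) → ℝ} (hf : Measurable f)
    (e : (cayley S).edgeSet) : Measurable fun q : Config (cayley S) × Config (cayley S) =>
      f q.1 * (val (q.1 e) - val (q.2 e)) :=
  have hval : Measurable val := measurable_of_finite _
  (hf.comp measurable_fst).mul ((hval.comp ((measurable_pi_apply e).comp measurable_fst)).sub
    (hval.comp ((measurable_pi_apply e).comp measurable_snd)))

theorem memLp_limitDifference [Countable Γ] (p : unitInterval) (e : (cayley S).edgeSet) :
    MemLp (limitDifference Δ k e) 2 (resampling (cayley S) p) := by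
  refine MemLp.of_bound (measurable_resample (measurable_limitInfluence Δ k e)
    e).aestronglyMeasurable (influenceBound Δ k * 1) (ae_of_all _ fun q => ?_)
  rw [Real.norm_eq_abs, limitDifference, abs_mul]
  exact mul_le_mul (abs_limitInfluence_le Δ k e _) (abs_val_sub_le _ _) (abs_nonneg _)
    (influenceBound_nonneg Δ k)

/-- Translates of an exhausting sequence still tend to infinity in the directed set of finite
windows, so convergence is even pointwise and the limit does not depend on `x`. -/
theorem tendstoInMeasure_bettiDifference (p : unitInterval)
    (e : (cayley S).edgeSet) (x : Γ) {A : ℕ → Finset Γ} (hA : Tendsto A atTop atTop) :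
    TendstoInMeasure (resampling (cayley S) p)
      (fun r => bettiDifference Δ k e ((x * ·) '' (A r : Set Γ))) atTop (limitDifference Δ k e) := by
  classical
  have h : ∀ r, bettiDifference Δ k e ((x * ·) '' (A r : Set Γ)) = fun q =>
      influence e (bettiOn Δ k ((A r).image (x * ·))) q.1 * (val (q.1 e) - val (q.2 e)) := by
    intro r
    funext q
    rw [← Finset.coe_image, bettiDifference_eq]
  simp only [h]
  refine tendstoInMeasure_of_tendsto_ae (fun r => (measurable_resample
    (measurable_influence_bettiOn Δ k _ e) e).aestronglyMeasurable) (ae_of_all _ fun q => ?_)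
  exact ((tendsto_influence_bettiOn Δ k e q.1).comp
    ((tendsto_translate_atTop x).comp hA)).mul_const _

theorem integral_condExp_limitDifference_sq [Countable Γ] (p : unitInterval)
    {le : (cayley S).edgeSet → (cayley S).edgeSet → Prop} {e : (cayley S).edgeSet}
    (hle : le e e) :
    ∫ q, (((resampling (cayley S) p)[limitDifference Δ k e | edgeSigma le e]) q) ^ 2
        ∂resampling (cayley S) p =
      ∫ ω, limitIncrement Δ k (bernoulliMeasure true false p) le e ω ^ 2
        ∂coinMeasure (cayley S).edgeSet (bernoulliMeasure true false p) := by
  have h1 := condExp_resample p hle (measurable_limitInfluence Δ k e) (abs_limitInfluence_le Δ k e)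
  have h2 : ∫ q, (((resampling (cayley S) p)[limitDifference Δ k e | edgeSigma le e]) q) ^ 2
        ∂resampling (cayley S) p = ∫ q : Config (cayley S) × Config (cayley S),
      limitIncrement Δ k (bernoulliMeasure true false p) le e q.1 ^ 2
        ∂resampling (cayley S) p := by
    refine integral_congr_ae ?_
    filter_upwards [h1] with q hq
    exact congrArg (· ^ 2) hq.symm
  rw [h2]
  exact integral_comp_of_measurePreserving
    (f := fun ω => limitIncrement Δ k (bernoulliMeasure true false p) le e ω ^ 2)
    (measurePreserving_fst (μ := percolation (cayley S) p) (ν := percolation (cayley S) p))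
    ((measurable_limitIncrement Δ k _ le e).pow_const 2).stronglyMeasurable

end LimitDifference

/-! ### A fundamental set with two edges in each orbit -/

section FundamentalSet

variable {Γ : Type*} [Group Γ] {S : Finset Γ} {H : Subgroup Γ}

open Classical in
/-- Two representatives of each orbit. -/
def OrbitReps.double (O : OrbitReps S H) (h : Γ) : Finset (cayley S).edgeSet :=
  O.reps ∪ O.reps.image (edgeTranslate S h)

theorem OrbitReps.isFundamental_double (O : OrbitReps S H) (h : Γ) :
    IsFundamental S H (O.double h) := by
  classical
  intro e
  refine ⟨(O.shift e)⁻¹, H.inv_mem (O.shift_mem e), Finset.mem_union_left _ ?_⟩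
  have h1 := congrArg (edgeTranslate S (O.shift e)⁻¹) (O.translate_rep e)
  rw [← edgeTranslate_mul, inv_mul_cancel, edgeTranslate_one] at h1
  rw [← h1]
  exact O.rep_mem e

/-- Representatives have shift one and their translates have shift `h`, so the two families are
disjoint. -/
theorem OrbitReps.sum_double (O : OrbitReps S H) {h : Γ} (hh : h ∈ H) (h1 : h ≠ 1)
    {φ : (cayley S).edgeSet → ℝ} (hφ : ∀ e, φ (edgeTranslate S h e) = φ e) :
    ∑ e ∈ O.double h, φ e = 2 * ∑ t ∈ O.reps, φ t := by
  classical
  have hinj : Function.Injective (edgeTranslate S h) := (edgeEquiv S h).injective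
  rw [OrbitReps.double, Finset.sum_union, Finset.sum_image hinj.injOn,
    Finset.sum_congr (g := φ) (s₁ := O.reps) rfl fun e _ => hφ e, two_mul]
  refine Finset.disjoint_left.2 fun t ht ht' => h1 ?_
  obtain ⟨t', ht1, rfl⟩ := Finset.mem_image.1 ht'
  have := O.shift_translate h hh t'
  rw [O.shift_of_mem _ ht, O.shift_of_mem _ ht1, mul_one] at this
  exact this.symm

theorem exists_ne_one_of_finiteIndex [Infinite Γ] (hH : H.FiniteIndex) : ∃ h ∈ H, h ≠ 1 := by
  by_contra! h
  rw [(Subgroup.eq_bot_iff_forall H).2 h] at hH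
  exact hH.index_ne_zero (by simp)

end FundamentalSet

end PercHom

end

theorem mainTheorem4 {Γ : Type*} [Group Γ] [Infinite Γ]
    (S : Finset Γ) (hSinv : ∀ s ∈ S, s⁻¹ ∈ S) (hSone : (1 : Γ) ∉ S)
    (hSgen : Subgroup.closure (S : Set Γ) = ⊤)
    (H : Subgroup Γ) (hHfin : H.FiniteIndex) (hHlo : IsLeftOrderable H)
    (p : unitInterval) (hp0 : 0 < p) (hp1 : p < 1)
    (A : ℕ → Finset Γ) (hA : IsExhaustiveFolner (cayley S) A)
    (Δ : LocalComplexRule (cayley S)) (k : ℕ) :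
    ∃ σ2 : ℝ≥0,
      -- convergence of the normalised variance
      Tendsto (fun r => (1 / ((A r).card : ℝ)) *
        variance (fun ω => bettiFunctional Δ k ω (A r))
          (percolation (cayley S) p)) atTop (𝓝 (σ2 : ℝ)) ∧
      -- central limit theorem
      TendstoInDistribution
        (fun r ω => (√((A r).card : ℝ))⁻¹ *
          (bettiFunctional Δ k ω (A r) -
            ∫ ω', bettiFunctional Δ k ω' (A r)
              ∂(percolation (cayley S) p)))
        atTop (id : ℝ → ℝ)
        (fun _ => percolation (cayley S) p) (gaussianReal 0 σ2) ∧
      -- the formula for the limiting variance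
      ∃ E' : Finset (cayley S).edgeSet, IsFundamental S H E' ∧
      ∃ Dinf : (cayley S).edgeSet →
          Config (cayley S) ×
            Config (cayley S) → ℝ,
        (∀ e, MemLp (Dinf e) 2 (resampling (cayley S) p)) ∧
        (∀ e, ∀ x : Γ, TendstoInMeasure (resampling (cayley S) p)
          (fun r => bettiDifference Δ k e ((x * ·) '' (A r : Set Γ))) atTop (Dinf e)) ∧
        (∃ le, IsInvariantOrder S H le) ∧
        ∀ le, IsInvariantOrder S H le →
          (σ2 : ℝ) = 1 / (2 * (H.index : ℝ)) * ∑ e ∈ E',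
            ∫ q, (((resampling (cayley S) p)[Dinf e | edgeSigma le e]) q) ^ 2
              ∂(resampling (cayley S) p) := by
  have := hA.countable
  set ν := bernoulliMeasure true false p with hν
  obtain ⟨O⟩ := nonempty_orbitReps S H hHfin hHlo
  obtain ⟨le, hle⟩ := O.exists_isInvariantOrder hHlo
  -- A nontrivial `h` supplies the second edge in each orbit, which absorbs the factor 2 in the
  -- denominator of the variance formula.
  obtain ⟨h, hh, hh1⟩ := exists_ne_one_of_finiteIndex hHfin
  have hclt := cltData Δ k ν hSgen hA hHfin hHlo O hle
  refine ⟨⟨limitVariance Δ k ν O le, limitVariance_nonneg Δ k ν O le⟩, hclt.tendsto_variance,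
    hclt.tendstoInDistribution rfl, O.double h, O.isFundamental_double h, limitDifference Δ k,
    fun e => memLp_limitDifference Δ k p e,
    fun e x => tendstoInMeasure_bettiDifference Δ k p e x hA.tendsto_atTop, ⟨le, hle⟩,
    fun le' hle' => ?_⟩
  have hclt' := cltData Δ k ν hSgen hA hHfin hHlo O hle'
  -- The normalised variances do not involve the order, so any two invariant orders give the same
  -- limit.
  refine (tendsto_nhds_unique hclt.tendsto_variance hclt'.tendsto_variance).trans ?_
  have hsum := O.sum_double hh hh1
    (φ := fun e => ∫ ω, limitIncrement Δ k ν le' e ω ^ 2 ∂coinMeasure (cayley S).edgeSet ν)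
    fun e => integral_sq_limitIncrement_translate Δ k ν hle' hh e
  rw [Finset.sum_congr rfl fun e _ =>
    integral_condExp_limitDifference_sq Δ k p (hle'.isLinearOrder.refl e), hsum, limitVariance]
  have : (H.index : ℝ) ≠ 0 := by exact_mod_cast hHfin.index_ne_zero
  field_simp
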